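/- For a prime $p$, write $a \bmod p$ for the residue of $a$ in $\{0,\dots,p-1\}$. All graphs are finite, and a bipartite graph $G=(L_G,R_G,E_G)$ comes with a fixed ordered bipartition of its vertex set $V(G)=L_G\mathbin{\dot\cup} R_G$. For bipartite graphs $G,H$ let $\mathrm{Hom}^{\mathrm{bip}}(G,H)$ be the set of graph homomorphisms $\sigma$ from $G$ to $H$ with $\sigma(L_G)\subseteq L_H$ and $\sigma(R_G)\subseteq R_H$. For tuples $\bar u\in V(G)^r$, $\bar w\in V(H)^r$ (repetitions allowed) let $\mathrm{Hom}^{\mathrm{bip}}((G,\bar u),(H,\bar w))$ be the set of those $\sigma\in\mathrm{Hom}^{\mathrm{bip}}(G,H)$ with $\sigma(u_i)=w_i$ for all $i$. Let $p$ be a prime and let $H=(L_H,R_H,E_H)$ be a bipartite graph that is partition-wise order $p$ reduced, i.e. no automorphism of $H$ that maps $L_H$ to $L_H$ and $R_H$ to $R_H$ has order $p$. Consider the following problems, in which $H$ and $p$ are fixed. - $\#\mathrm{BipHomsTo}_H[p]$: given a bipartite graph $G$, compute $|\mathrm{Hom}^{\mathrm{bip}}(G,H)| \bmod p$. - $\#\mathrm{BipPartLabHomsTo}_H[p]$: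 given a bipartite graph $G$, an integer $r>0$ and tuples $\bar u\in V(G)^r$, $\bar w\in V(H)^r$, compute $|\mathrm{Hom}^{\mathrm{bip}}((G,\bar u),(H,\bar w))| \bmod p$. - $\#\mathrm{BipPartLabHomsTo}_{(H,\bar w)}[p]$, for fixed $r>0$ and $\bar w\in V(H)^r$: given a bipartite graph $G$ and a tuple $\bar u\in V(G)^r$, compute $|\mathrm{Hom}^{\mathrm{bip}}((G,\bar u),(H,\bar w))| \bmod p$. Then $\#\mathrm{BipPartLabHomsTo}_H[p]$ and $\#\mathrm{BipHomsTo}_H[p]$ are equivalent under polynomial-time Turing reductions. Moreover, for every $r>0$ and every $\bar w\in V(H)^r$, also $\#\mathrm{BipPartLabHomsTo}_{(H,\bar w)}[p]$ and $\#\mathrm{BipHomsTo}_H[p]$ are equivalent under polynomial-time Turing reductions. -/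

import Mathlib

/-! ### Bipartite graphs with a fixed bipartition -/

/-- A bipartite graph `(L, R, E)` with vertex set `V` and a fixed ordered bipartition: `V` is the
disjoint union of `left` and `right`, and every edge joins a left vertex to a right vertex. -/
structure BipGraph (V : Type*) where
  graph : SimpleGraph V
  left : Set V
  right : Set V
  isBipartite : graph.IsBipartiteWith left right
  cover : left ∪ right = Set.univ

namespace BipGraph

/-- Homomorphisms from `G` to `H` that preserve the order of the bipartition. -/
def Hom {V W : Type*} (G : BipGraph V) (H : BipGraph W) : Type _ :=
  {σ : G.graph →g H.graph // (∀ v ∈ G.left, σ v ∈ H.left) ∧ (∀ v ∈ G.right, σ v ∈ H.right)}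

/-- The number of bipartition-preserving homomorphisms from `G` to `H`. -/
noncomputable def numHom {V W : Type*} (G : BipGraph V) (H : BipGraph W) : ℕ :=
  Nat.card (G.Hom H)

/-- The number of bipartition-preserving homomorphisms from `(G, u)` to `(H, w)`, where
`u` and `w` are tuples of `r` distinguished vertices (repetitions allowed). -/
noncomputable def numPinnedHom {V W : Type*} {r : ℕ} (G : BipGraph V) (u : Fin r → V)
    (H : BipGraph W) (w : Fin r → W) : ℕ :=
  Nat.card {σ : G.Hom H // ∀ i, σ.1 (u i) = w i}

/-- `H` is partition-wise order `p` reduced: no automorphism of `H` that maps left vertices to left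
vertices and right vertices to right vertices has order `p`. -/
def PartitionwiseReduced {V : Type*} (H : BipGraph V) (p : ℕ) : Prop :=
  ¬ ∃ φ : H.graph ≃g H.graph,
    (∀ v ∈ H.left, φ v ∈ H.left) ∧ (∀ v ∈ H.right, φ v ∈ H.right) ∧ orderOf φ = p

end BipGraph

/-! ### Oracle machines with a step count

The machine has finitely many stacks of bits (those that its program mentions), finite control in
the form of a structured program, and an oracle for a function on bit strings. It inspects only the
top of a stack, and each elementary operation costs one step. Up to a polynomial (without the oracle:
a constant) overhead in time, this is a deterministic multitape oracle Turing machine: a tape is a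
pair of stacks, and a state of a finite control is a bounded string on a stack. -/

/-- Programs of the machine. Tests depend on the top bit of one stack (`none` if it is empty). -/
inductive OracleProg : Type
  | skip : OracleProg
  | push (i : ℕ) (b : Bool) : OracleProg
  | pop (i : ℕ) : OracleProg
  | seq (P Q : OracleProg) : OracleProg
  | cond (i : ℕ) (f : Option Bool → Bool) (P Q : OracleProg) : OracleProg
  | loop (i : ℕ) (f : Option Bool → Bool) (P : OracleProg) : OracleProg
  | query (i j : ℕ) : OracleProg

/-- The contents of the stacks, the top of a stack being the head of the list. -/
abbrev Store : Type := ℕ → List Bool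

/-- `Runs O P s t s'`: with oracle `O`, the program `P` started on `s` halts on `s'` after exactly
`t` steps. `query i j` replaces stack `j` by the answer of the oracle to the string on stack `i`,
and is charged for the lengths of both. `loop i f P` repeats `P` while the test `f` holds. -/
inductive Runs (O : List Bool → List Bool) : OracleProg → Store → ℕ → Store → Prop
  | skip (s : Store) : Runs O .skip s 1 s
  | push (i : ℕ) (b : Bool) (s : Store) :
      Runs O (.push i b) s 1 (Function.update s i (b :: s i))
  | pop (i : ℕ) (s : Store) : Runs O (.pop i) s 1 (Function.update s i (s i).tail)
  | seq {P Q : OracleProg} {s s' s'' : Store} {t t' : ℕ} :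
      Runs O P s t s' → Runs O Q s' t' s'' → Runs O (.seq P Q) s (t + t') s''
  | cond_true {i : ℕ} {f : Option Bool → Bool} {P Q : OracleProg} {s s' : Store} {t : ℕ} :
      f (s i).head? = true → Runs O P s t s' → Runs O (.cond i f P Q) s (1 + t) s'
  | cond_false {i : ℕ} {f : Option Bool → Bool} {P Q : OracleProg} {s s' : Store} {t : ℕ} :
      f (s i).head? = false → Runs O Q s t s' → Runs O (.cond i f P Q) s (1 + t) s'
  | loop_done {i : ℕ} {f : Option Bool → Bool} {P : OracleProg} {s : Store} :
      f (s i).head? = false → Runs O (.loop i f P) s 1 s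
  | loop_step {i : ℕ} {f : Option Bool → Bool} {P : OracleProg} {s s' s'' : Store} {t t' : ℕ} :
      f (s i).head? = true → Runs O P s t s' → Runs O (.loop i f P) s' t' s'' →
        Runs O (.loop i f P) s (1 + t + t') s''
  | query (i j : ℕ) (s : Store) :
      Runs O (.query i j) s (1 + (s i).length + (O (s i)).length)
        (Function.update s j (O (s i)))

/-- The initial store: the input is on stack `0`, all other stacks are empty. -/
def initStore (x : List Bool) : Store := Function.update (fun _ => []) 0 x

/-- With oracle `O`, the program `P` on input `x` halts within `T` steps with the string `y` on the
output stack `1`. -/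
def OutputsWithin (O : List Bool → List Bool) (P : OracleProg) (x y : List Bool) (T : ℕ) : Prop :=
  ∃ (t : ℕ) (s : Store), Runs O P (initStore x) t s ∧ t ≤ T ∧ s 1 = y

/-! ### Function problems and polynomial-time Turing reductions -/

/-- A computational problem: instances, coded as bit strings, and the required output string. -/
structure FunProblem where
  Inst : Type*
  code : Inst → List Bool
  code_injective : Function.Injective code
  answer : Inst → List Bool

namespace FunProblem

/-- The oracle `O` solves the problem `Q` (its answers to non-instances are arbitrary). -/
def Solves (O : List Bool → List Bool) (Q : FunProblem) : Prop :=
  ∀ x : Q.Inst, O (Q.code x) = Q.answer x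

/-- Polynomial-time Turing reducibility: one oracle program and one polynomial time bound such that,
with any oracle for `Q`, the program solves every instance of `P` within the time bound. -/
def TuringReduces (P Q : FunProblem) : Prop :=
  ∃ (M : OracleProg) (q : Polynomial ℕ), ∀ O : List Bool → List Bool, Solves O Q →
    ∀ x : P.Inst, OutputsWithin O M (P.code x) (P.answer x) (q.eval (P.code x).length)

/-- Equivalence under polynomial-time Turing reductions. -/
def TuringEquivalent (P Q : FunProblem) : Prop :=
  TuringReduces P Q ∧ TuringReduces Q P

end FunProblem

/-! ### Codes of instances -/

/-- Self-delimiting unary code of a natural number. -/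
def natCode (n : ℕ) : List Bool := List.replicate n true ++ [false]

/-- Self-delimiting code of a list, from a self-delimiting code `f` of its entries. -/
def listCode {α : Type*} (f : α → List Bool) : List α → List Bool
  | [] => [false]
  | x :: l => true :: (f x ++ listCode f l)

/-- An input bipartite graph: left vertices `Fin a`, right vertices `Fin b`, and a list of edges
(in any order; an edge that is listed repeatedly counts once). -/
structure BipInput where
  a : ℕ
  b : ℕ
  edges : List (Fin a × Fin b)

namespace BipInput

/-- The vertices of an input graph. -/
abbrev Vertex (G : BipInput) : Type := Fin G.a ⊕ Fin G.b

/-- The adjacency relation given by the list of edges. -/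
def Adj (G : BipInput) : G.Vertex → G.Vertex → Prop
  | .inl i, .inr j => (i, j) ∈ G.edges
  | .inr j, .inl i => (i, j) ∈ G.edges
  | _, _ => False

/-- The bipartite graph described by the input. -/
def toBipGraph (G : BipInput) : BipGraph G.Vertex where
  graph :=
    { Adj := G.Adj
      symm := ⟨by rintro (i | j) (i' | j') h <;> exact h⟩
      loopless := ⟨by rintro (i | j) h <;> exact h⟩ }
  left := Set.range Sum.inl
  right := Set.range Sum.inr
  isBipartite := by
    refine ⟨Set.isCompl_range_inl_range_inr.disjoint, ?_⟩
    rintro (i | j) (i' | j') h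
    · exact h.elim
    · exact Or.inl ⟨⟨i, rfl⟩, ⟨j', rfl⟩⟩
    · exact Or.inr ⟨⟨j, rfl⟩, ⟨i', rfl⟩⟩
    · exact h.elim
  cover := Set.range_inl_union_range_inr

/-- The code of a graph: both numbers of vertices, then the list of edges. -/
def code (G : BipInput) : List Bool :=
  natCode G.a ++ natCode G.b ++
    listCode (fun e : Fin G.a × Fin G.b => natCode e.1 ++ natCode e.2) G.edges

/-- The code of a vertex: its side, then its number on that side. -/
def vertexCode (G : BipInput) : G.Vertex → List Bool
  | .inl i => false :: natCode i
  | .inr j => true :: natCode j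

end BipInput

/-- An input graph with `r` distinguished vertices (repetitions allowed). -/
structure DistInput (r : ℕ) where
  graph : BipInput
  u : Fin r → graph.Vertex

/-- A partially labelled input graph: a graph with a positive number `r` of distinguished vertices
and, for each of them, the vertex in `V` to which it is pinned. -/
structure LabInput (V : Type*) where
  graph : BipInput
  r : ℕ
  r_pos : 0 < r
  u : Fin r → graph.Vertex
  w : Fin r → V

/-- The code of a graph with distinguished vertices. -/
def DistInput.code {r : ℕ} (x : DistInput r) : List Bool :=
  x.graph.code ++ listCode x.graph.vertexCode (List.ofFn x.u)

/-- The code of a partially labelled graph, with respect to a numbering `e` of `V`. -/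
def LabInput.code {V : Type*} {m : ℕ} (e : V ≃ Fin m) (x : LabInput V) : List Bool :=
  x.graph.code ++ listCode (fun y : x.graph.Vertex × V => x.graph.vertexCode y.1 ++ natCode (e y.2))
    (List.ofFn fun i => (x.u i, x.w i))

/-! ### The codes are injective -/

theorem natCode_append_inj {m n : ℕ} {s t : List Bool} (h : natCode m ++ s = natCode n ++ t) :
    m = n ∧ s = t := by
  induction m generalizing n with
  | zero => cases n <;> simp_all [natCode, List.replicate_succ]
  | succ m ih =>
    cases n with
    | zero => simp [natCode, List.replicate_succ] at h
    | succ n =>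
      have h' : natCode m ++ s = natCode n ++ t := by
        simpa [natCode, List.replicate_succ] using h
      obtain ⟨h1, h2⟩ := ih h'
      exact ⟨by omega, h2⟩

theorem listCode_append_inj {α : Type*} {f : α → List Bool}
    (hf : ∀ {x y : α} {s t : List Bool}, f x ++ s = f y ++ t → x = y ∧ s = t)
    {l l' : List α} {s t : List Bool} (h : listCode f l ++ s = listCode f l' ++ t) :
    l = l' ∧ s = t := by
  induction l generalizing l' with
  | nil => cases l' <;> simp_all [listCode]
  | cons x l ih =>
    cases l' with
    | nil => simp [listCode] at h
    | cons y l' =>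
      simp only [listCode, List.cons_append, List.append_assoc, List.cons.injEq, true_and] at h
      obtain ⟨rfl, h2⟩ := hf h
      obtain ⟨rfl, h3⟩ := ih h2
      exact ⟨rfl, h3⟩

theorem pairCode_append_inj {a b : ℕ} {x y : Fin a × Fin b} {s t : List Bool}
    (h : (natCode x.1 ++ natCode x.2) ++ s = (natCode y.1 ++ natCode y.2) ++ t) :
    x = y ∧ s = t := by
  simp only [List.append_assoc] at h
  obtain ⟨h1, h⟩ := natCode_append_inj h
  obtain ⟨h2, h⟩ := natCode_append_inj h
  exact ⟨Prod.ext (Fin.ext h1) (Fin.ext h2), h⟩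

theorem BipInput.code_append_inj {G G' : BipInput} {s t : List Bool}
    (h : G.code ++ s = G'.code ++ t) : G = G' ∧ s = t := by
  obtain ⟨a, b, l⟩ := G
  obtain ⟨a', b', l'⟩ := G'
  simp only [BipInput.code, List.append_assoc] at h
  obtain ⟨rfl, h⟩ := natCode_append_inj h
  obtain ⟨rfl, h⟩ := natCode_append_inj h
  obtain ⟨h1, h2⟩ := listCode_append_inj pairCode_append_inj h
  exact ⟨by rw [h1], h2⟩

theorem BipInput.code_injective : Function.Injective BipInput.code := fun G G' h =>
  (BipInput.code_append_inj (s := []) (t := []) (by rw [h])).1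

theorem BipInput.vertexCode_append_inj (G : BipInput) {x y : G.Vertex} {s t : List Bool}
    (h : G.vertexCode x ++ s = G.vertexCode y ++ t) : x = y ∧ s = t := by
  rcases x with i | i <;> rcases y with j | j <;>
    simp only [BipInput.vertexCode, List.cons_append, List.cons.injEq, true_and, reduceCtorEq,
      false_and] at h
  · obtain ⟨h1, h2⟩ := natCode_append_inj h
    exact ⟨congrArg _ (Fin.ext h1), h2⟩
  · obtain ⟨h1, h2⟩ := natCode_append_inj h
    exact ⟨congrArg _ (Fin.ext h1), h2⟩

theorem DistInput.code_injective {r : ℕ} : Function.Injective (DistInput.code (r := r)) := by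
  rintro ⟨G, u⟩ ⟨G', u'⟩ h
  have hG : G = G' := (BipInput.code_append_inj h).1
  subst hG
  have h' := (BipInput.code_append_inj h).2
  have hu := (listCode_append_inj (s := []) (t := []) G.vertexCode_append_inj
    (congrArg (· ++ []) h')).1
  have hu' : u = u' := List.ofFn_injective hu
  rw [hu']

theorem LabInput.code_injective {V : Type*} {m : ℕ} (e : V ≃ Fin m) :
    Function.Injective (LabInput.code e) := by
  rintro ⟨G, r, hr, u, w⟩ ⟨G', r', hr', u', w'⟩ h
  have hG : G = G' := (BipInput.code_append_inj h).1
  subst hG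
  have h' := (BipInput.code_append_inj h).2
  have hf : ∀ {x y : G.Vertex × V} {s t : List Bool},
      (G.vertexCode x.1 ++ natCode (e x.2)) ++ s = (G.vertexCode y.1 ++ natCode (e y.2)) ++ t →
        x = y ∧ s = t := by
    intro x y s t hxy
    simp only [List.append_assoc] at hxy
    obtain ⟨h1, hxy⟩ := G.vertexCode_append_inj hxy
    obtain ⟨h2, hxy⟩ := natCode_append_inj hxy
    exact ⟨Prod.ext h1 (e.injective (Fin.ext h2)), hxy⟩
  have hl : (List.ofFn fun i => (u i, w i)) = List.ofFn fun i => (u' i, w' i) :=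
    (listCode_append_inj (s := []) (t := []) hf (congrArg (· ++ []) h')).1
  have hr : r = r' := by simpa using congrArg List.length hl
  subst hr
  have huw := List.ofFn_injective hl
  obtain rfl : u = u' := funext fun i => congrArg Prod.fst (congrFun huw i)
  obtain rfl : w = w' := funext fun i => congrArg Prod.snd (congrFun huw i)
  rfl

/-! ### The counting problems -/

/-- Given a bipartite graph `G`, compute modulo `p` the number of bipartition-preserving
homomorphisms from `G` to the fixed graph `H`. -/
noncomputable def bipHomsTo {V : Type*} (H : BipGraph V) (p : ℕ) : FunProblem where
  Inst := BipInput
  code := BipInput.code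
  code_injective := BipInput.code_injective
  answer G := natCode (G.toBipGraph.numHom H % p)

/-- Given a partially labelled bipartite graph, that is, a bipartite graph `G` with `r > 0`
distinguished vertices `u` and a tuple `w` of `r` vertices of the fixed graph `H`, compute modulo `p`
the number of bipartition-preserving homomorphisms from `(G, u)` to `(H, w)`. -/
noncomputable def bipPartLabHomsTo {V : Type*} {m : ℕ} (e : V ≃ Fin m) (H : BipGraph V) (p : ℕ) :
    FunProblem where
  Inst := LabInput V
  code := LabInput.code e
  code_injective := LabInput.code_injective e
  answer x := natCode (x.graph.toBipGraph.numPinnedHom x.u H x.w % p)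

/-- The version in which the tuple `w` is fixed together with `H`: given a bipartite graph `G` with
`r` distinguished vertices `u`, compute modulo `p` the number of bipartition-preserving
homomorphisms from `(G, u)` to `(H, w)`. -/
noncomputable def bipPartLabHomsToFixed {V : Type*} {r : ℕ} (H : BipGraph V) (w : Fin r → V)
    (p : ℕ) : FunProblem where
  Inst := DistInput r
  code := DistInput.code
  code_injective := DistInput.code_injective
  answer x := natCode (x.graph.toBipGraph.numPinnedHom x.u H w % p)

/-! From plain to pinned counting, isolated vertices suffice: give `G` one new isolated vertex for
each entry of `w`, on the side of that entry, and pin it there. A pinned homomorphism of the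
extended graph is the same as a homomorphism of `G` (`numPinnedHom_extend`), so a single query
answers the question.

From pinned to plain counting, replace each label `w i` by a vertex of a copy of `H` inside the
query. Consider the pairs `(σ, y)` of homomorphisms `σ : G → H` and `y : H → H` with `σ (u i) = y (w
i)` for all `i`. If `y` is injective, it is an automorphism because `H` is finite, and `y⁻¹ ∘ σ`
respects the pins; hence there are `|Aut H|` times as many such pairs as pinned homomorphisms
(`card_pairHom_injective`). By Cauchy's theorem, `p` does not divide `|Aut H|`, so this factor can
be cancelled modulo `p` (`not_dvd_card_autGroup`).

Injectivity of `y` is removed by inclusion and exclusion over the sets `S` of pairs of distinct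
vertices on the same side of `H` (`sum_card_pairHom`). The pairs `(σ, y)` in which `y` identifies
all pairs in `S` are the homomorphisms to `H` from one graph: the disjoint union of `H` and `G`, in
which `u i` is glued to `w i` and the pairs in `S` are glued together (`card_solution_union`,
`card_solution_mergePairs`). There are only constantly many sets `S`, so the pinned count modulo `p`
is a fixed linear combination of constantly many oracle answers (`sum_coefficient_mod`). If some
label lies on the wrong side, the count is zero and no gluing is meaningful; the program detects
this case.

The rest is the implementation on the stack machine. Numbers are unary, the glued graph is computed
by identifying one pair at a time and renumbering (`mergePairs`), and every quantity is bounded by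
`K`, the input length plus a constant, which gives a polynomial time bound. -/

section

open Function

/-! ### Running programs within a time bound -/

/-- The program `P` started on `s` halts on `s'` within `T` steps. -/
def RunsWithin (O : List Bool → List Bool) (P : OracleProg) (s s' : Store) (T : ℕ) : Prop :=
  ∃ t ≤ T, Runs O P s t s'

/-- The string `1 ⋯ 1` of length `n`. -/
abbrev ones (n : ℕ) : List Bool := List.replicate n true

/-- The concatenation of the codes of a list of numbers. -/
def numsCode (l : List ℕ) : List Bool := l.flatMap natCode

theorem natCode_append (n : ℕ) (r : List Bool) : natCode n ++ r = ones n ++ false :: r := by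
  simp [natCode]

theorem ones_append_natCode_append (k n : ℕ) (r : List Bool) :
    ones k ++ (ones n ++ false :: r) = natCode (k + n) ++ r := by
  rw [natCode_append, ← List.append_assoc, ← List.replicate_add]

theorem ones_append_cons (n : ℕ) (l : List Bool) : ones n ++ true :: l = true :: (ones n ++ l) := by
  induction n with
  | zero => rfl
  | succ n ih => simpa [List.replicate_succ] using ih

theorem length_natCode (n : ℕ) : (natCode n).length = n + 1 := by simp [natCode]

theorem numsCode_cons (n : ℕ) (l : List ℕ) : numsCode (n :: l) = natCode n ++ numsCode l := rfl

theorem numsCode_append (l l' : List ℕ) : numsCode (l ++ l') = numsCode l ++ numsCode l' := by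
  simp [numsCode]

/-- The test whether the top bit is `1`. -/
def topTrue (o : Option Bool) : Bool := o == some true

/-- The test whether a stack is nonempty. -/
def nonempty (o : Option Bool) : Bool := o.isSome

namespace RunsWithin

variable {O : List Bool → List Bool} {P Q : OracleProg} {s s' s'' : Store} {T T' : ℕ} {i : ℕ}
  {f : Option Bool → Bool}

theorem mono (h : RunsWithin O P s s' T) (hT : T ≤ T') : RunsWithin O P s s' T' := by
  obtain ⟨t, ht, h⟩ := h
  exact ⟨t, ht.trans hT, h⟩

/-- Separates the composition of runs from the verification: the final store and the time are first
whatever the composition yields, and are compared with the intended ones afterwards. -/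
theorem of_eq (h : RunsWithin O P s s' T) (hs : s' = s'') (hT : T ≤ T') :
    RunsWithin O P s s'' T' := hs ▸ h.mono hT

theorem of_eq' (h : RunsWithin O P s s'' T) (hs : s' = s) : RunsWithin O P s' s'' T := hs ▸ h

theorem skip : RunsWithin O .skip s s 1 := ⟨1, le_rfl, .skip s⟩

theorem push (i : ℕ) (b : Bool) : RunsWithin O (.push i b) s (update s i (b :: s i)) 1 :=
  ⟨1, le_rfl, .push i b s⟩

theorem pop (i : ℕ) : RunsWithin O (.pop i) s (update s i (s i).tail) 1 := ⟨1, le_rfl, .pop i s⟩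

theorem seq (h : RunsWithin O P s s' T) (h' : RunsWithin O Q s' s'' T') :
    RunsWithin O (.seq P Q) s s'' (T + T') := by
  obtain ⟨t, ht, h⟩ := h
  obtain ⟨t', ht', h'⟩ := h'
  exact ⟨t + t', by omega, .seq h h'⟩

theorem cond_true (hf : f (s i).head? = true) (h : RunsWithin O P s s' T) :
    RunsWithin O (.cond i f P Q) s s' (1 + T) := by
  obtain ⟨t, ht, h⟩ := h
  exact ⟨1 + t, by omega, .cond_true hf h⟩

theorem cond_false (hf : f (s i).head? = false) (h : RunsWithin O Q s s' T) :
    RunsWithin O (.cond i f P Q) s s' (1 + T) := by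
  obtain ⟨t, ht, h⟩ := h
  exact ⟨1 + t, by omega, .cond_false hf h⟩

theorem loop_done (hf : f (s i).head? = false) : RunsWithin O (.loop i f P) s s 1 :=
  ⟨1, le_rfl, .loop_done hf⟩

theorem loop_step (hf : f (s i).head? = true) (h : RunsWithin O P s s' T)
    (h' : RunsWithin O (.loop i f P) s' s'' T') : RunsWithin O (.loop i f P) s s'' (1 + T + T') := by
  obtain ⟨t, ht, h⟩ := h
  obtain ⟨t', ht', h'⟩ := h'
  exact ⟨1 + t + t', by omega, .loop_step hf h h'⟩

theorem query (i j : ℕ) :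
    RunsWithin O (.query i j) s (update s j (O (s i))) (1 + (s i).length + (O (s i)).length) :=
  ⟨_, le_rfl, .query i j s⟩

end RunsWithin

/-! ### Elementary programs -/

namespace OracleProg

/-- Moves the leading ones of stack `i` to stack `j`. -/
def moveOnes (i j : ℕ) : OracleProg := .loop i topTrue (.seq (.pop i) (.push j true))

/-- Moves all bits of stack `i` to stack `j`, in reversed order. -/
def moveBits (i j : ℕ) : OracleProg :=
  .loop i nonempty (.seq (.cond i topTrue (.push j true) (.push j false)) (.pop i))

/-- Moves all bits of stack `i` to both `j` and `k`, in reversed order. -/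
def moveBitsTwice (i j k : ℕ) : OracleProg :=
  .loop i nonempty (.seq (.cond i topTrue (.seq (.push j true) (.push k true))
    (.seq (.push j false) (.push k false))) (.pop i))

/-- Empties stack `i`. -/
def clear (i : ℕ) : OracleProg := .loop i nonempty (.pop i)

/-- Puts the string `l` on top of stack `i`. -/
def write (i : ℕ) : List Bool → OracleProg
  | [] => .skip
  | b :: l => .seq (write i l) (.push i b)

/-- Moves a number from stack `i` to stack `j` and adds `k` to it. -/
def moveNum (i j k : ℕ) : OracleProg :=
  .seq (.push j false) (.seq (moveOnes i j) (.seq (.pop i) (write j (ones k))))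

end OracleProg

open OracleProg

variable {O : List Bool → List Bool}

/-- The condition on `r` makes the loop stop exactly after the `n` ones, either at a delimiter or at
the bottom of the stack. -/
theorem runsWithin_moveOnes {i j : ℕ} (hij : i ≠ j) {n : ℕ} {r : List Bool}
    (hr : topTrue r.head? = false) {s : Store} (hs : s i = ones n ++ r) :
    RunsWithin O (moveOnes i j) s (update (update s i r) j (ones n ++ s j)) (3 * n + 1) := by
  induction n generalizing s with
  | zero =>
    refine (RunsWithin.loop_done (by simpa [hs] using hr)).of_eq ?_ (by omega)
    funext k
    grind [Function.update_apply]
  | succ n ih =>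
    refine (RunsWithin.loop_step (by simp [hs, List.replicate_succ, topTrue])
      ((RunsWithin.pop i).seq (RunsWithin.push j true)) (ih (by grind))).of_eq ?_ (by omega)
    funext k
    grind [Function.update_apply, ones_append_cons]

theorem runsWithin_moveBits {i j : ℕ} (hij : i ≠ j) {s : Store} {l : List Bool} (hs : s i = l) :
    RunsWithin O (moveBits i j) s (update (update s i []) j (l.reverse ++ s j))
      (4 * l.length + 1) := by
  induction l generalizing s with
  | nil =>
    refine (RunsWithin.loop_done (by simp [hs, nonempty])).of_eq ?_ (by simp)
    funext k
    grind [Function.update_apply]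
  | cons b l ih =>
    have h : RunsWithin O (.cond i topTrue (.push j true) (.push j false)) s
        (update s j (b :: s j)) 2 := by
      cases b
      · exact .cond_false (by simp [hs, topTrue]) (.push j false)
      · exact .cond_true (by simp [hs, topTrue]) (.push j true)
    refine (RunsWithin.loop_step (by simp [hs, nonempty]) (h.seq (.pop i))
      (ih (by grind))).of_eq ?_ (by simp; omega)
    funext k
    grind [Function.update_apply]

theorem runsWithin_moveBitsTwice {i j k : ℕ} (hij : i ≠ j) (hik : i ≠ k) (hjk : j ≠ k) {s : Store}
    {l : List Bool} (hs : s i = l) :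
    RunsWithin O (moveBitsTwice i j k) s
      (update (update (update s i []) j (l.reverse ++ s j)) k (l.reverse ++ s k))
      (5 * l.length + 1) := by
  induction l generalizing s with
  | nil =>
    refine (RunsWithin.loop_done (by simp [hs, nonempty])).of_eq ?_ (by simp)
    funext k
    grind [Function.update_apply]
  | cons b l ih =>
    have h : RunsWithin O (.cond i topTrue (.seq (.push j true) (.push k true))
        (.seq (.push j false) (.push k false))) s
        (update (update s j (b :: s j)) k (b :: s k)) 3 := by
      have hk : ∀ b, update s j (b :: s j) k = s k := fun b => by simp [hjk.symm]
      cases b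
      · exact .cond_false (by simp [hs, topTrue])
          (((RunsWithin.push j false).seq (.push k false)).of_eq (by rw [hk]) le_rfl)
      · exact .cond_true (by simp [hs, topTrue])
          (((RunsWithin.push j true).seq (.push k true)).of_eq (by rw [hk]) le_rfl)
    refine (RunsWithin.loop_step (by simp [hs, nonempty]) (h.seq (.pop i))
      (ih (by grind))).of_eq ?_ (by simp; omega)
    funext k
    grind [Function.update_apply]

theorem runsWithin_clear {i : ℕ} {s : Store} {l : List Bool} (hs : s i = l) :
    RunsWithin O (clear i) s (update s i []) (2 * l.length + 1) := by
  induction l generalizing s with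
  | nil =>
    refine (RunsWithin.loop_done (by simp [hs, nonempty])).of_eq ?_ (by simp)
    funext k
    grind [Function.update_apply]
  | cons b l ih =>
    refine (RunsWithin.loop_step (by simp [hs, nonempty]) (.pop i)
      (ih (by grind))).of_eq ?_ (by simp; omega)
    simp

theorem runsWithin_write (i : ℕ) (l : List Bool) (s : Store) :
    RunsWithin O (write i l) s (update s i (l ++ s i)) (l.length + 1) := by
  induction l with
  | nil => exact RunsWithin.skip.of_eq (by simp) (by simp)
  | cons b l ih => exact (ih.seq (.push i b)).of_eq (by simp) (by simp)

/-- A stack is written from the end, so the delimiter of the copy goes down before its ones. The `k`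
additional ones on top perform the addition. -/
theorem runsWithin_moveNum {i j : ℕ} (hij : i ≠ j) (k : ℕ) {n : ℕ} {r : List Bool} {s : Store}
    (hs : s i = natCode n ++ r) :
    RunsWithin O (moveNum i j k) s (update (update s i r) j (natCode (k + n) ++ s j))
      (3 * n + k + 4) := by
  rw [natCode_append] at hs
  have h1 := RunsWithin.push (O := O) (s := s) j false
  have h2 := runsWithin_moveOnes (O := O) hij (r := false :: r) (n := n)
    (s := update s j (false :: s j)) rfl (by grind)
  refine (h1.seq (h2.seq ((RunsWithin.pop i).seq (runsWithin_write j (ones k) _)))).of_eq ?_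
    (by simp; omega)
  funext m
  grind [Function.update_apply, ones_append_natCode_append]

end

section

open Function
open OracleProg

variable {O : List Bool → List Bool}

/-! ### Stores with auxiliary stacks -/

/-- The store that agrees with `b` except that the stacks `11` to `17` are given. -/
def frame (b : Store) (x11 x12 x13 x14 x15 x16 x17 : List Bool) : Store := fun k =>
  if k = 11 then x11 else if k = 12 then x12 else if k = 13 then x13 else if k = 14 then x14
  else if k = 15 then x15 else if k = 16 then x16 else if k = 17 then x17 else b k

section frame

variable (b : Store) (x11 x12 x13 x14 x15 x16 x17 y : List Bool)

/-- Lookup and update in normal form, one pair of rules for each stack: with these as simp lemmas,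
the store after any sequence of elementary operations is again an explicit `frame`. -/
theorem frame_apply_11 : frame b x11 x12 x13 x14 x15 x16 x17 11 = x11 := rfl

theorem update_frame_11 :
    update (frame b x11 x12 x13 x14 x15 x16 x17) 11 y = frame b y x12 x13 x14 x15 x16 x17 := by
  funext k
  by_cases h : k = 11 <;> simp [frame, h]

theorem frame_apply_12 : frame b x11 x12 x13 x14 x15 x16 x17 12 = x12 := rfl

theorem update_frame_12 :
    update (frame b x11 x12 x13 x14 x15 x16 x17) 12 y = frame b x11 y x13 x14 x15 x16 x17 := by
  funext k
  by_cases h : k = 12 <;> simp [frame, h]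

theorem frame_apply_13 : frame b x11 x12 x13 x14 x15 x16 x17 13 = x13 := rfl

theorem update_frame_13 :
    update (frame b x11 x12 x13 x14 x15 x16 x17) 13 y = frame b x11 x12 y x14 x15 x16 x17 := by
  funext k
  by_cases h : k = 13 <;> simp [frame, h]

theorem frame_apply_14 : frame b x11 x12 x13 x14 x15 x16 x17 14 = x14 := rfl

theorem update_frame_14 :
    update (frame b x11 x12 x13 x14 x15 x16 x17) 14 y = frame b x11 x12 x13 y x15 x16 x17 := by
  funext k
  by_cases h : k = 14 <;> simp [frame, h]

theorem frame_apply_15 : frame b x11 x12 x13 x14 x15 x16 x17 15 = x15 := rfl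

theorem update_frame_15 :
    update (frame b x11 x12 x13 x14 x15 x16 x17) 15 y = frame b x11 x12 x13 x14 y x16 x17 := by
  funext k
  by_cases h : k = 15 <;> simp [frame, h]

theorem frame_apply_16 : frame b x11 x12 x13 x14 x15 x16 x17 16 = x16 := rfl

theorem update_frame_16 :
    update (frame b x11 x12 x13 x14 x15 x16 x17) 16 y = frame b x11 x12 x13 x14 x15 y x17 := by
  funext k
  by_cases h : k = 16 <;> simp [frame, h]

theorem frame_apply_17 : frame b x11 x12 x13 x14 x15 x16 x17 17 = x17 := rfl

theorem update_frame_17 :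
    update (frame b x11 x12 x13 x14 x15 x16 x17) 17 y = frame b x11 x12 x13 x14 x15 x16 y := by
  funext k
  by_cases h : k = 17 <;> simp [frame, h]

theorem frame_apply_of_lt {i : ℕ} (hi : i < 11) : frame b x11 x12 x13 x14 x15 x16 x17 i = b i := by
  unfold frame
  iterate 7 rw [if_neg (by omega)]

theorem update_frame_of_lt {i : ℕ} (hi : i < 11) :
    update (frame b x11 x12 x13 x14 x15 x16 x17) i y = frame (update b i y) x11 x12 x13 x14 x15 x16 x17 := by
  funext k
  by_cases h : k = i
  · subst h
    simp [frame_apply_of_lt _ _ _ _ _ _ _ _ hi]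
  · simp [frame, h]

end frame

attribute [simp] frame_apply_11 update_frame_11
  frame_apply_12 update_frame_12
  frame_apply_13 update_frame_13
  frame_apply_14 update_frame_14
  frame_apply_15 update_frame_15
  frame_apply_16 update_frame_16
  frame_apply_17 update_frame_17
  frame_apply_of_lt update_frame_of_lt

/-! ### Identifying two numbers -/

/-- The map on numbers that identifies `M` with `M - d` and closes the gap at `M`. -/
def mergeMap (M d x : ℕ) : ℕ := if x < M then x else if x = M then M - d else x - 1

namespace OracleProg

/-- Moves the leading ones of stack `i` to stack `11`, and for each of them one bit from stack `12`
to stack `13` as long as there are any. -/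
def compareNum (i : ℕ) : OracleProg :=
  .loop i topTrue (.seq (.pop i) (.seq (.push 11 true)
    (.cond 12 topTrue (.seq (.pop 12) (.push 13 true)) .skip)))

/-- Removes as many bits from stack `11` as there are on stack `14`, which move to `15`. -/
def subtractNum : OracleProg :=
  .loop 14 topTrue (.seq (.pop 14) (.seq (.push 15 true) (.pop 11)))

/-- Moves a number from stack `i` to stack `11`, bits reversed, applying `mergeMap M d` to it; here
stack `12` holds `M + 1` ones and stack `14` holds `d` ones. -/
def remapNum (i : ℕ) : OracleProg :=
  .seq (compareNum i) (.seq
    (.cond 12 topTrue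
      (.seq (.pop 12) (.seq (.push 13 true)
        (.cond 12 topTrue .skip (.seq subtractNum (moveOnes 15 14)))))
      (.pop 11))
    (.seq (moveOnes 13 12) (.seq (.pop i) (.push 11 false))))

/-- Applies `mergeMap M d` to all numbers on stack `i`. -/
def remapNums (i : ℕ) : OracleProg := .seq (.loop i nonempty (remapNum i)) (moveBits 11 i)

/-- Turns `x` ones on stack `16` and `y` ones on stack `17` into `max x y` ones on stack `12` and
`|x - y|` ones on stack `14`. -/
def maxDiff : OracleProg :=
  .seq (.loop 16 topTrue (.seq (.pop 16) (.seq (.push 12 true)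
    (.cond 17 topTrue (.pop 17) (.push 14 true)))))
    (.loop 17 topTrue (.seq (.pop 17) (.seq (.push 12 true) (.push 14 true))))

/-- Takes a pair of numbers from stack `k` and identifies them in the numbering of a set whose size
is on stack `i`, renaming the numbers on stacks `j` and `k`. -/
def mergeStep (i j k : ℕ) : OracleProg :=
  .seq (moveOnes k 16) (.seq (.pop k) (.seq (moveOnes k 17) (.seq (.pop k) (.seq maxDiff (.seq
    (.cond 14 topTrue (.seq (.push 12 true) (.seq (.pop i) (.seq (remapNums j) (remapNums k))))
      .skip)
    (.seq (clear 12) (clear 14)))))))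

/-- Identifies all pairs of numbers on stack `k`. -/
def mergeAll (i j k : ℕ) : OracleProg := .loop k nonempty (mergeStep i j k)

end OracleProg

theorem topTrue_ones_append_false (n : ℕ) (l : List Bool) :
    topTrue (ones n ++ false :: l).head? = decide (0 < n) := by
  cases n <;> simp [topTrue, List.replicate_succ]

theorem topTrue_ones (n : ℕ) : topTrue (ones n).head? = decide (0 < n) := by
  cases n <;> simp [topTrue, List.replicate_succ]

theorem tail_ones_append {n : ℕ} (hn : 0 < n) (l : List Bool) :
    (ones n ++ l).tail = ones (n - 1) ++ l := by
  cases n with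
  | zero => omega
  | succ n => simp [List.replicate_succ]

theorem cons_ones (n : ℕ) : true :: ones n = ones (n + 1) := rfl

/-- The `A - x` ones left on stack `12` record the outcome of the comparison, and stack `13` keeps
the removed ones so that stack `12` can be restored. -/
theorem runsWithin_compareNum {i : ℕ} (hi : i < 11) {x A B : ℕ} {r : List Bool} {b : Store}
    (hb : b i = ones x ++ false :: r) {x11 x14 x15 x16 x17 : List Bool} :
    RunsWithin O (compareNum i) (frame b x11 (ones A) (ones B) x14 x15 x16 x17)
      (frame (update b i (false :: r)) (ones x ++ x11) (ones (A - x)) (ones (min x A + B))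
        x14 x15 x16 x17) (6 * x + 1) := by
  induction x generalizing b A B x11 with
  | zero =>
    refine (RunsWithin.loop_done (by simp [hb, hi, topTrue])).of_eq ?_ (by omega)
    have hb' : b i = false :: r := hb
    simp [← hb']
  | succ x ih =>
    have h : ∀ b' y11, RunsWithin O (.cond 12 topTrue (.seq (.pop 12) (.push 13 true)) .skip)
        (frame b' y11 (ones A) (ones B) x14 x15 x16 x17)
        (frame b' y11 (ones (A - 1)) (ones (min 1 A + B)) x14 x15 x16 x17) 3 := by
      intro b' y11
      rcases A with _ | A
      · exact (RunsWithin.cond_false rfl .skip).of_eq (by simp) (by omega)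
      · exact (RunsWithin.cond_true rfl ((RunsWithin.pop 12).seq (.push 13 true))).of_eq
          (by simp [cons_ones, add_comm]) (by omega)
    refine (RunsWithin.loop_step (by simp [hi, hb, topTrue, List.replicate_succ])
      ((RunsWithin.pop i).seq ((RunsWithin.push 11 true).seq
        ((h _ _).of_eq' (by simp [hi, hb, List.replicate_succ]; rfl))))
      (ih (by simp))).of_eq ?_ (by omega)
    have e1 : A - 1 - x = A - (x + 1) := by omega
    have e2 : min x (A - 1) + (min 1 A + B) = min (x + 1) A + B := by omega
    simp [e1, e2, ones_append_cons, List.replicate_succ]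

theorem runsWithin_subtractNum {d : ℕ} {b : Store} {x11 x12 x13 x15 x16 x17 : List Bool} :
    RunsWithin O subtractNum (frame b x11 x12 x13 (ones d) x15 x16 x17)
      (frame b (x11.drop d) x12 x13 [] (ones d ++ x15) x16 x17) (4 * d + 1) := by
  induction d generalizing x11 x15 with
  | zero => exact (RunsWithin.loop_done rfl).of_eq (by simp) (by omega)
  | succ d ih =>
    refine (RunsWithin.loop_step rfl ((RunsWithin.pop 14).seq ((RunsWithin.push 15 true).seq
      (RunsWithin.pop 11))) (ih.of_eq' (by simp; rfl))).of_eq ?_ (by omega)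
    simp [ones_append_cons, List.replicate_succ]

/-- After the comparison with `M + 1`, at least two ones, exactly one, or none remain on stack `12`
according to whether `x < M`, `x = M` or `x > M`; these are the three cases of `mergeMap`. In each
case the ones on stacks `12` and `13` still add up to `M + 1`, so moving them back restores the
parameter for the next number. -/
theorem runsWithin_remapNum {i : ℕ} (hi : i < 11) {x M d : ℕ} (hd : d ≤ M) {r : List Bool}
    {b : Store} (hb : b i = natCode x ++ r) {x11 x16 x17 : List Bool} :
    RunsWithin O (remapNum i) (frame b x11 (ones (M + 1)) [] (ones d) [] x16 x17)
      (frame (update b i r) (false :: (ones (mergeMap M d x) ++ x11)) (ones (M + 1)) [] (ones d) []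
        x16 x17) (9 * x + 7 * d + 20) := by
  rw [natCode_append] at hb
  have hc := runsWithin_compareNum (O := O) hi (A := M + 1) (B := 0) hb (x11 := x11)
    (x14 := ones d) (x15 := []) (x16 := x16) (x17 := x17)
  rw [add_zero] at hc
  have hcond : RunsWithin O (.cond 12 topTrue
      (.seq (.pop 12) (.seq (.push 13 true)
        (.cond 12 topTrue .skip (.seq subtractNum (moveOnes 15 14)))))
      (.pop 11))
      (frame (update b i (false :: r)) (ones x ++ x11) (ones (M + 1 - x)) (ones (min x (M + 1)))
        (ones d) [] x16 x17)
      (frame (update b i (false :: r)) (ones (mergeMap M d x) ++ x11) (ones (M - x))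
        (ones (min x M + 1)) (ones d) [] x16 x17) (7 * d + 6) := by
    rcases lt_trichotomy x M with hx | hx | hx
    · have e1 : M + 1 - x = M - x - 1 + 1 + 1 := by omega
      have e2 : min x (M + 1) = min x M := by omega
      have e3 : M - x - 1 + 1 = M - x := by omega
      rw [e1]
      refine (RunsWithin.cond_true rfl ((RunsWithin.pop 12).seq ((RunsWithin.push 13 true).seq
        (RunsWithin.cond_true ?_ RunsWithin.skip)))).of_eq ?_ (by omega)
      · simp [topTrue, List.replicate_succ]
      · simp [e2, e3, cons_ones, mergeMap, hx]
    · subst hx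
      have e1 : x + 1 - x = 1 := by omega
      have hs := runsWithin_subtractNum (O := O) (d := d) (b := update b i (false :: r))
        (x11 := ones x ++ x11) (x12 := []) (x13 := ones (x + 1)) (x15 := []) (x16 := x16)
        (x17 := x17)
      rw [e1]
      refine (RunsWithin.cond_true rfl ((RunsWithin.pop 12).seq ((RunsWithin.push 13 true).seq
        (RunsWithin.cond_false ?_ ((hs.of_eq' ?_).seq
          (runsWithin_moveOnes (n := d) (r := []) (by norm_num) rfl ?_)))))).of_eq ?_ (by omega)
      · simp [topTrue]
      · simp [cons_ones]
      · simp
      · have e : (ones x ++ x11).drop d = ones (x - d) ++ x11 := by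
          rw [List.drop_append]
          simp [hd]
        simp [e, mergeMap]
    · have e1 : M + 1 - x = 0 := by omega
      have e2 : min x (M + 1) = M + 1 := by omega
      have e3 : M - x = 0 := by omega
      have e4 : min x M = M := by omega
      have e5 : mergeMap M d x = x - 1 := by
        rw [mergeMap, if_neg (by omega), if_neg (by omega)]
      rw [e1, e2, e3, e4, e5]
      refine (RunsWithin.cond_false rfl (RunsWithin.pop 11)).of_eq ?_ (by omega)
      rw [frame_apply_11, update_frame_11, tail_ones_append (by omega)]
  refine (hc.seq (hcond.seq ((runsWithin_moveOnes (n := min x M + 1) (r := []) (by norm_num) rfl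
    (by simp)).seq ((RunsWithin.pop i).seq (RunsWithin.push 11 false))))).of_eq ?_ (by omega)
  have e : min x M + 1 + (M - x) = M + 1 := by omega
  have e' : ones (min x M + 1) ++ ones (M - x) = ones (M + 1) := by
    rw [← List.replicate_add, e]
  simp [hi, e]

theorem length_numsCode_le {l : List ℕ} {K : ℕ} (hl : ∀ x ∈ l, x ≤ K) :
    (numsCode l).length ≤ l.length * (K + 1) := by
  induction l with
  | nil => simp [numsCode]
  | cons x l ih =>
    have hx : x ≤ K := hl x (by simp)
    have := ih (fun y hy => hl y (by simp [hy]))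
    simp only [numsCode_cons, List.length_append, length_natCode, List.length_cons, add_mul]
    omega

theorem mergeMap_le {M d x K : ℕ} (hx : x ≤ K) : mergeMap M d x ≤ K := by
  unfold mergeMap
  split_ifs <;> omega

/-- The renamed numbers pile up on stack `11` as the reversal of the new code, and one final
`moveBits` reverses them back onto stack `i`. -/
theorem runsWithin_remapNums {i : ℕ} (hi : i < 11) {M d K : ℕ} (hd : d ≤ M) (hM : M ≤ K)
    {l : List ℕ} (hl : ∀ x ∈ l, x ≤ K) {b : Store} (hb : b i = numsCode l)
    {x16 x17 : List Bool} :
    RunsWithin O (remapNums i) (frame b [] (ones (M + 1)) [] (ones d) [] x16 x17)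
      (frame (update b i (numsCode (l.map (mergeMap M d)))) [] (ones (M + 1)) [] (ones d) []
        x16 x17) (l.length * (20 * K + 25) + 2) := by
  have hloop : ∀ x11, RunsWithin O (.loop i nonempty (remapNum i))
      (frame b x11 (ones (M + 1)) [] (ones d) [] x16 x17)
      (frame (update b i []) ((numsCode (l.map (mergeMap M d))).reverse ++ x11) (ones (M + 1)) []
        (ones d) [] x16 x17)
      (l.length * (16 * K + 21) + 1) := by
    induction l generalizing b with
    | nil =>
      intro x11
      refine (RunsWithin.loop_done (by simp [hi, hb, nonempty, numsCode])).of_eq ?_ (by simp)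
      have hb' : b i = [] := hb
      simp [numsCode, ← hb']
      simp [hb']
    | cons x l ih =>
      intro x11
      have hx : x ≤ K := hl x (by simp)
      refine (RunsWithin.loop_step (by cases x <;> simp [hi, hb, nonempty, numsCode, natCode,
        List.replicate_succ]) (runsWithin_remapNum hi hd (hb.trans (numsCode_cons x l)))
        (ih (fun y hy => hl y (by simp [hy])) (by simp) _)).of_eq ?_ ?_
      · simp [numsCode_cons, natCode]
      · simp only [List.length_cons, add_mul]
        omega
  have hlen := length_numsCode_le (K := K) (l := l.map (mergeMap M d)) (by
    simp only [List.mem_map, forall_exists_index, and_imp, forall_apply_eq_imp_iff₂]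
    exact fun x hx => mergeMap_le (hl x hx))
  refine ((hloop []).seq (runsWithin_moveBits (by omega) rfl)).of_eq ?_ ?_
  · simp [hi]
  · rw [List.length_map] at hlen
    simp only [frame_apply_11, List.append_nil, List.length_reverse]
    have e : l.length * (20 * K + 25) =
      l.length * (16 * K + 21) + 4 * (l.length * (K + 1)) := by ring
    omega

end

/-! ### Identifying all pairs of a list, with renumbering. -/

section

open Function
open OracleProg

variable {O : List Bool → List Bool}

/-- The concatenation of the codes of a list of pairs of numbers. -/
def pairsCode (q : List (ℕ × ℕ)) : List Bool := q.flatMap fun p => natCode p.1 ++ natCode p.2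

theorem pairsCode_cons (p : ℕ × ℕ) (q : List (ℕ × ℕ)) :
    pairsCode (p :: q) = natCode p.1 ++ (natCode p.2 ++ pairsCode q) := by
  simp [pairsCode]

theorem pairsCode_append (q q' : List (ℕ × ℕ)) :
    pairsCode (q ++ q') = pairsCode q ++ pairsCode q' := by
  simp [pairsCode]

theorem pairsCode_eq_numsCode (q : List (ℕ × ℕ)) :
    pairsCode q = numsCode (q.flatMap fun p => [p.1, p.2]) := by
  induction q with
  | nil => rfl
  | cons p q ih => simp [pairsCode_cons, numsCode_cons, ih]

theorem length_flatMap_pair (q : List (ℕ × ℕ)) :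
    (q.flatMap fun p => [p.1, p.2]).length = 2 * q.length := by
  induction q with
  | nil => rfl
  | cons p q ih => simp at ih ⊢; omega

theorem map_flatMap_pair (f : ℕ → ℕ) (q : List (ℕ × ℕ)) :
    (q.flatMap fun p => [p.1, p.2]).map f =
      (q.map (Prod.map f f)).flatMap fun p => [p.1, p.2] := by
  induction q with
  | nil => rfl
  | cons p q ih => simpa using ih

/-- The map on numbers that identifies `x` and `y` and closes the gap. -/
def identify (x y : ℕ) : ℕ → ℕ := mergeMap (x + (y - x)) (y - x + (x - y))

/-- Identifies all pairs in a list of pairs of numbers less than `n`, and renames the numbers in the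
list `l`; returns the number of classes and the renamed list. -/
def mergePairs (n : ℕ) (l : List ℕ) : List (ℕ × ℕ) → ℕ × List ℕ
  | [] => (n, l)
  | (x, y) :: q => if x = y then mergePairs n l q else
      mergePairs (n - 1) (l.map (identify x y)) (q.map (Prod.map (identify x y) (identify x y)))
  termination_by q => q.length

/-- With truncated subtraction `x + (y - x)` is the maximum, and `y - x + (x - y)` is the distance
since one summand vanishes. The first loop matches the ones of `x` with those of `y`, the second one
handles the excess of `y`. -/
theorem runsWithin_maxDiff {x y : ℕ} {b : Store} {x11 x13 x15 : List Bool} :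
    RunsWithin O maxDiff (frame b x11 [] x13 [] x15 (ones x) (ones y))
      (frame b x11 (ones (x + (y - x))) x13 (ones (y - x + (x - y))) x15 [] [])
      (5 * x + 4 * y + 2) := by
  have h1 : ∀ a d, RunsWithin O (.loop 16 topTrue (.seq (.pop 16) (.seq (.push 12 true)
      (.cond 17 topTrue (.pop 17) (.push 14 true)))))
      (frame b x11 (ones a) x13 (ones d) x15 (ones x) (ones y))
      (frame b x11 (ones (x + a)) x13 (ones (x - y + d)) x15 [] (ones (y - x)))
      (5 * x + 1) := by
    induction x generalizing y with
    | zero => exact fun a d => (RunsWithin.loop_done rfl).of_eq (by simp) (by omega)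
    | succ x ih =>
      intro a d
      have h : RunsWithin O (.cond 17 topTrue (.pop 17) (.push 14 true))
          (frame b x11 (ones (a + 1)) x13 (ones d) x15 (ones x) (ones y))
          (frame b x11 (ones (a + 1)) x13 (ones (1 - y + d)) x15 (ones x) (ones (y - 1))) 2 := by
        rcases y with _ | y
        · exact (RunsWithin.cond_false rfl (.push 14 true)).of_eq
            (by simp [cons_ones, add_comm]) (by omega)
        · exact (RunsWithin.cond_true rfl (.pop 17)).of_eq (by simp) (by omega)
      refine (RunsWithin.loop_step rfl ((RunsWithin.pop 16).seq ((RunsWithin.push 12 true).seq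
        (h.of_eq' ?_))) (ih _ _)).of_eq ?_ (by omega)
      · simp [cons_ones]
      · have e1 : y - 1 - x = y - (x + 1) := by omega
        have e2 : x + (a + 1) = x + 1 + a := by omega
        have e3 : x - (y - 1) + (1 - y + d) = x + 1 - y + d := by omega
        rw [e1, e2, e3]
  have h2 : ∀ z a d, RunsWithin O
      (.loop 17 topTrue (.seq (.pop 17) (.seq (.push 12 true) (.push 14 true))))
      (frame b x11 (ones a) x13 (ones d) x15 [] (ones z))
      (frame b x11 (ones (a + z)) x13 (ones (z + d)) x15 [] []) (4 * z + 1) := by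
    intro z
    induction z with
    | zero => exact fun a d => (RunsWithin.loop_done rfl).of_eq (by simp) (by omega)
    | succ z ih =>
      intro a d
      refine (RunsWithin.loop_step rfl ((RunsWithin.pop 17).seq ((RunsWithin.push 12 true).seq
        (RunsWithin.push 14 true))) ((ih (a + 1) (d + 1)).of_eq' (by simp [cons_ones]))).of_eq ?_
        (by omega)
      rw [show a + 1 + z = a + (z + 1) by omega, show z + (d + 1) = z + 1 + d by omega]
  exact ((h1 0 0).seq (h2 _ _ _)).of_eq (by simp) (by omega)

theorem topTrue_natCode_append (n : ℕ) (l : List Bool) :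
    topTrue (natCode n ++ l).head? = decide (0 < n) := by
  rw [natCode_append, topTrue_ones_append_false]

/-- The distance on stack `14` is zero exactly if `x = y`, and then nothing is to be done. Otherwise
the maximum becomes the minimum and all larger numbers drop by one, in the edge ends and also in the
pairs still waiting, which must refer to the new numbering. -/
theorem runsWithin_mergeStep {i j k : ℕ} (hi : i < 11) (hj : j < 11) (hk : k < 11) (hij : i ≠ j) (hik : i ≠ k)
    (hjk : j ≠ k) {n K x y : ℕ} {l : List ℕ} {q : List (ℕ × ℕ)} {b : Store}
    (hx : x ≤ K) (hy : y ≤ K) (hl : ∀ z ∈ l, z ≤ K)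
    (hq : ∀ p ∈ q, p.1 ≤ K ∧ p.2 ≤ K) (hlK : l.length ≤ K) (hqK : q.length ≤ K)
    (hbi : b i = ones n) (hbj : b j = numsCode l)
    (hbk : b k = natCode x ++ (natCode y ++ pairsCode q)) :
    RunsWithin O (mergeStep i j k) (frame b [] [] [] [] [] [] [])
      (frame (if x = y then update b k (pairsCode q) else
        update (update (update b i (ones (n - 1))) j (numsCode (l.map (identify x y)))) k
          (pairsCode (q.map (Prod.map (identify x y) (identify x y))))) [] [] [] [] [] [] [])
      (100 * (K + 1) ^ 2) := by
  have m1 := runsWithin_moveOnes (O := O) (i := k) (j := 16) (by omega) (n := x)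
    (r := false :: (natCode y ++ pairsCode q)) rfl
    (s := frame b [] [] [] [] [] [] []) (by simp [hk, hbk, natCode_append])
  have m2 := runsWithin_moveOnes (O := O) (i := k) (j := 17) (by omega) (n := y)
    (r := false :: pairsCode q) rfl
    (s := frame (update b k (natCode y ++ pairsCode q)) [] [] [] [] [] (ones x) [])
    (by simp [hk, natCode_append])
  have e1 : update (update (update (frame b [] [] [] [] [] [] []) k
      (false :: (natCode y ++ pairsCode q))) 16
      (ones x ++ frame b [] [] [] [] [] [] [] 16)) k (natCode y ++ pairsCode q) =
      frame (update b k (natCode y ++ pairsCode q)) [] [] [] [] [] (ones x) [] := by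
    simp [hk]
  have hpairs : RunsWithin O
      (.cond 14 topTrue (.seq (.push 12 true) (.seq (.pop i) (.seq (remapNums j) (remapNums k))))
        .skip)
      (frame (update b k (pairsCode q)) [] (ones (x + (y - x))) [] (ones (y - x + (x - y)))
        [] [] [])
      (if x = y then (frame (update b k (pairsCode q)) [] (ones (x + (y - x))) []
        (ones (y - x + (x - y))) [] [] []) else
        frame (update (update (update b i (ones (n - 1))) j (numsCode (l.map (identify x y)))) k
          (pairsCode (q.map (Prod.map (identify x y) (identify x y))))) [] (ones (x + (y - x) + 1))
          [] (ones (y - x + (x - y))) [] [] [])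
      (3 * (K * (20 * K + 25)) + 7) := by
    by_cases hxy : x = y
    · subst hxy
      refine (RunsWithin.cond_false (by simp [topTrue]) RunsWithin.skip).of_eq ?_ (by omega)
      simp
    · have r1 := runsWithin_remapNums (O := O) hj (M := x + (y - x)) (d := y - x + (x - y))
        (K := K) (by omega) (by omega) hl
        (b := update (update b k (pairsCode q)) i (ones (n - 1)))
        (by simp [hij.symm, hjk, hbj]) (x16 := []) (x17 := [])
      have r2 := runsWithin_remapNums (O := O) hk (M := x + (y - x)) (d := y - x + (x - y))
        (K := K) (by omega) (by omega) (l := q.flatMap fun p => [p.1, p.2])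
        (by
          simp only [List.mem_flatMap, List.mem_cons, List.not_mem_nil, or_false]
          rintro z ⟨p, hp, rfl | rfl⟩
          · exact (hq p hp).1
          · exact (hq p hp).2)
        (b := update (update (update b k (pairsCode q)) i (ones (n - 1))) j
          (numsCode (l.map (mergeMap (x + (y - x)) (y - x + (x - y))))))
        (by simp [hik.symm, hjk.symm, pairsCode_eq_numsCode]) (x16 := []) (x17 := [])
      refine (RunsWithin.cond_true (by
        rw [frame_apply_14, topTrue_ones]; exact decide_eq_true (by omega)) ((RunsWithin.push 12 true).seq
        ((RunsWithin.pop i).seq ((r1.of_eq' ?_).seq r2)))).of_eq ?_ ?_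
      · simp [hi, hik, hbi, cons_ones]
      · rw [if_neg hxy]
        congr 1
        rw [map_flatMap_pair, ← pairsCode_eq_numsCode]
        funext m
        simp only [update_apply, identify]
        split_ifs <;> rfl
      · rw [length_flatMap_pair]
        have h1 : l.length * (20 * K + 25) ≤ K * (20 * K + 25) := Nat.mul_le_mul_right _ hlK
        have h2 : 2 * q.length * (20 * K + 25) ≤ 2 * K * (20 * K + 25) :=
          Nat.mul_le_mul_right _ (by omega)
        rw [mul_assoc 2 K] at h2
        omega
  have c1 : ∀ b' a d, RunsWithin O (.seq (clear 12) (clear 14))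
      (frame b' [] (ones a) [] (ones d) [] [] []) (frame b' [] [] [] [] [] [] [])
      (2 * a + 1 + (2 * d + 1)) := fun b' a d =>
    ((runsWithin_clear rfl).seq (runsWithin_clear rfl)).of_eq (by simp) (by simp)
  refine (m1.seq ((RunsWithin.pop k).seq ((m2.of_eq' ?_).seq ((RunsWithin.pop k).seq
    ((runsWithin_maxDiff.of_eq' ?_).seq (hpairs.seq (T' := 6 * K + 4) (s'' := frame (if x = y then
      update b k (pairsCode q) else
        update (update (update b i (ones (n - 1))) j (numsCode (l.map (identify x y)))) k
          (pairsCode (q.map (Prod.map (identify x y) (identify x y))))) [] [] [] [] [] [] [])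
      ?_)))))).of_eq rfl ?_
  · simp [hk]
  · simp [hk]
  · split_ifs with hxy
    · exact (c1 _ _ _).mono (by omega)
    · exact (c1 _ _ _).mono (by omega)
  · have : 100 * (K + 1) ^ 2 = 60 * (K * K) + 40 * (K * K) + 200 * K + 100 := by ring
    have e : K * (20 * K + 25) = 20 * (K * K) + 25 * K := by ring
    rw [e]
    omega

/-- Renaming neither lengthens a list nor takes a number above `K`, so every step of the induction
costs at most the same amount. -/
theorem runsWithin_mergeAll {i j k : ℕ} (hi : i < 11) (hj : j < 11) (hk : k < 11) (hij : i ≠ j) (hik : i ≠ k)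
    (hjk : j ≠ k) {n K : ℕ} {l : List ℕ} {q : List (ℕ × ℕ)} {b : Store}
    (hl : ∀ z ∈ l, z ≤ K)
    (hq : ∀ p ∈ q, p.1 ≤ K ∧ p.2 ≤ K) (hlK : l.length ≤ K) (hqK : q.length ≤ K)
    (hbi : b i = ones n) (hbj : b j = numsCode l) (hbk : b k = pairsCode q) :
    RunsWithin O (mergeAll i j k) (frame b [] [] [] [] [] [] [])
      (frame (update (update (update b i (ones (mergePairs n l q).1)) j
        (numsCode (mergePairs n l q).2)) k []) [] [] [] [] [] [] [])
      (q.length * (100 * (K + 1) ^ 2 + 1) + 1) := by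
  induction hm : q.length generalizing n l q b with
  | zero =>
    obtain rfl : q = [] := List.eq_nil_of_length_eq_zero hm
    refine (RunsWithin.loop_done (by simp [hk, hbk, pairsCode, nonempty])).of_eq ?_ (by simp)
    rw [mergePairs, ← hbi, ← hbj, show [] = b k from hbk.symm]
    simp
  | succ m ih =>
    obtain ⟨⟨x, y⟩, q, rfl⟩ := List.exists_cons_of_length_eq_add_one hm
    rw [pairsCode_cons] at hbk
    have hxy := hq (x, y) (by simp)
    have hq' : ∀ p ∈ q, p.1 ≤ K ∧ p.2 ≤ K := fun p hp => hq p (by simp [hp])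
    rw [List.length_cons] at hm hqK
    have hs := runsWithin_mergeStep (O := O) hi hj hk hij hik hjk hxy.1 hxy.2 hl hq' hlK
      (by omega) hbi hbj hbk
    have htest : nonempty ((frame b [] [] [] [] [] [] [] k).head?) = true := by
      cases x <;> simp [hk, hbk, nonempty, natCode, List.replicate_succ]
    rw [mergePairs]
    by_cases h : x = y
    · simp only [h, if_true] at hs ⊢
      refine (RunsWithin.loop_step htest hs (ih (n := n) hl hq' hlK (by omega) (by simp [hik, hbi])
        (by simp [hjk, hbj]) (by simp) (by omega))).of_eq ?_ ?_
      · congr 1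
        funext m
        simp only [update_apply]
        split_ifs <;> rfl
      · rw [add_mul]
        omega
    · simp only [h, if_false] at hs ⊢
      have hM : x + (y - x) ≤ K := by have := hxy.1; have := hxy.2; simp only at *; omega
      refine (RunsWithin.loop_step htest hs (ih (n := n - 1) (l := l.map (identify x y))
        (q := q.map (Prod.map (identify x y) (identify x y))) ?_ ?_ (by simpa using hlK)
        (by simp; omega) ?_ ?_ (by simp) (by simp; omega))).of_eq ?_ ?_
      · simp only [List.mem_map, forall_exists_index, and_imp, forall_apply_eq_imp_iff₂]
        exact fun z hz => mergeMap_le (hl z hz)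
      · simp only [List.mem_map, forall_exists_index, and_imp, forall_apply_eq_imp_iff₂]
        exact fun p hp => ⟨mergeMap_le (hq' p hp).1, mergeMap_le (hq' p hp).2⟩
      · simp [hij, hik]
      · simp [hjk]
      · congr 1
        funext m
        simp only [update_apply]
        split_ifs <;> rfl
      · rw [add_mul]
        omega

end

/-! ### Stores with explicit main stacks, and reading graphs and pins. -/

section

open Function
open OracleProg

variable {O : List Bool → List Bool}

/-- The store with given stacks `0` to `10`, all other stacks being empty. -/
def base (y0 y1 y2 y3 y4 y5 y6 y7 y8 y9 y10 : List Bool) : Store := fun k =>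
  if k = 0 then y0
  else if k = 1 then y1
  else if k = 2 then y2
  else if k = 3 then y3
  else if k = 4 then y4
  else if k = 5 then y5
  else if k = 6 then y6
  else if k = 7 then y7
  else if k = 8 then y8
  else if k = 9 then y9
  else if k = 10 then y10 else []

section base

variable (y0 y1 y2 y3 y4 y5 y6 y7 y8 y9 y10 y : List Bool)

theorem base_apply_0 : base y0 y1 y2 y3 y4 y5 y6 y7 y8 y9 y10 0 = y0 := rfl

theorem update_base_0 :
    update (base y0 y1 y2 y3 y4 y5 y6 y7 y8 y9 y10) 0 y = base y y1 y2 y3 y4 y5 y6 y7 y8 y9 y10 := by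
  funext k
  by_cases h : k = 0 <;> simp [base, h]

theorem base_apply_1 : base y0 y1 y2 y3 y4 y5 y6 y7 y8 y9 y10 1 = y1 := rfl

theorem update_base_1 :
    update (base y0 y1 y2 y3 y4 y5 y6 y7 y8 y9 y10) 1 y = base y0 y y2 y3 y4 y5 y6 y7 y8 y9 y10 := by
  funext k
  by_cases h : k = 1 <;> simp [base, h]

theorem base_apply_2 : base y0 y1 y2 y3 y4 y5 y6 y7 y8 y9 y10 2 = y2 := rfl

theorem update_base_2 :
    update (base y0 y1 y2 y3 y4 y5 y6 y7 y8 y9 y10) 2 y = base y0 y1 y y3 y4 y5 y6 y7 y8 y9 y10 := by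
  funext k
  by_cases h : k = 2 <;> simp [base, h]

theorem base_apply_3 : base y0 y1 y2 y3 y4 y5 y6 y7 y8 y9 y10 3 = y3 := rfl

theorem update_base_3 :
    update (base y0 y1 y2 y3 y4 y5 y6 y7 y8 y9 y10) 3 y = base y0 y1 y2 y y4 y5 y6 y7 y8 y9 y10 := by
  funext k
  by_cases h : k = 3 <;> simp [base, h]

theorem base_apply_4 : base y0 y1 y2 y3 y4 y5 y6 y7 y8 y9 y10 4 = y4 := rfl

theorem update_base_4 :
    update (base y0 y1 y2 y3 y4 y5 y6 y7 y8 y9 y10) 4 y = base y0 y1 y2 y3 y y5 y6 y7 y8 y9 y10 := by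
  funext k
  by_cases h : k = 4 <;> simp [base, h]

theorem base_apply_5 : base y0 y1 y2 y3 y4 y5 y6 y7 y8 y9 y10 5 = y5 := rfl

theorem update_base_5 :
    update (base y0 y1 y2 y3 y4 y5 y6 y7 y8 y9 y10) 5 y = base y0 y1 y2 y3 y4 y y6 y7 y8 y9 y10 := by
  funext k
  by_cases h : k = 5 <;> simp [base, h]

theorem base_apply_6 : base y0 y1 y2 y3 y4 y5 y6 y7 y8 y9 y10 6 = y6 := rfl

theorem update_base_6 :
    update (base y0 y1 y2 y3 y4 y5 y6 y7 y8 y9 y10) 6 y = base y0 y1 y2 y3 y4 y5 y y7 y8 y9 y10 := by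
  funext k
  by_cases h : k = 6 <;> simp [base, h]

theorem base_apply_7 : base y0 y1 y2 y3 y4 y5 y6 y7 y8 y9 y10 7 = y7 := rfl

theorem update_base_7 :
    update (base y0 y1 y2 y3 y4 y5 y6 y7 y8 y9 y10) 7 y = base y0 y1 y2 y3 y4 y5 y6 y y8 y9 y10 := by
  funext k
  by_cases h : k = 7 <;> simp [base, h]

theorem base_apply_8 : base y0 y1 y2 y3 y4 y5 y6 y7 y8 y9 y10 8 = y8 := rfl

theorem update_base_8 :
    update (base y0 y1 y2 y3 y4 y5 y6 y7 y8 y9 y10) 8 y = base y0 y1 y2 y3 y4 y5 y6 y7 y y9 y10 := by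
  funext k
  by_cases h : k = 8 <;> simp [base, h]

theorem base_apply_9 : base y0 y1 y2 y3 y4 y5 y6 y7 y8 y9 y10 9 = y9 := rfl

theorem update_base_9 :
    update (base y0 y1 y2 y3 y4 y5 y6 y7 y8 y9 y10) 9 y = base y0 y1 y2 y3 y4 y5 y6 y7 y8 y y10 := by
  funext k
  by_cases h : k = 9 <;> simp [base, h]

theorem base_apply_10 : base y0 y1 y2 y3 y4 y5 y6 y7 y8 y9 y10 10 = y10 := rfl

theorem update_base_10 :
    update (base y0 y1 y2 y3 y4 y5 y6 y7 y8 y9 y10) 10 y = base y0 y1 y2 y3 y4 y5 y6 y7 y8 y9 y := by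
  funext k
  by_cases h : k = 10 <;> simp [base, h]

end base

attribute [simp] base_apply_0 update_base_0
  base_apply_1 update_base_1
  base_apply_2 update_base_2
  base_apply_3 update_base_3
  base_apply_4 update_base_4
  base_apply_5 update_base_5
  base_apply_6 update_base_6
  base_apply_7 update_base_7
  base_apply_8 update_base_8
  base_apply_9 update_base_9
  base_apply_10 update_base_10

theorem initStore_eq (x : List Bool) :
    initStore x = frame (base x [] [] [] [] [] [] [] [] [] []) [] [] [] [] [] [] [] := by
  funext k
  by_cases h : k = 0
  · subst h; rfl
  · simp [initStore, frame, base, h]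

/-! ### Reading the input -/

/-- The code of an edge. -/
def edgeCode (e : ℕ × ℕ) : List Bool := natCode e.1 ++ natCode e.2

/-- A label `k` is looked up in the table `t`. -/
def label (t : List (Option ℕ)) (k : ℕ) : Option ℕ := t[k]?.join

/-- The pairs of numbers that are to be identified on the side `c`, for a list of pins (consisting
of the side, the number of the pinned vertex, and its label). -/
def pinPairs (c : Bool) (a : ℕ) (t : List (Option ℕ)) (l : List (Bool × ℕ × ℕ)) : List (ℕ × ℕ) :=
  ((l.filter fun x => x.1 == c).map fun x => ((label t x.2.2).getD 0, a + x.2.1)).reverse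

/-- Whether a pin has a label of the other side. -/
def badPin (tL tR : List (Option ℕ)) (x : Bool × ℕ × ℕ) : Bool :=
  (label (if x.1 then tR else tL) x.2.2).isNone

namespace OracleProg

/-- Adds edges, read from stack `2`, to stacks `4` and `7`, shifting the numbers by `a` and `b`. -/
def readEdges (a b : ℕ) : OracleProg :=
  .seq (.loop 2 topTrue (.seq (.pop 2) (.seq (moveNum 2 4 a) (moveNum 2 7 b)))) (.pop 2)

/-- Puts a label on stack `i`; a missing label is recorded on stack `9`. -/
def putLabel (i : ℕ) : Option ℕ → OracleProg
  | some x => write i (natCode x)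
  | none => .seq (write i (natCode 0)) (.push 9 true)

/-- Reads a label from stack `2`, looks it up and puts the result on stack `i`. -/
def readLabel (i : ℕ) : List (Option ℕ) → OracleProg
  | [] => .skip
  | o :: t => .cond 2 topTrue (.seq (.pop 2) (readLabel i t)) (.seq (.pop 2) (putLabel i o))

/-- Reads one vertex from stack `2`, and continues with `P` on the left and `Q` on the right side. -/
def readVertex (a b : ℕ) (P Q : OracleProg) : OracleProg :=
  .seq (.pop 2) (.cond 2 topTrue (.seq (.pop 2) (.seq (moveNum 2 8 b) Q))
    (.seq (.pop 2) (.seq (moveNum 2 5 a) P)))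

/-- Reads a list of pins from stack `2`. -/
def readPins (a b : ℕ) (tL tR : List (Option ℕ)) : OracleProg :=
  .seq (.loop 2 topTrue (readVertex a b (readLabel 5 tL) (readLabel 8 tR))) (.pop 2)

/-- Reads a list of vertices from stack `2`, to be pinned to a given list of labels. -/
def readVertices (a b : ℕ) (tL tR : List (Option ℕ)) : List ℕ → OracleProg
  | [] => .pop 2
  | k :: l => .seq (readVertex a b (putLabel 5 (label tL k)) (putLabel 8 (label tR k)))
      (readVertices a b tL tR l)

end OracleProg

theorem runsWithin_readEdges {a b : ℕ} {l : List (ℕ × ℕ)} {r : List Bool} {K : ℕ}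
    (hl : ∀ e ∈ l, e.1 ≤ K ∧ e.2 ≤ K) {s : Store} (hs : s 2 = listCode edgeCode l ++ r) :
    RunsWithin O (readEdges a b) s
      (update (update (update s 2 r) 4 (numsCode ((l.map fun e => a + e.1).reverse) ++ s 4)) 7
        (numsCode ((l.map fun e => b + e.2).reverse) ++ s 7))
      (l.length * (6 * K + a + b + 10) + 2) := by
  have hloop : RunsWithin O
      (.loop 2 topTrue (.seq (.pop 2) (.seq (moveNum 2 4 a) (moveNum 2 7 b)))) s
      (update (update (update s 2 (false :: r)) 4
        (numsCode ((l.map fun e => a + e.1).reverse) ++ s 4)) 7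
        (numsCode ((l.map fun e => b + e.2).reverse) ++ s 7))
      (l.length * (6 * K + a + b + 10) + 1) := by
    induction l generalizing s with
    | nil =>
      refine (RunsWithin.loop_done (by simp [hs, listCode, topTrue])).of_eq ?_ (by simp)
      have hs' : s 2 = false :: r := hs
      simp [numsCode, ← hs']
    | cons e l ih =>
      have he := hl e (by simp)
      have hs' : s 2 = true :: (natCode e.1 ++ (natCode e.2 ++ (listCode edgeCode l ++ r))) := by
        simp [hs, listCode, edgeCode]
      refine (RunsWithin.loop_step (by simp [hs', topTrue]) ((RunsWithin.pop 2).seq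
        ((runsWithin_moveNum (by norm_num) a (by simp [hs']; rfl)).seq
          (runsWithin_moveNum (by norm_num) b (by simp; rfl))))
        (ih (fun e' he' => hl e' (by simp [he'])) (by simp))).of_eq ?_ ?_
      · funext k
        by_cases h7 : k = 7
        · subst h7; simp [numsCode]
        by_cases h4 : k = 4
        · subst h4; simp [numsCode]
        by_cases h2 : k = 2
        · subst h2; simp
        simp [h7, h4, h2]
      · rw [List.length_cons, add_mul]
        omega
  refine (hloop.seq (.pop 2)).of_eq ?_ (by omega)
  funext k
  by_cases h2 : k = 2
  · subst h2; simp
  simp [update_apply, h2]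

/-- A missing label is replaced by `0`, so that the pair on stack `i` stays complete, while the mark
on stack `9` later overrides the result. -/
theorem runsWithin_putLabel {i : ℕ} (hi : i ≠ 9) (o : Option ℕ) (s : Store) :
    RunsWithin O (putLabel i o) s (update (update s i (natCode (o.getD 0) ++ s i)) 9
      (ones o.isNone.toNat ++ s 9)) (o.getD 0 + 3) := by
  cases o with
  | none =>
    refine ((runsWithin_write i _ s).seq (.push 9 true)).of_eq ?_ (by simp [length_natCode])
    simp [hi.symm]
  | some x =>
    refine (runsWithin_write i _ s).of_eq ?_ (by simp [length_natCode])
    simp only [Option.getD_some, Option.isNone_some, Bool.toNat_false, List.replicate_zero,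
      List.nil_append]
    rw [← update_of_ne hi.symm (natCode x ++ s i) s, update_eq_self]

/-- The table is part of the program: each one of the unary label descends one entry. Since `k` lies
within the table, the delimiter is met before the table ends. -/
theorem runsWithin_readLabel {i : ℕ} (h2 : i ≠ 2) (hi : i ≠ 9) {t : List (Option ℕ)} {k M : ℕ}
    (hk : k < t.length) (hM : (label t k).getD 0 ≤ M) {r : List Bool} {s : Store}
    (hs : s 2 = natCode k ++ r) :
    RunsWithin O (readLabel i t) s
      (update (update (update s 2 r) i (natCode ((label t k).getD 0) ++ s i)) 9
        (ones (label t k).isNone.toNat ++ s 9)) (2 * k + M + 5) := by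
  induction t generalizing k s with
  | nil => simp at hk
  | cons o t ih =>
    cases k with
    | zero =>
      refine (RunsWithin.cond_false (by simp [hs, natCode, topTrue]) ((RunsWithin.pop 2).seq
        (runsWithin_putLabel hi o _))).of_eq ?_ ?_
      · simp [hs, natCode, label, h2]
      · simp only [label, List.length_cons, Nat.zero_lt_succ, getElem?_pos, List.getElem_cons_zero,
          Option.join_some] at hM
        omega
    | succ k =>
      refine (RunsWithin.cond_true (by simp [hs, natCode, topTrue, List.replicate_succ])
        ((RunsWithin.pop 2).seq (ih (k := k) (by simpa using hk) (by simpa [label] using hM)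
          (by simp [hs, natCode, List.replicate_succ])))).of_eq ?_ (by omega)
      simp [label, h2]

/-- The bit `d` is the continuation bit of the surrounding list code. The shifts by `a` and `b`
leave the first numbers on each side to the vertices of the target graph. -/
theorem runsWithin_readVertex {a b : ℕ} {P Q : OracleProg} {c : Bool} {x K T : ℕ}
    (hx : x ≤ K) {d : Bool} {r : List Bool} {s s' : Store} (hs : s 2 = d :: c :: (natCode x ++ r))
    (hP : c = false → RunsWithin O P
      (update (update s 2 r) 5 (natCode (a + x) ++ s 5)) s' T)
    (hQ : c = true → RunsWithin O Q
      (update (update s 2 r) 8 (natCode (b + x) ++ s 8)) s' T) :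
    RunsWithin O (readVertex a b P Q) s s' (3 * K + a + b + T + 7) := by
  cases c with
  | false =>
    refine ((RunsWithin.pop 2).seq (RunsWithin.cond_false (by simp [hs, topTrue])
      ((RunsWithin.pop 2).seq ((runsWithin_moveNum (n := x) (r := r) (by norm_num) a
        (by simp [hs])).seq ((hP rfl).of_eq' ?_))))).mono (by omega)
    simp
  | true =>
    refine ((RunsWithin.pop 2).seq (RunsWithin.cond_true (by simp [hs, topTrue])
      ((RunsWithin.pop 2).seq ((runsWithin_moveNum (n := x) (r := r) (by norm_num) b
        (by simp [hs])).seq ((hQ rfl).of_eq' ?_))))).mono (by omega)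
    simp

/-- The store after reading a list of pins. -/
def pinStore (a b : ℕ) (tL tR : List (Option ℕ)) (s : Store) (r : List Bool)
    (l : List (Bool × ℕ × ℕ)) : Store :=
  update (update (update (update s 2 r) 5 (pairsCode (pinPairs false a tL l) ++ s 5)) 8
    (pairsCode (pinPairs true b tR l) ++ s 8)) 9 (ones (l.countP (badPin tL tR)) ++ s 9)

theorem pinPairs_cons (c : Bool) (a : ℕ) (t : List (Option ℕ)) (x : Bool × ℕ × ℕ)
    (l : List (Bool × ℕ × ℕ)) :
    pinPairs c a t (x :: l) = pinPairs c a t l ++ pinPairs c a t [x] := by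
  by_cases h : x.1 == c <;> simp [pinPairs, h]

/-- Drives the inductions over the list of pins. Later pins land higher on the stacks, which is why
`pinPairs` reverses its list. -/
theorem pinStore_pinStore {a b : ℕ} {tL tR : List (Option ℕ)} (s : Store) (r r' : List Bool)
    (x : Bool × ℕ × ℕ) (l : List (Bool × ℕ × ℕ)) :
    pinStore a b tL tR (pinStore a b tL tR s r [x]) r' l = pinStore a b tL tR s r' (x :: l) := by
  have hc : ones (l.countP (badPin tL tR)) ++ (ones ([x].countP (badPin tL tR)) ++ s 9) =
      ones ((x :: l).countP (badPin tL tR)) ++ s 9 := by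
    rw [← List.append_assoc, ← List.replicate_add]
    by_cases h : badPin tL tR x <;> simp [h]
  funext k
  by_cases h9 : k = 9
  · subst h9; simpa [pinStore] using hc
  by_cases h8 : k = 8
  · subst h8; simp [pinStore, pinPairs_cons true b tR x l, pairsCode_append]
  by_cases h5 : k = 5
  · subst h5; simp [pinStore, pinPairs_cons false a tL x l, pairsCode_append]
  by_cases h2 : k = 2
  · subst h2; simp [pinStore]
  simp [pinStore, h9, h8, h5, h2]

theorem pinStore_left {a b : ℕ} {tL tR : List (Option ℕ)} {s s' : Store} {r : List Bool} {x k : ℕ}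
    (h2 : s' 2 = r) (h5 : s' 5 = natCode ((label tL k).getD 0) ++ (natCode (a + x) ++ s 5))
    (h9 : s' 9 = ones (label tL k).isNone.toNat ++ s 9)
    (h : ∀ j, j ≠ 2 → j ≠ 5 → j ≠ 9 → s' j = s j) :
    s' = pinStore a b tL tR s r [(false, x, k)] := by
  funext j
  by_cases j9 : j = 9
  · subst j9
    cases hb : label tL k <;> simp_all [pinStore, badPin]
  by_cases j8 : j = 8
  · subst j8; simp [pinStore, pinPairs, pairsCode, h]
  by_cases j5 : j = 5
  · subst j5; simp [pinStore, pinPairs, pairsCode, h5]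
  by_cases j2 : j = 2
  · subst j2; simp [pinStore, h2]
  simp [pinStore, j9, j8, j5, j2, h]

theorem pinStore_right {a b : ℕ} {tL tR : List (Option ℕ)} {s s' : Store} {r : List Bool} {x k : ℕ}
    (h2 : s' 2 = r) (h8 : s' 8 = natCode ((label tR k).getD 0) ++ (natCode (b + x) ++ s 8))
    (h9 : s' 9 = ones (label tR k).isNone.toNat ++ s 9)
    (h : ∀ j, j ≠ 2 → j ≠ 8 → j ≠ 9 → s' j = s j) :
    s' = pinStore a b tL tR s r [(true, x, k)] := by
  funext j
  by_cases j9 : j = 9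
  · subst j9
    cases hb : label tR k <;> simp_all [pinStore, badPin]
  by_cases j8 : j = 8
  · subst j8; simp [pinStore, pinPairs, pairsCode, h8]
  by_cases j5 : j = 5
  · subst j5; simp [pinStore, pinPairs, pairsCode, h]
  by_cases j2 : j = 2
  · subst j2; simp [pinStore, h2]
  simp [pinStore, j9, j8, j5, j2, h]

/-- The code of a pin. -/
def pinCode (x : Bool × ℕ × ℕ) : List Bool := x.1 :: (natCode x.2.1 ++ natCode x.2.2)

theorem runsWithin_readPins {a b K : ℕ} {tL tR : List (Option ℕ)}
    {l : List (Bool × ℕ × ℕ)} (hL : ∀ k, (label tL k).getD 0 ≤ K)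
    (hR : ∀ k, (label tR k).getD 0 ≤ K)
    (hl : ∀ x ∈ l, x.2.1 ≤ K ∧ x.2.2 ≤ K ∧ x.2.2 < tL.length ∧ x.2.2 < tR.length)
    {s : Store} (hs : s 2 = listCode pinCode l) :
    RunsWithin O (readPins a b tL tR) s (pinStore a b tL tR s [] l)
      (l.length * (6 * K + a + b + 13) + 2) := by
  have hloop : RunsWithin O (.loop 2 topTrue (readVertex a b (readLabel 5 tL) (readLabel 8 tR))) s
      (pinStore a b tL tR s [false] l) (l.length * (6 * K + a + b + 13) + 1) := by
    induction l generalizing s with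
    | nil =>
      refine (RunsWithin.loop_done (by simp [hs, listCode, topTrue])).of_eq ?_ (by simp)
      have hs' : s 2 = [false] := hs
      simp [pinStore, pinPairs, pairsCode, ← hs']
    | cons p l ih =>
      obtain ⟨c, x, k⟩ := p
      obtain ⟨hx, hk, hkL, hkR⟩ := hl (c, x, k) (by simp)
      simp only at hx hk hkL hkR
      have hs' : s 2 = true :: c :: (natCode x ++ (natCode k ++ listCode pinCode l)) := by
        simp [hs, listCode, pinCode]
      have hv : RunsWithin O (readVertex a b (readLabel 5 tL) (readLabel 8 tR)) s
          (pinStore a b tL tR s (listCode pinCode l) [(c, x, k)])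
          (3 * K + a + b + (2 * K + K + 5) + 7) := by
        refine runsWithin_readVertex hx hs' ?_ ?_
        · rintro rfl
          refine (runsWithin_readLabel (by norm_num) (by norm_num) hkL (hL k)
            (r := listCode pinCode l) (by simp)).of_eq (pinStore_left ?_ ?_ ?_ ?_) (by omega)
          · simp
          · simp
          · simp
          · intro j j2 j5 j9; simp [j2, j5, j9]
        · rintro rfl
          refine (runsWithin_readLabel (by norm_num) (by norm_num) hkR (hR k)
            (r := listCode pinCode l) (by simp)).of_eq (pinStore_right ?_ ?_ ?_ ?_) (by omega)
          · simp
          · simp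
          · simp
          · intro j j2 j5 j9; simp [j2, j5, j9]
      refine (RunsWithin.loop_step (by simp [hs', topTrue]) hv
        (ih (fun y hy => hl y (by simp [hy])) (by simp [pinStore]))).of_eq ?_ ?_
      · rw [pinStore_pinStore]
      · rw [List.length_cons, add_mul]
        omega
  refine (hloop.seq (.pop 2)).of_eq ?_ (by omega)
  funext k
  by_cases h2 : k = 2
  · subst h2; simp [pinStore]
  simp [pinStore, update_apply, h2]

/-- The counterpart of `runsWithin_readPins` for fixed labels: only the vertices are on the input
stack, and the labels, being known in advance, are resolved in the program text. -/
theorem runsWithin_readVertices {a b K : ℕ} {tL tR : List (Option ℕ)}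
    (hL : ∀ k, (label tL k).getD 0 ≤ K) (hR : ∀ k, (label tR k).getD 0 ≤ K)
    {l : List ((Bool × ℕ) × ℕ)} (hl : ∀ x ∈ l, x.1.2 ≤ K) {s : Store}
    (hs : s 2 = listCode (fun x : Bool × ℕ => x.1 :: natCode x.2) (l.map Prod.fst)) :
    RunsWithin O (readVertices a b tL tR (l.map Prod.snd)) s
      (pinStore a b tL tR s [] (l.map fun x => (x.1.1, x.1.2, x.2)))
      (l.length * (6 * K + a + b + 13) + 2) := by
  induction l generalizing s with
  | nil =>
    refine (RunsWithin.pop 2).of_eq ?_ (by simp)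
    simp only [pinStore, pinPairs, pairsCode, hs, listCode, List.map_nil, List.filter_nil,
      List.reverse_nil, List.flatMap_nil, List.nil_append, List.countP_nil, List.replicate_zero,
      List.tail_cons]
    funext j
    simp only [update_apply]
    split_ifs <;> simp_all
  | cons p l ih =>
    obtain ⟨⟨c, x⟩, k⟩ := p
    have hx := hl ((c, x), k) (by simp)
    simp only at hx
    generalize hr : listCode (fun x : Bool × ℕ => x.1 :: natCode x.2) (l.map Prod.fst) = r at ih
    have hs' : s 2 = true :: c :: (natCode x ++ r) := by
      simp [hs, listCode, hr]
    have hv : RunsWithin O (readVertex a b (putLabel 5 (label tL k)) (putLabel 8 (label tR k))) s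
        (pinStore a b tL tR s r [(c, x, k)]) (3 * K + a + b + (K + 3) + 7) := by
      refine runsWithin_readVertex hx hs' ?_ ?_
      · rintro rfl
        have := hL k
        refine (runsWithin_putLabel (by norm_num) (label tL k) _).of_eq
          (pinStore_left ?_ ?_ ?_ ?_) (by omega)
        · simp
        · simp
        · simp
        · intro j j2 j5 j9; simp [j2, j5, j9]
      · rintro rfl
        have := hR k
        refine (runsWithin_putLabel (by norm_num) (label tR k) _).of_eq
          (pinStore_right ?_ ?_ ?_ ?_) (by omega)
        · simp
        · simp
        · simp
        · intro j j2 j5 j9; simp [j2, j5, j9]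
    refine (hv.seq (ih (fun y hy => hl y (by simp [hy])) (by simp [pinStore]))).of_eq ?_ ?_
    · rw [pinStore_pinStore]
      rfl
    · rw [List.length_cons, add_mul]
      omega

end

section

open Function
open OracleProg

variable {O : List Bool → List Bool}

/-! ### Asking one query -/

theorem listCode_map {α β : Type*} (f : β → List Bool) (g : α → β) (l : List α) :
    listCode f (l.map g) = listCode (fun x => f (g x)) l := by
  induction l with
  | nil => rfl
  | cons x l ih => simp [listCode, ih]

/-- The code of a graph with `n` left and `n'` right vertices, the ends of whose edges are listed. -/
def endsCode (n n' : ℕ) (l l' : List ℕ) : List Bool :=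
  natCode n ++ natCode n' ++ listCode edgeCode (l.zip l').reverse

theorem length_listCode_edgeCode_le {l : List (ℕ × ℕ)} {K : ℕ}
    (hl : ∀ e ∈ l, e.1 ≤ K ∧ e.2 ≤ K) :
    (listCode edgeCode l).length ≤ l.length * (2 * K + 3) + 1 := by
  induction l with
  | nil => simp [listCode]
  | cons e l ih =>
    have := hl e (by simp)
    have := ih (fun y hy => hl y (by simp [hy]))
    simp only [listCode, edgeCode, List.length_cons, List.length_append, length_natCode, add_mul]
    omega

namespace OracleProg

/-- Writes to stack `16` the code of the number of ones on stack `i`. -/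
def writeNum (i : ℕ) : OracleProg := .seq (.push 16 false) (moveOnes i 16)

/-- Writes the code of the graph on the stacks `3`, `4`, `6`, `7` to stack `16`. -/
def writeGraph : OracleProg :=
  .seq (.push 16 false) (.seq
    (.loop 4 nonempty (.seq (moveNum 7 16 0) (.seq (moveNum 4 16 0) (.push 16 true))))
    (.seq (writeNum 6) (writeNum 3)))

/-- Queries the oracle about the graph on the stacks `3`, `4`, `6`, `7` and adds `c` times the
answer to the number on stack `10`. -/
def askGraph (c : ℕ) : OracleProg :=
  .seq writeGraph (.seq (.query 16 17) (.seq (clear 16) (.seq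
    (.loop 17 topTrue (.seq (.pop 17) (write 10 (ones c)))) (.pop 17))))

end OracleProg

/-- The code is produced from its end: the delimiter of the edge list, then the edges with right end
before left end, then `n'` and finally `n`. This is the origin of the reversal in `endsCode`. -/
theorem runsWithin_writeGraph {n n' K : ℕ} {l l' : List ℕ} (hn : n ≤ K) (hn' : n' ≤ K)
    (hl : ∀ x ∈ l, x ≤ K) (hl' : ∀ x ∈ l', x ≤ K) (hll : l.length = l'.length)
    {x y9 y10 : List Bool} :
    RunsWithin O writeGraph
      (frame (base x [] [] (ones n) (numsCode l) [] (ones n') (numsCode l') [] y9 y10)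
        [] [] [] [] [] [] [])
      (frame (base x [] [] [] [] [] [] [] [] y9 y10)
        [] [] [] [] [] (endsCode n n' l l') [])
      (l.length * (6 * K + 10) + 6 * K + 6) := by
  have hloop : ∀ m : List (ℕ × ℕ), RunsWithin O
      (.loop 4 nonempty (.seq (moveNum 7 16 0) (.seq (moveNum 4 16 0) (.push 16 true))))
      (frame (base x [] [] (ones n) (numsCode l) [] (ones n') (numsCode l') [] y9 y10)
        [] [] [] [] [] (listCode edgeCode m) [])
      (frame (base x [] [] (ones n) [] [] (ones n') [] [] y9 y10)
        [] [] [] [] [] (listCode edgeCode ((l.zip l').reverse ++ m)) [])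
      (l.length * (6 * K + 10) + 1) := by
    induction l generalizing l' with
    | nil =>
      obtain rfl : l' = [] := List.eq_nil_of_length_eq_zero hll.symm
      exact fun m => (RunsWithin.loop_done rfl).of_eq rfl (by simp)
    | cons i l ih =>
      obtain ⟨j, l', rfl⟩ := List.exists_cons_of_length_eq_add_one (hll.symm.trans List.length_cons)
      intro m
      have hi := hl i (by simp)
      have hj := hl' j (by simp)
      refine (RunsWithin.loop_step (by cases i <;> rfl)
        ((runsWithin_moveNum (n := j) (r := numsCode l') (by norm_num) 0 rfl).seq
          ((runsWithin_moveNum (n := i) (r := numsCode l) (by norm_num) 0 (by simp; rfl)).seq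
            (RunsWithin.push 16 true)))
        ((ih (l' := l') (fun y hy => hl y (by simp [hy])) (fun y hy => hl' y (by simp [hy]))
          (by simpa using hll) ((i, j) :: m)).of_eq' ?_)).of_eq ?_ ?_
      · simp [listCode, edgeCode]
      · simp
      · rw [List.length_cons, add_mul]
        omega
  refine ((RunsWithin.push 16 false).seq (((hloop []).of_eq' ?_).seq
    (((RunsWithin.push 16 false).seq (runsWithin_moveOnes (n := n') (r := []) (by norm_num) rfl
      (by simp))).seq
    ((RunsWithin.push 16 false).seq (runsWithin_moveOnes (n := n) (r := []) (by norm_num) rfl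
      (by simp)))))).of_eq ?_ (by omega)
  · simp [listCode]
  · simp [endsCode, natCode_append]

/-- The answer is unary, so each of its ones contributes `c` ones to the accumulator on stack `10`.
-/
theorem runsWithin_askGraph {n n' K c v : ℕ} {l l' : List ℕ} (hn : n ≤ K) (hn' : n' ≤ K)
    (hl : ∀ x ∈ l, x ≤ K) (hl' : ∀ x ∈ l', x ≤ K) (hll : l.length = l'.length)
    (hlK : l.length ≤ K) (hc : c ≤ K) (hv : v ≤ K)
    (hO : O (endsCode n n' l l') = natCode v) {x y9 : List Bool} {A : ℕ} :
    RunsWithin O (askGraph c)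
      (frame (base x [] [] (ones n) (numsCode l) [] (ones n') (numsCode l') [] y9 (ones A))
        [] [] [] [] [] [] [])
      (frame (base x [] [] [] [] [] [] [] [] y9 (ones (v * c + A))) [] [] [] [] [] [] [])
      (50 * (K + 1) ^ 2) := by
  have hlen : (endsCode n n' l l').length ≤ 2 * K + 2 + (K * (2 * K + 3) + 1) := by
    have h1 : ∀ e ∈ (l.zip l').reverse, e.1 ≤ K ∧ e.2 ≤ K := by
      intro e he
      rw [List.mem_reverse] at he
      exact ⟨hl _ (List.of_mem_zip he).1, hl' _ (List.of_mem_zip he).2⟩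
    have h2 := length_listCode_edgeCode_le h1
    rw [List.length_reverse, List.length_zip, ← hll, min_self] at h2
    have h3 : l.length * (2 * K + 3) ≤ K * (2 * K + 3) := Nat.mul_le_mul_right _ hlK
    simp only [endsCode, List.length_append, length_natCode]
    omega
  have hadd : ∀ A, RunsWithin O (.loop 17 topTrue (.seq (.pop 17) (write 10 (ones c))))
      (frame (base x [] [] [] [] [] [] [] [] y9 (ones A)) [] [] [] [] [] [] (natCode v))
      (frame (base x [] [] [] [] [] [] [] [] y9 (ones (v * c + A))) [] [] [] [] [] [] [false])
      (v * (c + 3) + 1) := by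
    clear hO
    induction v with
    | zero => exact fun A => (RunsWithin.loop_done rfl).of_eq (by simp [natCode]) (by omega)
    | succ v ih =>
      intro A
      refine (RunsWithin.loop_step rfl ((RunsWithin.pop 17).seq (runsWithin_write 10 (ones c) _))
        ((ih (by omega) (c + A)).of_eq' ?_)).of_eq ?_ ?_
      · simp [natCode, List.replicate_succ]
      · rw [show v * c + (c + A) = (v + 1) * c + A by ring]
      · rw [add_mul, List.length_replicate]
        omega
  refine ((runsWithin_writeGraph hn hn' hl hl' hll).seq ((RunsWithin.query 16 17).seq
    ((runsWithin_clear rfl).seq (((hadd A).of_eq' ?_).seq (.pop 17))))).of_eq ?_ ?_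
  · simp [hO]
  · simp
  · simp only [frame_apply_16, hO, length_natCode, update_frame_17]
    have h1 : l.length * (6 * K + 10) ≤ K * (6 * K + 10) := Nat.mul_le_mul_right _ hlK
    have h2 : v * (c + 3) ≤ K * (K + 3) := Nat.mul_le_mul hv (by omega)
    have e : 50 * (K + 1) ^ 2 = K * (6 * K + 10) + K * (K + 3) + 3 * (K * (2 * K + 3)) +
      37 * (K * K) + 78 * K + 50 := by ring
    omega

theorem identify_le {x y z K : ℕ} (hz : z ≤ K) :
    identify x y z ≤ K := mergeMap_le hz

theorem mergePairs_bounds {n K : ℕ} {l : List ℕ} {q : List (ℕ × ℕ)} (hl : ∀ x ∈ l, x ≤ K)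
    (hq : ∀ p ∈ q, p.1 ≤ K ∧ p.2 ≤ K) :
    (mergePairs n l q).1 ≤ n ∧ (∀ x ∈ (mergePairs n l q).2, x ≤ K) ∧
      (mergePairs n l q).2.length = l.length := by
  induction hm : q.length generalizing n l q with
  | zero =>
    obtain rfl : q = [] := List.eq_nil_of_length_eq_zero hm
    simpa [mergePairs] using hl
  | succ m ih =>
    obtain ⟨⟨x, y⟩, q, rfl⟩ := List.exists_cons_of_length_eq_add_one hm
    have hxy := hq (x, y) (by simp)
    have hq' : ∀ p ∈ q, p.1 ≤ K ∧ p.2 ≤ K := fun p hp => hq p (by simp [hp])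
    rw [mergePairs]
    split_ifs with h
    · exact ih hl hq' (by simpa using hm)
    · have := ih (n := n - 1) (l := l.map (identify x y))
        (q := q.map (Prod.map (identify x y) (identify x y))) (by
          simp only [List.mem_map, forall_exists_index, and_imp, forall_apply_eq_imp_iff₂]
          exact fun z hz => identify_le (hl z hz)) (by
          simp only [List.mem_map, forall_exists_index, and_imp, forall_apply_eq_imp_iff₂]
          exact fun p hp => ⟨identify_le (hq' p hp).1,
            identify_le (hq' p hp).2⟩) (by simpa using hm)
      exact ⟨by omega, this.2.1, by simpa using this.2.2⟩

/-! ### The whole program -/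

/-- The fixed data of the program: the numbers of left and right vertices and the edges of the
target graph, and for each label the number of its vertex on the left or right side. -/
structure TargetData where
  a : ℕ
  b : ℕ
  edges : List (ℕ × ℕ)
  tL : List (Option ℕ)
  tR : List (Option ℕ)

/-- The data of a query: pairs of vertices of the target graph that are to be identified on either
side, and the coefficient of the answer. -/
structure QueryData where
  qL : List (ℕ × ℕ)
  qR : List (ℕ × ℕ)
  c : ℕ

/-- A graph with pinned vertices. -/
structure PinnedData where
  a : ℕ
  b : ℕ
  edges : List (ℕ × ℕ)
  pins : List (Bool × ℕ × ℕ)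

namespace PinnedData

variable (G : PinnedData) (D : TargetData) (Q : QueryData)

/-- The left ends of the edges of the union of both graphs. -/
def endsL : List ℕ := (G.edges.map fun e => D.a + e.1).reverse ++ D.edges.map Prod.fst

/-- The right ends of the edges of the union of both graphs. -/
def endsR : List ℕ := (G.edges.map fun e => D.b + e.2).reverse ++ D.edges.map Prod.snd

/-- The pairs that are to be identified on the left. -/
def pairsL : List (ℕ × ℕ) := pinPairs false D.a D.tL G.pins ++ Q.qL

/-- The pairs that are to be identified on the right. -/
def pairsR : List (ℕ × ℕ) := pinPairs true D.b D.tR G.pins ++ Q.qR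

/-- The left side of the graph with which the oracle is queried. -/
def sideL : ℕ × List ℕ := mergePairs (D.a + G.a) (G.endsL D) (G.pairsL D Q)

/-- The right side of the graph with which the oracle is queried. -/
def sideR : ℕ × List ℕ := mergePairs (D.b + G.b) (G.endsR D) (G.pairsR D Q)

/-- The string with which the oracle is queried. -/
def query : List Bool :=
  endsCode (G.sideL D Q).1 (G.sideR D Q).1 (G.sideL D Q).2 (G.sideR D Q).2

/-- The code of the graph without the pins. -/
def graphCode : List Bool := natCode G.a ++ natCode G.b ++ listCode edgeCode G.edges

/-- All relevant numbers are at most `K`. -/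
structure Bounded (x : List Bool) (K : ℕ) : Prop where
  input : x.length ≤ K
  left : D.a + G.a ≤ K
  right : D.b + G.b ≤ K
  length : G.edges.length + D.edges.length ≤ K
  edges : ∀ e ∈ G.edges, D.a + e.1 ≤ K ∧ D.b + e.2 ≤ K
  targetEdges : ∀ e ∈ D.edges, e.1 ≤ K ∧ e.2 ≤ K
  pairsL : ∀ p ∈ G.pairsL D Q, p.1 ≤ K ∧ p.2 ≤ K
  pairsR : ∀ p ∈ G.pairsR D Q, p.1 ≤ K ∧ p.2 ≤ K
  lengthL : (G.pairsL D Q).length ≤ K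
  lengthR : (G.pairsR D Q).length ≤ K
  coeff : Q.c ≤ K

end PinnedData

namespace OracleProg

/-- Loads the union of both graphs; `P` reads the pins. -/
def loadUnion (P : OracleProg) (D : TargetData) (Q : QueryData) : OracleProg :=
  .seq (moveBits 0 11) (.seq (moveBitsTwice 11 0 2) (.seq
    (.seq (moveOnes 2 3) (.seq (.pop 2) (write 3 (ones D.a)))) (.seq
    (.seq (moveOnes 2 6) (.seq (.pop 2) (write 6 (ones D.b)))) (.seq
    (.seq (write 4 (numsCode (D.edges.map Prod.fst))) (.seq
      (write 7 (numsCode (D.edges.map Prod.snd))) (readEdges D.a D.b)))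
    (.seq (write 5 (pairsCode Q.qL)) (.seq (write 8 (pairsCode Q.qR)) P))))))

/-- Performs one query. -/
def queryStep (P : OracleProg) (D : TargetData) (Q : QueryData) : OracleProg :=
  .seq (loadUnion P D Q) (.seq (mergeAll 3 4 5) (.seq (mergeAll 6 7 8) (askGraph Q.c)))

end OracleProg

open PinnedData

theorem length_pairsCode_le {q : List (ℕ × ℕ)} {K : ℕ} (hq : ∀ p ∈ q, p.1 ≤ K ∧ p.2 ≤ K)
    (hqK : q.length ≤ K) : (pairsCode q).length ≤ 2 * K * (K + 1) := by
  rw [pairsCode_eq_numsCode]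
  refine (length_numsCode_le (K := K) ?_).trans ?_
  · simp only [List.mem_flatMap, List.mem_cons, List.not_mem_nil, or_false]
    rintro z ⟨p, hp, rfl | rfl⟩
    · exact (hq p hp).1
    · exact (hq p hp).2
  · rw [length_flatMap_pair]
    exact Nat.mul_le_mul_right _ (by omega)

/-- Stack layout: `0` the input, `2` the copy being read; `3`, `4`, `5` the size, the edge ends and
the pairs of the left side; `6`, `7`, `8` the same on the right; `9` the marks of misplaced labels;
`10` the accumulator. The input is moved away and back in duplicate, since every query has to read
it again. -/
theorem runsWithin_loadUnion {P : OracleProg} {D : TargetData} {Q : QueryData} {G : PinnedData}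
    {x y : List Bool} {K T F A : ℕ} (hx : x = G.graphCode ++ y) (hB : G.Bounded D Q x K)
    (hP : ∀ s : Store, s 2 = y → RunsWithin O P s (pinStore D.a D.b D.tL D.tR s [] G.pins) T) :
    RunsWithin O (loadUnion P D Q)
      (frame (base x [] [] [] [] [] [] [] [] (ones F) (ones A)) [] [] [] [] [] [] [])
      (frame (base x [] [] (ones (D.a + G.a)) (numsCode (G.endsL D)) (pairsCode (G.pairsL D Q))
        (ones (D.b + G.b)) (numsCode (G.endsR D)) (pairsCode (G.pairsR D Q))
        (ones (G.pins.countP (badPin D.tL D.tR) + F)) (ones A)) [] [] [] [] [] [] [])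
      (50 * (K + 1) ^ 2 + T) := by
  have hK := hB.input
  have hK' := hB.left
  have hK'' := hB.right
  have hlen := hB.length
  have hx' : x = ones G.a ++ false :: (ones G.b ++ false :: (listCode edgeCode G.edges ++ y)) := by
    simp [hx, graphCode, natCode_append]
  have s1 := runsWithin_moveBits (O := O) (i := 0) (j := 11) (l := x) (by norm_num)
    (s := frame (base x [] [] [] [] [] [] [] [] (ones F) (ones A)) [] [] [] [] [] [] []) rfl
  have s2 := runsWithin_moveBitsTwice (O := O) (i := 11) (j := 0) (k := 2) (l := x.reverse)
    (by norm_num) (by norm_num) (by norm_num)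
    (s := frame (base [] [] [] [] [] [] [] [] [] (ones F) (ones A)) x.reverse [] [] [] [] [] []) rfl
  have s3 := (runsWithin_moveOnes (O := O) (i := 2) (j := 3) (n := G.a) (by norm_num) rfl
    (s := frame (base x [] x [] [] [] [] [] [] (ones F) (ones A)) [] [] [] [] [] [] []) hx').seq
    ((RunsWithin.pop 2).seq (runsWithin_write 3 (ones D.a) _))
  have s4 := (runsWithin_moveOnes (O := O) (i := 2) (j := 6) (n := G.b) (by norm_num) rfl
    (s := frame (base x [] (ones G.b ++ false :: (listCode edgeCode G.edges ++ y))
      (ones (D.a + G.a)) [] [] [] [] [] (ones F) (ones A)) [] [] [] [] [] [] []) rfl).seq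
    ((RunsWithin.pop 2).seq (runsWithin_write 6 (ones D.b) _))
  have s5 := (runsWithin_write (O := O) 4 (numsCode (D.edges.map Prod.fst))
    (frame (base x [] (listCode edgeCode G.edges ++ y)
      (ones (D.a + G.a)) [] [] (ones (D.b + G.b)) [] [] (ones F) (ones A)) [] [] [] [] [] [] [])).seq
    ((runsWithin_write 7 (numsCode (D.edges.map Prod.snd)) _).seq
    (runsWithin_readEdges (a := D.a) (b := D.b) (l := G.edges) (r := y) (K := K)
      (fun e he => by have := hB.edges e he; omega) (by simp)))
  have s6 := (runsWithin_write (O := O) 5 (pairsCode Q.qL)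
    (frame (base x [] y (ones (D.a + G.a)) (numsCode (G.endsL D)) [] (ones (D.b + G.b))
      (numsCode (G.endsR D)) [] (ones F) (ones A)) [] [] [] [] [] [] [])).seq
    ((runsWithin_write 8 (pairsCode Q.qR) _).seq (hP _ (by simp)))
  refine (s1.seq ((s2.of_eq' ?_).seq ((s3.of_eq' ?_).seq ((s4.of_eq' ?_).seq ((s5.of_eq' ?_).seq
    (s6.of_eq' ?_)))))).of_eq ?_ ?_
  · simp
  · simp
  · simp
  · simp
  · simp [endsL, endsR, numsCode_append]
  · simp [pinStore, PinnedData.pairsL, PinnedData.pairsR, pairsCode_append]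
  · have h1 := length_numsCode_le (K := K) (l := D.edges.map Prod.fst) (by
      simp only [List.mem_map, forall_exists_index, and_imp, forall_apply_eq_imp_iff₂]
      exact fun e he => (hB.targetEdges e he).1)
    have h2 := length_numsCode_le (K := K) (l := D.edges.map Prod.snd) (by
      simp only [List.mem_map, forall_exists_index, and_imp, forall_apply_eq_imp_iff₂]
      exact fun e he => (hB.targetEdges e he).2)
    have h3 := length_pairsCode_le (K := K) (q := Q.qL)
      (fun p hp => hB.pairsL p (List.mem_append_right _ hp))
      (le_trans (by simp [PinnedData.pairsL]) hB.lengthL)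
    have h4 := length_pairsCode_le (K := K) (q := Q.qR)
      (fun p hp => hB.pairsR p (List.mem_append_right _ hp))
      (le_trans (by simp [PinnedData.pairsR]) hB.lengthR)
    rw [List.length_map] at h1 h2
    have h5 : D.edges.length * (K + 1) ≤ K * (K + 1) := Nat.mul_le_mul_right _ (by omega)
    have h6 : G.edges.length * (6 * K + D.a + D.b + 10) ≤ K * (8 * K + 10) :=
      Nat.mul_le_mul (by omega) (by omega)
    simp only [List.length_replicate, List.length_reverse]
    have e : 50 * (K + 1) ^ 2 = 2 * (K * (K + 1)) + K * (8 * K + 10) + 2 * (2 * K * (K + 1)) +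
      36 * (K * K) + 84 * K + 50 := by ring
    have : 0 ≤ K * K := by positivity
    omega

/-- All working stacks end up empty, so that queries can be chained. The cubic term comes from at
most `K` identifications on each side, each of quadratic cost. -/
theorem runsWithin_queryStep {P : OracleProg} {D : TargetData} {Q : QueryData} {G : PinnedData}
    {x y : List Bool} {K T F A v : ℕ} (hx : x = G.graphCode ++ y) (hB : G.Bounded D Q x K)
    (hP : ∀ s : Store, s 2 = y → RunsWithin O P s (pinStore D.a D.b D.tL D.tR s [] G.pins) T)
    (hO : O (G.query D Q) = natCode v) (hv : v ≤ K) :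
    RunsWithin O (queryStep P D Q)
      (frame (base x [] [] [] [] [] [] [] [] (ones F) (ones A)) [] [] [] [] [] [] [])
      (frame (base x [] [] [] [] [] [] [] []
        (ones (G.pins.countP (badPin D.tL D.tR) + F)) (ones (v * Q.c + A))) [] [] [] [] [] [] [])
      (400 * (K + 1) ^ 3 + T) := by
  have hK' := hB.left
  have hK'' := hB.right
  have hlen := hB.length
  have hL : ∀ z ∈ G.endsL D, z ≤ K := by
    simp only [endsL, List.mem_append, List.mem_reverse, List.mem_map]
    rintro z (⟨e, he, rfl⟩ | ⟨e, he, rfl⟩)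
    · exact (hB.edges e he).1
    · exact (hB.targetEdges e he).1
  have hR : ∀ z ∈ G.endsR D, z ≤ K := by
    simp only [endsR, List.mem_append, List.mem_reverse, List.mem_map]
    rintro z (⟨e, he, rfl⟩ | ⟨e, he, rfl⟩)
    · exact (hB.edges e he).2
    · exact (hB.targetEdges e he).2
  have hLK : (G.endsL D).length ≤ K := by simpa [endsL] using hlen
  have hRK : (G.endsR D).length ≤ K := by simpa [endsR] using hlen
  have bL := mergePairs_bounds (n := D.a + G.a) hL hB.pairsL
  have bR := mergePairs_bounds (n := D.b + G.b) hR hB.pairsR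
  have m1 := runsWithin_mergeAll (O := O) (i := 3) (j := 4) (k := 5) (by norm_num) (by norm_num)
    (by norm_num) (by norm_num) (by norm_num) (by norm_num) hL hB.pairsL hLK hB.lengthL
    (n := D.a + G.a)
    (b := base x [] [] (ones (D.a + G.a)) (numsCode (G.endsL D)) (pairsCode (G.pairsL D Q))
        (ones (D.b + G.b)) (numsCode (G.endsR D)) (pairsCode (G.pairsR D Q))
        (ones (G.pins.countP (badPin D.tL D.tR) + F)) (ones A)) rfl rfl rfl
  have m2 := runsWithin_mergeAll (O := O) (i := 6) (j := 7) (k := 8) (by norm_num) (by norm_num)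
    (by norm_num) (by norm_num) (by norm_num) (by norm_num) hR hB.pairsR hRK hB.lengthR
    (n := D.b + G.b)
    (b := base x [] [] (ones (G.sideL D Q).1) (numsCode (G.sideL D Q).2) []
        (ones (D.b + G.b)) (numsCode (G.endsR D)) (pairsCode (G.pairsR D Q))
        (ones (G.pins.countP (badPin D.tL D.tR) + F)) (ones A)) rfl rfl rfl
  have m3 := runsWithin_askGraph (O := O) (n := (G.sideL D Q).1) (n' := (G.sideR D Q).1)
    (l := (G.sideL D Q).2) (l' := (G.sideR D Q).2) (K := K) (bL.1.trans hK') (bR.1.trans hK'')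
    bL.2.1 bR.2.1 (by
      refine bL.2.2.trans (Eq.trans ?_ bR.2.2.symm)
      simp [endsL, endsR]) (bL.2.2.le.trans hLK) hB.coeff hv hO (x := x)
      (y9 := ones (G.pins.countP (badPin D.tL D.tR) + F)) (A := A)
  refine ((runsWithin_loadUnion hx hB hP).seq (m1.seq ((m2.of_eq' ?_).seq (m3.of_eq' ?_)))).of_eq
    rfl ?_
  · simp [sideL]
  · simp [sideR]
  · have h1 : (G.pairsL D Q).length * (100 * (K + 1) ^ 2 + 1) ≤ K * (100 * (K + 1) ^ 2 + 1) :=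
      Nat.mul_le_mul_right _ hB.lengthL
    have h2 : (G.pairsR D Q).length * (100 * (K + 1) ^ 2 + 1) ≤ K * (100 * (K + 1) ^ 2 + 1) :=
      Nat.mul_le_mul_right _ hB.lengthR
    have e1 : 400 * (K + 1) ^ 3 = 2 * (K * (100 * (K + 1) ^ 2)) + 200 * (K * (K + 1) ^ 2) +
      400 * (K + 1) ^ 2 := by ring
    have e2 : K * (100 * (K + 1) ^ 2 + 1) = K * (100 * (K + 1) ^ 2) + K := by ring
    have e3 : (K + 1) ^ 2 = K * K + 2 * K + 1 := by ring
    rw [e2] at h1 h2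
    have h3 : 0 ≤ K * (K + 1) ^ 2 := by positivity
    generalize K * (100 * (K + 1) ^ 2) = u at *
    generalize K * (K + 1) ^ 2 = w at *
    omega

end

/-! ### Combining the answers and reducing them modulo `p`. -/

section

open Function
open OracleProg

variable {O : List Bool → List Bool}

namespace OracleProg

/-- Performs a list of queries. -/
def querySteps (P : OracleProg) (D : TargetData) : List QueryData → OracleProg
  | [] => .skip
  | Q :: l => .seq (queryStep P D Q) (querySteps P D l)

/-- Writes to stack `1` the residue modulo `p` of the number on stack `10` plus `r`, if that number
is at most `n`. -/
def writeResidue (p : ℕ) : ℕ → ℕ → OracleProg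
  | 0, r => write 1 (natCode (r % p))
  | n + 1, r => .cond 10 topTrue (.seq (.pop 10) (writeResidue p n (r + 1)))
      (write 1 (natCode (r % p)))

/-- Counts the homomorphisms from a pinned graph modulo `p`; here `P` reads the pins. -/
def countPinned (P : OracleProg) (D : TargetData) (p : ℕ) (l : List QueryData) : OracleProg :=
  .seq (querySteps P D l) (.cond 9 topTrue (write 1 (natCode 0))
    (writeResidue p (l.map fun Q => p * Q.c).sum 0))

end OracleProg

theorem runsWithin_querySteps {P : OracleProg} {D : TargetData} {G : PinnedData}
    {x y : List Bool} {K T : ℕ} (hx : x = G.graphCode ++ y)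
    (hP : ∀ s : Store, s 2 = y → RunsWithin O P s (pinStore D.a D.b D.tL D.tR s [] G.pins) T)
    {l : List QueryData} (hB : ∀ Q ∈ l, G.Bounded D Q x K) {v : QueryData → ℕ}
    (hO : ∀ Q ∈ l, O (G.query D Q) = natCode (v Q)) (hv : ∀ Q ∈ l, v Q ≤ K) (F A : ℕ) :
    RunsWithin O (querySteps P D l)
      (frame (base x [] [] [] [] [] [] [] [] (ones F) (ones A)) [] [] [] [] [] [] [])
      (frame (base x [] [] [] [] [] [] [] []
        (ones (l.length * G.pins.countP (badPin D.tL D.tR) + F))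
        (ones ((l.map fun Q => v Q * Q.c).sum + A))) [] [] [] [] [] [] [])
      (l.length * (400 * (K + 1) ^ 3 + T) + 1) := by
  induction l generalizing F A with
  | nil => exact RunsWithin.skip.of_eq (by simp) (by simp)
  | cons Q l ih =>
    refine ((runsWithin_queryStep hx (hB Q (by simp)) hP (hO Q (by simp)) (hv Q (by simp))).seq
      (ih (fun Q' h => hB Q' (by simp [h])) (fun Q' h => hO Q' (by simp [h]))
        (fun Q' h => hv Q' (by simp [h])) _ _)).of_eq ?_ ?_
    · rw [List.length_cons, List.map_cons, List.sum_cons]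
      congr 3
      · ring
      · ring
    · rw [List.length_cons, add_mul]
      omega

/-- No division is carried out at run time: the accumulated number has an a priori bound `n`, so the
program can be a decision tree of depth `n` with the residues at its leaves. -/
theorem runsWithin_writeResidue {p n r m : ℕ} (hp : 0 < p) (hm : m ≤ n) {s : Store}
    (h10 : s 10 = ones m) (h1 : s 1 = []) :
    ∃ s', RunsWithin O (writeResidue p n r) s s' (2 * n + p + 2) ∧
      s' 1 = natCode ((r + m) % p) := by
  have hw : ∀ r, RunsWithin O (write 1 (natCode (r % p))) s
      (update s 1 (natCode (r % p) ++ s 1)) (p + 1) := fun r =>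
    (runsWithin_write 1 _ s).mono (by
      rw [length_natCode]
      have := Nat.mod_lt r hp
      omega)
  induction n generalizing r m s with
  | zero =>
    obtain rfl : m = 0 := by omega
    exact ⟨_, (hw r).mono (by omega), by simp [h1]⟩
  | succ n ih =>
    cases m with
    | zero => exact ⟨_, (RunsWithin.cond_false (by simp [h10, topTrue]) (hw r)).mono (by omega),
        by simp [h1]⟩
    | succ m =>
      obtain ⟨s', h, h'⟩ := ih (m := m) (r := r + 1) (by omega) (s := update s 10 (s 10).tail)
        (by simp [h10]) (by simpa using h1)
        (fun r => (runsWithin_write 1 _ _).mono (by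
          rw [length_natCode]
          have := Nat.mod_lt r hp
          omega))
      refine ⟨s', (RunsWithin.cond_true (by simp [h10, topTrue, List.replicate_succ])
        ((RunsWithin.pop 10).seq h)).mono (by omega), ?_⟩
      rw [h', show r + 1 + m = r + (m + 1) by ring]

/-- Answers below `p` bound the accumulator by the constant `∑ p * Q.c`, the depth of the decision
tree. At least one query is needed for misplaced labels to leave a mark on stack `9`. -/
theorem outputsWithin_countPinned {P : OracleProg} {D : TargetData} {G : PinnedData} {p : ℕ}
    (hp : 0 < p) {x y : List Bool} {K T : ℕ} (hx : x = G.graphCode ++ y)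
    (hP : ∀ s : Store, s 2 = y → RunsWithin O P s (pinStore D.a D.b D.tL D.tR s [] G.pins) T)
    {l : List QueryData} (hl : l ≠ []) (hB : ∀ Q ∈ l, G.Bounded D Q x K) {v : QueryData → ℕ}
    (hO : ∀ Q ∈ l, O (G.query D Q) = natCode (v Q)) (hv : ∀ Q ∈ l, v Q < p) (hpK : p ≤ K) :
    OutputsWithin O (countPinned P D p l) x
      (natCode (if G.pins.countP (badPin D.tL D.tR) = 0 then
        (l.map fun Q => v Q * Q.c).sum % p else 0))
      (l.length * (400 * (K + 1) ^ 3 + T) + 2 * (l.map fun Q => p * Q.c).sum + p + 10) := by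
  have hq := runsWithin_querySteps hx hP hB hO (fun Q h => (hv Q h).le.trans hpK) 0 0
  have hinit : initStore x = frame (base x [] [] [] [] [] [] [] [] (ones 0) (ones 0))
    [] [] [] [] [] [] [] := initStore_eq x
  rw [← hinit] at hq
  simp only [add_zero] at hq
  have key : ∃ s', RunsWithin O (countPinned P D p l) (initStore x) s'
      (l.length * (400 * (K + 1) ^ 3 + T) + 2 * (l.map fun Q => p * Q.c).sum + p + 10) ∧
      s' 1 = natCode (if G.pins.countP (badPin D.tL D.tR) = 0 then
        (l.map fun Q => v Q * Q.c).sum % p else 0) := by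
    split_ifs with h
    · obtain ⟨s', h1, h2⟩ := runsWithin_writeResidue (O := O) (p := p) (r := 0) hp
        (n := (l.map fun Q => p * Q.c).sum) (m := (l.map fun Q => v Q * Q.c).sum)
        (List.sum_le_sum fun Q hQ => Nat.mul_le_mul_right _ (hv Q hQ).le)
        (s := frame (base x [] [] [] [] [] [] [] []
          (ones (l.length * G.pins.countP (badPin D.tL D.tR)))
          (ones (l.map fun Q => v Q * Q.c).sum)) [] [] [] [] [] [] []) rfl rfl
      refine ⟨s', (hq.seq (RunsWithin.cond_false (by simp [h, topTrue]) h1)).mono (by omega), ?_⟩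
      rw [h2, zero_add]
    · refine ⟨_, (hq.seq (RunsWithin.cond_true ?_ (runsWithin_write 1 _ _))).mono ?_, ?_⟩
      · rw [frame_apply_of_lt _ _ _ _ _ _ _ _ (by norm_num), base_apply_9, topTrue_ones]
        exact decide_eq_true (Nat.mul_pos (List.length_pos_iff.2 hl) (Nat.pos_of_ne_zero h))
      · rw [length_natCode]
        omega
      · simp
  obtain ⟨s', ⟨t, ht, hr⟩, hs'⟩ := key
  exact ⟨t, s', hr, ht, hs'⟩

end

section

open Function

/-! ### Quotients by lists of pairs -/

theorem identify_lt {x y z n : ℕ} (hx : x < n) (hy : y < n) (hz : z < n) (hxy : x ≠ y) :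
    identify x y z < n - 1 := by
  unfold identify mergeMap
  split_ifs <;> omega

/-- A right inverse of `identify x y`. -/
def identifySection (x y w : ℕ) : ℕ := if w < x + (y - x) then w else w + 1

theorem identify_identifySection {x y : ℕ} (w : ℕ) :
    identify x y (identifySection x y w) = w := by
  unfold identify identifySection mergeMap
  split_ifs <;> omega

/-- The composite of `identify` with its section moves only the maximum of `x` and `y`, to the
minimum, and `α` takes the same value at both. Thus `α` factors through `identify x y`. -/
theorem apply_identifySection_identify {X : Type*} {α : ℕ → X} {x y : ℕ} (hxy : x ≠ y)
    (h : α x = α y) (z : ℕ) : α (identifySection x y (identify x y z)) = α z := by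
  have h1 : z ≠ x + (y - x) → identifySection x y (identify x y z) = z := by
    intro hz
    unfold identify identifySection mergeMap
    split_ifs <;> omega
  by_cases hz : z = x + (y - x)
  · have h2 : identifySection x y (identify x y z) = min x y := by
      unfold identify identifySection mergeMap
      split_ifs <;> omega
    rw [h2]
    rcases le_total x y with hle | hle
    · rw [min_eq_left hle, h]; congr 1; omega
    · rw [min_eq_right hle, ← h]; congr 1; omega
  · rw [h1 hz]

/-- `mergePairs n l q` renames the numbers less than `n` by the quotient map for the equivalence
relation generated by `q`. -/
theorem exists_quotientMap (X : Type*) (n : ℕ) (l : List ℕ) (q : List (ℕ × ℕ))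
    (hq : ∀ p ∈ q, p.1 < n ∧ p.2 < n) :
    ∃ g : ℕ → ℕ, (mergePairs n l q).2 = l.map g ∧ (∀ z < n, g z < (mergePairs n l q).1) ∧
      (∀ w < (mergePairs n l q).1, ∃ z < n, g z = w) ∧ (∀ p ∈ q, g p.1 = g p.2) ∧
      ∀ α : ℕ → X, (∀ p ∈ q, α p.1 = α p.2) → ∀ y < n, ∀ z < n, g y = g z → α y = α z := by
  induction hm : q.length generalizing n l q with
  | zero =>
    obtain rfl : q = [] := List.eq_nil_of_length_eq_zero hm
    refine ⟨id, ?_⟩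
    simp +contextual [mergePairs]
  | succ m ih =>
    obtain ⟨⟨x, y⟩, q, rfl⟩ := List.exists_cons_of_length_eq_add_one hm
    have hxy := hq (x, y) (by simp)
    have hq' : ∀ p ∈ q, p.1 < n ∧ p.2 < n := fun p hp => hq p (by simp [hp])
    simp only at hxy
    rw [mergePairs]
    split_ifs with h
    · obtain ⟨g, h1, h2, h3, h4, h5⟩ := ih n l q hq' (by simpa using hm)
      refine ⟨g, h1, h2, h3, ?_, fun α hα => h5 α fun p hp => hα p (by simp [hp])⟩
      intro p hp
      rcases List.mem_cons.1 hp with rfl | hp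
      · exact congrArg g h
      · exact h4 p hp
    · obtain ⟨g, h1, h2, h3, h4, h5⟩ := ih (n - 1) (l.map (identify x y))
        (q.map (Prod.map (identify x y) (identify x y))) (by
          simp only [List.mem_map, forall_exists_index, and_imp, forall_apply_eq_imp_iff₂]
          exact fun p hp => ⟨identify_lt hxy.1 hxy.2 (hq' p hp).1 h,
            identify_lt hxy.1 hxy.2 (hq' p hp).2 h⟩) (by simpa using hm)
      refine ⟨g ∘ identify x y, by rw [h1, List.map_map],
        fun z hz => h2 _ (identify_lt hxy.1 hxy.2 hz h), ?_, ?_, ?_⟩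
      · intro w hw
        obtain ⟨z, hz, rfl⟩ := h3 w hw
        refine ⟨identifySection x y z, ?_, congrArg g (identify_identifySection z)⟩
        unfold identifySection
        split_ifs <;> omega
      · intro p hp
        rcases List.mem_cons.1 hp with rfl | hp
        · have hid : identify x y x = identify x y y := by
            unfold identify mergeMap
            split_ifs <;> omega
          exact congrArg g hid
        · exact h4 _ (List.mem_map.2 ⟨p, hp, rfl⟩)
      · intro α hα y' hy' z' hz' hg
        have hα0 : α x = α y := hα (x, y) (by simp)
        -- The descended function on the smaller set of numbers respects the renamed pairs, so the
        -- induction hypothesis applies to it.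
        have := h5 (α ∘ identifySection x y) (by
          simp only [List.mem_map, forall_exists_index, and_imp, forall_apply_eq_imp_iff₂,
            Prod.map_fst, Prod.map_snd, comp_apply, apply_identifySection_identify h hα0]
          exact fun p hp => hα p (by simp [hp])) _ (identify_lt hxy.1 hxy.2 hy' h) _
          (identify_lt hxy.1 hxy.2 hz' h) hg
        simpa only [comp_apply, apply_identifySection_identify h hα0] using this

/-! ### Homomorphisms as pairs of maps between the sides. -/

namespace BipGraph

variable {V W : Type*}

/-- A homomorphism of bipartite graphs, given by its values on both sides. -/
noncomputable def Hom.ofSides (G : BipGraph V) (H : BipGraph W) (f : G.left → H.left)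
    (g : G.right → H.right)
    (h : ∀ (u : G.left) (v : G.right), G.graph.Adj u v → H.graph.Adj (f u) (g v)) :
    G.Hom H := by
  classical
  have hr : ∀ v, v ∉ G.left → v ∈ G.right := fun v hv =>
    (Set.eq_univ_iff_forall.1 G.cover v).resolve_left hv
  have hl : ∀ v, v ∈ G.right → v ∉ G.left := fun v hv hv' =>
    Set.disjoint_left.1 G.isBipartite.disjoint hv' hv
  let φ : V → W := fun v => if hv : v ∈ G.left then f ⟨v, hv⟩ else g ⟨v, hr v hv⟩
  have hφl : ∀ v (hv : v ∈ G.left), φ v = f ⟨v, hv⟩ := fun v hv => dif_pos hv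
  have hφr : ∀ v (hv : v ∈ G.right), φ v = g ⟨v, hv⟩ := fun v hv => dif_neg (hl v hv)
  refine ⟨⟨φ, ?_⟩, ?_, ?_⟩
  · intro u v huv
    rcases G.isBipartite.mem_of_adj huv with ⟨hu, hv⟩ | ⟨hu, hv⟩
    · rw [hφl u hu, hφr v hv]
      exact h ⟨u, hu⟩ ⟨v, hv⟩ huv
    · rw [hφr u hu, hφl v hv]
      exact (h ⟨v, hv⟩ ⟨u, hu⟩ huv.symm).symm
  · intro v hv
    have : φ v ∈ H.left := by rw [hφl v hv]; exact (f ⟨v, hv⟩).2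
    exact this
  · intro v hv
    have : φ v ∈ H.right := by rw [hφr v hv]; exact (g ⟨v, hv⟩).2
    exact this

theorem Hom.ofSides_left {G : BipGraph V} {H : BipGraph W} {f : G.left → H.left}
    {g : G.right → H.right}
    (h : ∀ (u : G.left) (v : G.right), G.graph.Adj u v → H.graph.Adj (f u) (g v)) (v : G.left) :
    (Hom.ofSides G H f g h).1 v = f v := dif_pos v.2

theorem Hom.ofSides_right {G : BipGraph V} {H : BipGraph W} {f : G.left → H.left}
    {g : G.right → H.right}
    (h : ∀ (u : G.left) (v : G.right), G.graph.Adj u v → H.graph.Adj (f u) (g v)) (v : G.right) :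
    (Hom.ofSides G H f g h).1 v = g v :=
  dif_neg fun hv => Set.disjoint_left.1 G.isBipartite.disjoint hv v.2

theorem Hom.ext {G : BipGraph V} {H : BipGraph W} {σ τ : G.Hom H} (h : ∀ v, σ.1 v = τ.1 v) :
    σ = τ := Subtype.ext (RelHom.ext h)

end BipGraph

open BipGraph

/-- A homomorphism from an input graph, given by its values on both sides. -/
def BipInput.homOfSides {W : Type*} (G : BipInput) (H : BipGraph W) (f : Fin G.a → H.left)
    (g : Fin G.b → H.right) (h : ∀ e ∈ G.edges, H.graph.Adj (f e.1) (g e.2)) :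
    G.toBipGraph.Hom H := by
  refine ⟨⟨Sum.elim (fun i => (f i : W)) (fun j => (g j : W)), ?_⟩, ?_, ?_⟩
  · rintro (i | j) (i' | j') hij
    · exact hij.elim
    · exact h (i, j') hij
    · exact (h (i', j) hij).symm
    · exact hij.elim
  · rintro _ ⟨i, rfl⟩
    exact (f i).2
  · rintro _ ⟨j, rfl⟩
    exact (g j).2

/-- The maps from `n` left and `n'` right vertices to the sides of `H` that map the pairs in `E` to
edges and identify the pairs in `q` and `q'`. -/
def Solution {W : Type*} (H : BipGraph W) (n n' : ℕ) (E q q' : List (ℕ × ℕ)) : Type _ :=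
  {f : (Fin n → H.left) × (Fin n' → H.right) //
    (∀ i j, (i.1, j.1) ∈ E → H.graph.Adj (f.1 i) (f.2 j)) ∧
    (∀ i j : Fin n, (i.1, j.1) ∈ q → f.1 i = f.1 j) ∧
    ∀ i j : Fin n', (i.1, j.1) ∈ q' → f.2 i = f.2 j}

variable {W : Type*} (H : BipGraph W)

/-- Turns homomorphism counts into numbers of solutions of constraints on plain numbers, the form in
which the renumbering acts. Only membership in the edge list matters, so its order and repetitions
are irrelevant. -/
theorem BipInput.numHom_eq (G : BipInput) : G.toBipGraph.numHom H =
    Nat.card (Solution H G.a G.b (G.edges.map fun e => (e.1.1, e.2.1)) [] []) := by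
  have mem : ∀ i j, ((i, j) : Fin G.a × Fin G.b) ∈ G.edges ↔
      (i.1, j.1) ∈ G.edges.map fun e => (e.1.1, e.2.1) := by
    intro i j
    simp only [List.mem_map, Prod.mk.injEq, Prod.exists]
    constructor
    · exact fun h => ⟨i, j, h, rfl, rfl⟩
    · rintro ⟨i', j', h, hi, hj⟩
      obtain rfl := Fin.ext hi
      obtain rfl := Fin.ext hj
      exact h
  refine Nat.card_eq_of_bijective (fun σ => ⟨(fun i => ⟨σ.1 (.inl i), σ.2.1 _ ⟨i, rfl⟩⟩,
    fun j => ⟨σ.1 (.inr j), σ.2.2 _ ⟨j, rfl⟩⟩), ?_, by simp, by simp⟩) ⟨?_, ?_⟩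
  · intro i j hij
    exact σ.1.map_rel (show G.toBipGraph.graph.Adj (.inl i) (.inr j) from (mem i j).2 hij)
  · intro σ τ h
    have h' := congrArg Subtype.val h
    refine Hom.ext ?_
    rintro (i | j)
    · exact congrArg Subtype.val (congrFun (congrArg Prod.fst h') i)
    · exact congrArg Subtype.val (congrFun (congrArg Prod.snd h') j)
  · rintro ⟨⟨f, g⟩, hfg, -⟩
    exact ⟨G.homOfSides H f g fun e he => hfg e.1 e.2 ((mem e.1 e.2).1 he), rfl⟩

/-- Functions on the quotient are functions that identify the given pairs. -/
theorem exists_quotient (X : Type*) (n : ℕ) (l : List ℕ) (q : List (ℕ × ℕ))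
    (hq : ∀ p ∈ q, p.1 < n ∧ p.2 < n) :
    ∃ g : Fin n → Fin (mergePairs n l q).1, Surjective g ∧
      (∃ g' : ℕ → ℕ, (mergePairs n l q).2 = l.map g' ∧ ∀ i : Fin n, g' i = g i) ∧
      ∀ α : Fin n → X, (∀ i j, (i.1, j.1) ∈ q → α i = α j) ↔ ∃ β, α = β ∘ g := by
  -- A function on `Fin n` has to be extended to all numbers; `none` serves as the value outside
  -- even if `X` is empty.
  obtain ⟨g, h1, h2, h3, h4, h5⟩ := exists_quotientMap (Option X) n l q hq
  refine ⟨fun i => ⟨g i, h2 i i.2⟩, ?_, ⟨g, h1, fun _ => rfl⟩, fun α => ⟨fun hα => ?_, ?_⟩⟩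
  · rintro ⟨w, hw⟩
    obtain ⟨z, hz, rfl⟩ := h3 w hw
    exact ⟨⟨z, hz⟩, rfl⟩
  · have hker : ∀ i j : Fin n, g i = g j → α i = α j := by
      intro i j hij
      have := h5 (fun z => if hz : z < n then some (α ⟨z, hz⟩) else none) (by
        intro p hp
        have h := hq p hp
        simp only [h.1, h.2, dif_pos]
        exact congrArg some (hα ⟨p.1, h.1⟩ ⟨p.2, h.2⟩ hp)) i i.2 j j.2 hij
      simpa using this
    have hs : Surjective fun i : Fin n => (⟨g i, h2 i i.2⟩ : Fin (mergePairs n l q).1) := by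
      rintro ⟨w, hw⟩
      obtain ⟨z, hz, rfl⟩ := h3 w hw
      exact ⟨⟨z, hz⟩, rfl⟩
    refine ⟨fun w => α (surjInv hs w), ?_⟩
    funext i
    exact hker _ _ (congrArg Fin.val (surjInv_eq hs ⟨g i, h2 i i.2⟩)).symm
  · rintro ⟨β, rfl⟩ i j hij
    simp only [comp_apply]
    congr 2
    exact h4 _ hij

/-- Composition with the two quotient maps is a bijection: it is injective since these maps are
surjective, and it reaches exactly the maps that identify the given pairs. -/
theorem card_solution_mergePairs {n n' : ℕ} {l l' : List ℕ} {q q' : List (ℕ × ℕ)}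
    (hq : ∀ p ∈ q, p.1 < n ∧ p.2 < n) (hq' : ∀ p ∈ q', p.1 < n' ∧ p.2 < n')
    (hl : ∀ z ∈ l, z < n) (hl' : ∀ z ∈ l', z < n') :
    Nat.card (Solution H (mergePairs n l q).1 (mergePairs n' l' q').1
      ((mergePairs n l q).2.zip (mergePairs n' l' q').2) [] []) =
    Nat.card (Solution H n n' (l.zip l') q q') := by
  obtain ⟨g, hg, ⟨k, hk, hkg⟩, h⟩ := exists_quotient H.left n l q hq
  obtain ⟨g', hg', ⟨k', hk', hkg'⟩, h'⟩ := exists_quotient H.right n' l' q' hq'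
  rw [hk, hk', List.zip_map]
  refine Nat.card_eq_of_bijective (fun f => ⟨(f.1.1 ∘ g, f.1.2 ∘ g'), ?_, ?_, ?_⟩) ⟨?_, ?_⟩
  · intro i j hij
    refine f.2.1 _ _ (List.mem_map.2 ⟨_, hij, ?_⟩)
    simp [hkg, hkg']
  · exact (h _).2 ⟨f.1.1, rfl⟩
  · exact (h' _).2 ⟨f.1.2, rfl⟩
  · intro f₁ f₂ hf
    have hf' := congrArg Subtype.val hf
    exact Subtype.ext (Prod.ext (hg.injective_comp_right (congrArg Prod.fst hf'))
      (hg'.injective_comp_right (congrArg Prod.snd hf')))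
  · rintro ⟨⟨α, α'⟩, hadj, hα, hα'⟩
    obtain ⟨β, rfl⟩ := (h α).1 hα
    obtain ⟨β', rfl⟩ := (h' α').1 hα'
    refine ⟨⟨(β, β'), ?_, by simp, by simp⟩, rfl⟩
    intro i j hij
    obtain ⟨⟨y, z⟩, hyz, he⟩ := List.mem_map.1 hij
    -- An edge of the quotient comes from a listed edge, whose ends are actual vertices by the
    -- bounds on the lists.
    have hy := hl y (List.of_mem_zip hyz).1
    have hz := hl' z (List.of_mem_zip hyz).2
    have := hadj ⟨y, hy⟩ ⟨z, hz⟩ hyz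
    simp only [Prod.map_apply, Prod.mk.injEq] at he
    have e1 : g ⟨y, hy⟩ = i := Fin.ext ((hkg ⟨y, hy⟩).symm.trans he.1)
    have e2 : g' ⟨z, hz⟩ = j := Fin.ext ((hkg' ⟨z, hz⟩).symm.trans he.2)
    simpa [e1, e2] using this

end

section

open Function BipGraph

/-! ### The numbering of the target graph -/

section numbering

variable {V : Type*} [Finite V]

open Classical in
/-- The number of an element of a finite set. -/
noncomputable def num (s : Set V) (v : V) : ℕ :=
  if h : v ∈ s then (Finite.equivFin s ⟨v, h⟩).1 else 0

theorem num_eq {s : Set V} (v : s) : num s v = (Finite.equivFin s v).1 := dif_pos v.2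

theorem num_lt {s : Set V} {v : V} (hv : v ∈ s) : num s v < Nat.card s := by
  rw [num, dif_pos hv]
  exact Fin.is_lt _

open Classical in
/-- The table of the numbers of the elements of `s`. -/
noncomputable def numTable {m : ℕ} (e : V ≃ Fin m) (s : Set V) : List (Option ℕ) :=
  List.ofFn fun k => if e.symm k ∈ s then some (num s (e.symm k)) else none

open Classical in
theorem label_numTable {m : ℕ} (e : V ≃ Fin m) (s : Set V) (v : V) :
    label (numTable e s) (e v) = if v ∈ s then some (num s v) else none := by
  simp [label, numTable]

theorem label_numTable_le {m : ℕ} (e : V ≃ Fin m) (s : Set V) (k : ℕ) :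
    (label (numTable e s) k).getD 0 ≤ Nat.card s := by
  classical
  by_cases hk : k < m
  · obtain ⟨v, hv⟩ := e.surjective ⟨k, hk⟩
    have : k = e v := by rw [hv]
    rw [this, label_numTable]
    split_ifs with h
    · exact (num_lt h).le
    · simp
  · have : label (numTable e s) k = none := by
      simp [label, numTable, hk]
    simp [this]

open Classical in
/-- The numbers of pairs of elements of `s`. -/
noncomputable def numPairs (s : Set V) (S : Finset (V × V)) : List (ℕ × ℕ) :=
  (S.toList.filter fun x => x.1 ∈ s).map fun x => (num s x.1, num s x.2)

theorem mem_numPairs {s : Set V} {S : Finset (V × V)} {i j : ℕ} :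
    (i, j) ∈ numPairs s S ↔ ∃ x ∈ S, x.1 ∈ s ∧ num s x.1 = i ∧ num s x.2 = j := by
  simp [numPairs, and_assoc]

open Classical in
/-- The edges of `H`, given by the numbers of their ends. -/
noncomputable def numEdges (H : BipGraph V) : List (ℕ × ℕ) :=
  let _ := Fintype.ofFinite V
  ((Finset.univ.filter fun x : V × V => x.1 ∈ H.left ∧ x.2 ∈ H.right ∧
    H.graph.Adj x.1 x.2).toList).map fun x => (num H.left x.1, num H.right x.2)

theorem mem_numEdges {H : BipGraph V} {i j : ℕ} : (i, j) ∈ numEdges H ↔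
    ∃ (u : H.left) (v : H.right), H.graph.Adj u v ∧ num H.left u = i ∧ num H.right v = j := by
  simp only [numEdges, List.mem_map, Finset.mem_toList, Finset.mem_filter, Finset.mem_univ,
    true_and, Prod.mk.injEq, Prod.exists, Subtype.exists]
  constructor
  · rintro ⟨u, v, ⟨hu, hv, h⟩, hi, hj⟩
    exact ⟨u, hu, v, hv, h, hi, hj⟩
  · rintro ⟨u, hu, v, hv, h, hi, hj⟩
    exact ⟨u, v, ⟨hu, hv, h⟩, hi, hj⟩

/-- The target graph as data of the program. -/
noncomputable def targetData {m : ℕ} (e : V ≃ Fin m) (H : BipGraph V) : TargetData where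
  a := Nat.card H.left
  b := Nat.card H.right
  edges := numEdges H
  tL := numTable e H.left
  tR := numTable e H.right

/-- The query about the quotient by the pairs in `S`, with a coefficient. -/
noncomputable def queryData (H : BipGraph V) (c : Finset (V × V) → ℕ) (S : Finset (V × V)) :
    QueryData := ⟨numPairs H.left S, numPairs H.right S, c S⟩

end numbering

/-- The number of a vertex on its side. -/
def BipInput.index (G : BipInput) : G.Vertex → ℕ := Sum.elim Fin.val Fin.val

/-- An input graph with a list of pins as data of the program. -/
def BipInput.pinnedData {V : Type*} {m : ℕ} (e : V ≃ Fin m) (G : BipInput)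
    (l : List (G.Vertex × V)) : PinnedData where
  a := G.a
  b := G.b
  edges := G.edges.map fun x => (x.1.1, x.2.1)
  pins := l.map fun x => (x.1.isRight, G.index x.1, (e x.2).1)

/-- Pairs of homomorphisms from `G` to `H` and from `H` to `H` that are compatible with the pins,
the latter identifying the pairs in `S`. -/
def PairHom {V : Type*} (G : BipInput) (H : BipGraph V) (l : List (G.Vertex × V))
    (S : Finset (V × V)) : Type _ :=
  {x : G.toBipGraph.Hom H × H.Hom H //
    (∀ q ∈ l, x.1.1 q.1 = x.2.1 q.2) ∧ ∀ s ∈ S, x.2.1 s.1 = x.2.1 s.2}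

/-- The pairs of the vertices of `H` on the same side. -/
def BipGraph.SameSide {V : Type*} (H : BipGraph V) (S : Finset (V × V)) : Prop :=
  ∀ s ∈ S, (s.1 ∈ H.left ∧ s.2 ∈ H.left) ∨ (s.1 ∈ H.right ∧ s.2 ∈ H.right)

/-- All labels are on the sides of the vertices that are pinned to them. -/
def BipInput.GoodPins {V : Type*} (G : BipInput) (H : BipGraph V) (l : List (G.Vertex × V)) : Prop :=
  (∀ i v, (.inl i, v) ∈ l → v ∈ H.left) ∧ ∀ j v, (.inr j, v) ∈ l → v ∈ H.right

theorem BipGraph.not_mem_left_of_mem_right {V : Type*} {H : BipGraph V} {v : V}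
    (hv : v ∈ H.right) : v ∉ H.left := fun hv' =>
  Set.disjoint_left.1 H.isBipartite.disjoint hv' hv

theorem BipGraph.not_mem_right_of_mem_left {V : Type*} {H : BipGraph V} {v : V}
    (hv : v ∈ H.left) : v ∉ H.right := fun hv' =>
  Set.disjoint_left.1 H.isBipartite.disjoint hv hv'

/-! ### Solutions on the glued union of `H` and `G` as pairs of homomorphisms. -/

section counting

variable {V : Type*} [Finite V] {m : ℕ} (e : V ≃ Fin m) {H : BipGraph V} {G : BipInput}
  {l : List (G.Vertex × V)} {c : Finset (V × V) → ℕ} {S : Finset (V × V)}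

/-- For good pins the table lookup never fails, so the default `0` for missing labels does not
occur. -/
theorem mem_pairsL (hl : G.GoodPins H l) {i j : ℕ} :
    (i, j) ∈ (G.pinnedData e l).pairsL (targetData e H) (queryData H c S) ↔
      (∃ (x : Fin G.a) (v : V), (.inl x, v) ∈ l ∧ num H.left v = i ∧ Nat.card H.left + x.1 = j) ∨
      ∃ s ∈ S, s.1 ∈ H.left ∧ num H.left s.1 = i ∧ num H.left s.2 = j := by
  classical
  simp only [PinnedData.pairsL, queryData, List.mem_append, mem_numPairs, pinPairs,
    BipInput.pinnedData, targetData, List.mem_reverse, List.mem_map, List.mem_filter]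
  refine or_congr ⟨?_, ?_⟩ Iff.rfl
  · rintro ⟨_, ⟨⟨⟨x | x, v⟩, hx, rfl⟩, hs⟩, hij⟩
    · simp only [label_numTable, if_pos (hl.1 x v hx), Prod.mk.injEq] at hij
      exact ⟨x, v, hx, hij⟩
    · simp at hs
  · rintro ⟨x, v, hx, rfl, rfl⟩
    refine ⟨_, ⟨⟨(.inl x, v), hx, rfl⟩, by simp⟩, ?_⟩
    simp [label_numTable, hl.1 x v hx, BipInput.index]

theorem mem_pairsR (hl : G.GoodPins H l) {i j : ℕ} :
    (i, j) ∈ (G.pinnedData e l).pairsR (targetData e H) (queryData H c S) ↔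
      (∃ (x : Fin G.b) (v : V), (.inr x, v) ∈ l ∧ num H.right v = i ∧ Nat.card H.right + x.1 = j) ∨
      ∃ s ∈ S, s.1 ∈ H.right ∧ num H.right s.1 = i ∧ num H.right s.2 = j := by
  classical
  simp only [PinnedData.pairsR, queryData, List.mem_append, mem_numPairs, pinPairs,
    BipInput.pinnedData, targetData, List.mem_reverse, List.mem_map, List.mem_filter]
  refine or_congr ⟨?_, ?_⟩ Iff.rfl
  · rintro ⟨_, ⟨⟨⟨x | x, v⟩, hx, rfl⟩, hs⟩, hij⟩
    · simp at hs
    · simp only [label_numTable, if_pos (hl.2 x v hx), Prod.mk.injEq] at hij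
      exact ⟨x, v, hx, hij⟩
  · rintro ⟨x, v, hx, rfl, rfl⟩
    refine ⟨_, ⟨⟨(.inr x, v), hx, rfl⟩, by simp⟩, ?_⟩
    simp [label_numTable, hl.2 x v hx, BipInput.index]

/-- The left and right ends were stacked in parallel, so zipping them recovers the edges of both
graphs. -/
theorem mem_zip_ends {i j : ℕ} :
    (i, j) ∈ ((G.pinnedData e l).endsL (targetData e H)).zip
      ((G.pinnedData e l).endsR (targetData e H)) ↔
      (∃ x ∈ G.edges, Nat.card H.left + x.1.1 = i ∧ Nat.card H.right + x.2.1 = j) ∨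
      ∃ (u : H.left) (v : H.right), H.graph.Adj u v ∧ num H.left u = i ∧ num H.right v = j := by
  rw [PinnedData.endsL, PinnedData.endsR, List.zip_append (by simp), ← List.map_reverse,
    ← List.map_reverse, List.zip_map', List.zip_map', List.mem_append, ← mem_numEdges]
  simp [BipInput.pinnedData, targetData]

/-- The map on one side of the union of two graphs. -/
noncomputable def unionMap {s : Set V} {n : ℕ} (y : s → s) (f : Fin n → s) :
    Fin (Nat.card s + n) → s :=
  Fin.append (fun k => y ((Finite.equivFin s).symm k)) f

theorem unionMap_of_eq_num {s : Set V} {n : ℕ} (y : s → s) (f : Fin n → s) {v : V} (hv : v ∈ s)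
    {k : Fin (Nat.card s + n)} (hk : num s v = k) : unionMap y f k = y ⟨v, hv⟩ := by
  have : k = Fin.castAdd n (Finite.equivFin s ⟨v, hv⟩) :=
    Fin.ext (hk.symm.trans (num_eq ⟨v, hv⟩))
  rw [this, unionMap, Fin.append_left, Equiv.symm_apply_apply]

theorem unionMap_of_eq_add {s : Set V} {n : ℕ} (y : s → s) (f : Fin n → s) {x : Fin n}
    {k : Fin (Nat.card s + n)} (hk : Nat.card s + x.1 = k) : unionMap y f k = f x := by
  have : k = Fin.natAdd (Nat.card s) x := Fin.ext hk.symm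
  rw [this, unionMap, Fin.append_right]

theorem unionMap_eq {s : Set V} {n : ℕ} {y : s → s} {f : Fin n → s}
    {h : Fin (Nat.card s + n) → s} (hy : ∀ v, y v = h (Fin.castAdd n (Finite.equivFin s v)))
    (hf : ∀ i, f i = h (Fin.natAdd _ i)) : unionMap y f = h := by
  funext k
  refine Fin.addCases (fun k => ?_) (fun k => ?_) k
  · rw [unionMap, Fin.append_left, hy, Equiv.apply_symm_apply]
  · rw [unionMap, Fin.append_right, hf]

/-- A map on the disjoint union is a map `y` on the block of `H` together with a map `σ` on the
block of `G`. Gluing a label to its vertex means that `σ` and `y` agree there, and gluing the pairs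
in `S` is a condition on `y` alone. -/
theorem card_solution_union (hl : G.GoodPins H l) (hS : H.SameSide S) :
    Nat.card (Solution H (Nat.card H.left + G.a) (Nat.card H.right + G.b)
      (((G.pinnedData e l).endsL (targetData e H)).zip ((G.pinnedData e l).endsR (targetData e H)))
      ((G.pinnedData e l).pairsL (targetData e H) (queryData H c S))
      ((G.pinnedData e l).pairsR (targetData e H) (queryData H c S))) =
    Nat.card (PairHom G H l S) := by
  symm
  refine Nat.card_eq_of_bijective (fun x => ⟨
    (unionMap (fun v => ⟨x.1.2.1 v, x.1.2.2.1 _ v.2⟩)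
      (fun i => ⟨x.1.1.1 (.inl i), x.1.1.2.1 _ ⟨i, rfl⟩⟩),
    unionMap (fun v => ⟨x.1.2.1 v, x.1.2.2.2 _ v.2⟩)
      (fun i => ⟨x.1.1.1 (.inr i), x.1.1.2.2 _ ⟨i, rfl⟩⟩)), ?_, ?_, ?_⟩) ⟨?_, ?_⟩
  · intro i j hij
    rcases (mem_zip_ends e).1 hij with ⟨⟨a, b⟩, hab, hi, hj⟩ | ⟨u, v, huv, hi, hj⟩
    · simp only
      rw [unionMap_of_eq_add _ _ hi, unionMap_of_eq_add _ _ hj]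
      exact x.1.1.1.map_rel (show G.toBipGraph.graph.Adj (.inl a) (.inr b) from hab)
    · simp only
      rw [unionMap_of_eq_num _ _ u.2 hi, unionMap_of_eq_num _ _ v.2 hj]
      exact x.1.2.1.map_rel huv
  · intro i j hij
    rcases (mem_pairsL e hl).1 hij with ⟨a, v, hav, hi, hj⟩ | ⟨s, hs, hsl, hi, hj⟩
    · simp only
      rw [unionMap_of_eq_num _ _ (hl.1 _ _ hav) hi, unionMap_of_eq_add _ _ hj]
      exact Subtype.ext (x.2.1 _ hav).symm
    · have hsl' : s.2 ∈ H.left := by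
        rcases hS s hs with h | h
        · exact h.2
        · exact absurd hsl (not_mem_left_of_mem_right h.1)
      simp only
      rw [unionMap_of_eq_num _ _ hsl hi, unionMap_of_eq_num _ _ hsl' hj]
      exact Subtype.ext (x.2.2 s hs)
  · intro i j hij
    rcases (mem_pairsR e hl).1 hij with ⟨a, v, hav, hi, hj⟩ | ⟨s, hs, hsl, hi, hj⟩
    · simp only
      rw [unionMap_of_eq_num _ _ (hl.2 _ _ hav) hi, unionMap_of_eq_add _ _ hj]
      exact Subtype.ext (x.2.1 _ hav).symm
    · have hsl' : s.2 ∈ H.right := by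
        rcases hS s hs with h | h
        · exact absurd hsl (not_mem_right_of_mem_left h.1)
        · exact h.2
      simp only
      rw [unionMap_of_eq_num _ _ hsl hi, unionMap_of_eq_num _ _ hsl' hj]
      exact Subtype.ext (x.2.2 s hs)
  · rintro ⟨⟨σ, y⟩, h1⟩ ⟨⟨τ, z⟩, h2⟩ h
    have h' := congrArg Subtype.val h
    have hL := congrArg Prod.fst h'
    have hR := congrArg Prod.snd h'
    simp only at hL hR
    have e1 : σ = τ := by
      refine Hom.ext ?_
      rintro (i | i)
      · have := congrFun hL (Fin.natAdd _ i)
        rw [unionMap_of_eq_add _ _ rfl, unionMap_of_eq_add _ _ rfl] at this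
        exact congrArg Subtype.val this
      · have := congrFun hR (Fin.natAdd _ i)
        rw [unionMap_of_eq_add _ _ rfl, unionMap_of_eq_add _ _ rfl] at this
        exact congrArg Subtype.val this
    have e2 : y = z := by
      refine Hom.ext fun v => ?_
      rcases Set.eq_univ_iff_forall.1 H.cover v with hv | hv
      · have := congrFun hL (Fin.castAdd _ (Finite.equivFin H.left ⟨v, hv⟩))
        rw [unionMap_of_eq_num _ _ hv (num_eq ⟨v, hv⟩),
          unionMap_of_eq_num _ _ hv (num_eq ⟨v, hv⟩)] at this
        exact congrArg Subtype.val this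
      · have := congrFun hR (Fin.castAdd _ (Finite.equivFin H.right ⟨v, hv⟩))
        rw [unionMap_of_eq_num _ _ hv (num_eq ⟨v, hv⟩),
          unionMap_of_eq_num _ _ hv (num_eq ⟨v, hv⟩)] at this
        exact congrArg Subtype.val this
    subst e1 e2
    rfl
  · rintro ⟨⟨f, g⟩, hE, hL, hR⟩
    simp only at hE hL hR
    have aσ : ∀ x ∈ G.edges, H.graph.Adj (f (Fin.natAdd _ x.1)) (g (Fin.natAdd _ x.2)) :=
      fun x hx => hE _ _ ((mem_zip_ends e).2 (.inl ⟨x, hx, rfl, rfl⟩))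
    have ay : ∀ (u : H.left) (v : H.right), H.graph.Adj u v →
        H.graph.Adj (f (Fin.castAdd _ (Finite.equivFin H.left u)))
          (g (Fin.castAdd _ (Finite.equivFin H.right v))) :=
      fun u v huv => hE _ _ ((mem_zip_ends e).2 (.inr ⟨u, v, huv, num_eq u, num_eq v⟩))
    have yl := Hom.ofSides_left ay
    have yr := Hom.ofSides_right ay
    refine ⟨⟨(G.homOfSides H (fun i => f (Fin.natAdd _ i)) (fun j => g (Fin.natAdd _ j)) aσ,
      Hom.ofSides H H _ _ ay), ?_, ?_⟩, ?_⟩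
    · rintro ⟨x | x, v⟩ hx
      · have hv := hl.1 _ _ hx
        refine Eq.trans ?_ (yl ⟨v, hv⟩).symm
        exact congrArg Subtype.val (hL _ _ ((mem_pairsL e hl).2
          (.inl ⟨x, v, hx, num_eq ⟨v, hv⟩, rfl⟩))).symm
      · have hv := hl.2 _ _ hx
        refine Eq.trans ?_ (yr ⟨v, hv⟩).symm
        exact congrArg Subtype.val (hR _ _ ((mem_pairsR e hl).2
          (.inl ⟨x, v, hx, num_eq ⟨v, hv⟩, rfl⟩))).symm
    · rintro ⟨u, v⟩ hs
      rcases hS _ hs with ⟨hu, hv⟩ | ⟨hu, hv⟩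
      · refine (yl ⟨u, hu⟩).trans (Eq.trans ?_ (yl ⟨v, hv⟩).symm)
        exact congrArg Subtype.val (hL _ _ ((mem_pairsL e hl).2
          (.inr ⟨_, hs, hu, num_eq ⟨u, hu⟩, num_eq ⟨v, hv⟩⟩)))
      · refine (yr ⟨u, hu⟩).trans (Eq.trans ?_ (yr ⟨v, hv⟩).symm)
        exact congrArg Subtype.val (hR _ _ ((mem_pairsR e hl).2
          (.inr ⟨_, hs, hu, num_eq ⟨u, hu⟩, num_eq ⟨v, hv⟩⟩)))
    · have kL : unionMap (s := H.left) (fun v => ⟨(Hom.ofSides H H _ _ ay).1 v,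
          (Hom.ofSides H H _ _ ay).2.1 _ v.2⟩) (fun i => f (Fin.natAdd _ i)) = f :=
        unionMap_eq (fun v => Subtype.ext (yl v)) fun i => rfl
      have kR : unionMap (s := H.right) (fun v => ⟨(Hom.ofSides H H _ _ ay).1 v,
          (Hom.ofSides H H _ _ ay).2.2 _ v.2⟩) (fun i => g (Fin.natAdd _ i)) = g :=
        unionMap_eq (fun v => Subtype.ext (yr v)) fun i => rfl
      exact Subtype.ext (Prod.ext kL kR)

end counting

end

section

open Function BipGraph

/-! ### Automorphisms -/

section automorphisms

variable {V : Type*} (H : BipGraph V)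

/-- The group of the automorphisms of `H` that preserve both sides. -/
def BipGraph.autGroup : Subgroup (H.graph ≃g H.graph) where
  carrier := {φ | (∀ v ∈ H.left, φ v ∈ H.left) ∧ ∀ v ∈ H.right, φ v ∈ H.right}
  one_mem' := ⟨fun _ h => h, fun _ h => h⟩
  mul_mem' := fun {φ ψ} hφ hψ =>
    ⟨fun v hv => hφ.1 _ (hψ.1 v hv), fun v hv => hφ.2 _ (hψ.2 v hv)⟩
  inv_mem' := by
    intro φ hφ
    have h : ∀ v, φ (φ⁻¹ v) = v := fun v => φ.apply_symm_apply v
    refine ⟨fun v hv => ?_, fun v hv => ?_⟩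
    · rcases Set.eq_univ_iff_forall.1 H.cover (φ⁻¹ v) with h' | h'
      · exact h'
      · have := hφ.2 _ h'
        rw [h] at this
        exact absurd hv (not_mem_left_of_mem_right this)
    · rcases Set.eq_univ_iff_forall.1 H.cover (φ⁻¹ v) with h' | h'
      · have := hφ.1 _ h'
        rw [h] at this
        exact absurd this (not_mem_left_of_mem_right hv)
      · exact h'

variable {H}

/-- On a finite set an injective self-map is a permutation of finite order. Its inverse is one of
its powers, and powers of a homomorphism preserve adjacency. -/
theorem BipGraph.exists_automorphism [Finite V] {y : H.Hom H} (hy : Injective y.1) :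
    ∃ φ ∈ H.autGroup, ∀ v, φ v = y.1 v := by
  let π : Equiv.Perm V := Equiv.ofBijective y.1 (Finite.injective_iff_bijective.1 hy)
  have hπ : ∀ u v, H.graph.Adj u v → H.graph.Adj (π u) (π v) := fun u v h => y.1.map_rel h
  have hπn : ∀ (n : ℕ) u v, H.graph.Adj u v → H.graph.Adj ((π ^ n) u) ((π ^ n) v) := by
    intro n
    induction n with
    | zero => exact fun u v h => h
    | succ n ih =>
      intro u v h
      rw [pow_succ]
      exact ih _ _ (hπ u v h)
  refine ⟨⟨π, fun {u v} => ⟨fun h => ?_, hπ u v⟩⟩, ⟨y.2.1, y.2.2⟩, fun v => rfl⟩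
  have hn := hπn (orderOf π - 1) _ _ h
  have e : π ^ (orderOf π - 1) * π = 1 := by
    rw [← pow_succ, Nat.sub_add_cancel (orderOf_pos π), pow_orderOf_eq_one]
  have e' : ∀ w, (π ^ (orderOf π - 1)) (π w) = w := fun w => Equiv.Perm.congr_fun e w
  rwa [e', e'] at hn

/-- Cauchy's theorem: otherwise the group would have an element of order `p`. -/
theorem BipGraph.not_dvd_card_autGroup [Finite V] {p : ℕ} (hp : p.Prime)
    (hH : H.PartitionwiseReduced p) : ¬ p ∣ Nat.card H.autGroup := by
  intro h
  have := Fact.mk hp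
  have : Finite (H.graph ≃g H.graph) := DFunLike.finite _
  obtain ⟨φ, hφ⟩ := exists_prime_orderOf_dvd_card' p h
  exact hH ⟨φ.1, φ.2.1, φ.2.2, by rw [Subgroup.orderOf_coe, hφ]⟩

end automorphisms

/-! ### Counting pinned homomorphisms by inclusion and exclusion -/

section counting

variable {V : Type*} {H : BipGraph V} {G : BipInput} {l : List (G.Vertex × V)}

instance BipGraph.finite_hom {V W : Type*} [Finite V] [Finite W] (G : BipGraph V) (H : BipGraph W) :
    Finite (G.Hom H) :=
  Finite.of_injective (fun σ : G.Hom H => (σ.1 : V → W)) fun _ _ h => Hom.ext (congrFun h)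

/-- Homomorphisms that respect the pins. -/
def PinnedHom (G : BipInput) (H : BipGraph V) (l : List (G.Vertex × V)) : Type _ :=
  {σ : G.toBipGraph.Hom H // ∀ q ∈ l, σ.1 q.1 = q.2}

/-- The bijection sends `(φ, σ)` to `(φ ∘ σ, φ)`, with inverse `(τ, y) ↦ (y, y⁻¹ ∘ τ)`. -/
theorem card_pairHom_injective [Finite V] :
    Nat.card {x : G.toBipGraph.Hom H × H.Hom H //
      (∀ q ∈ l, x.1.1 q.1 = x.2.1 q.2) ∧ Injective x.2.1} =
    Nat.card H.autGroup * Nat.card (PinnedHom G H l) := by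
  rw [← Nat.card_prod]
  symm
  let comp : H.autGroup → G.toBipGraph.Hom H → G.toBipGraph.Hom H := fun φ σ =>
    ⟨φ.1.toHom.comp σ.1, fun v hv => φ.2.1 _ (σ.2.1 v hv), fun v hv => φ.2.2 _ (σ.2.2 v hv)⟩
  refine Nat.card_eq_of_bijective (fun x => ⟨(comp x.1 x.2.1, ⟨x.1.1.toHom, x.1.2.1, x.1.2.2⟩),
    fun q hq => congrArg x.1.1 (x.2.2 q hq), x.1.1.injective⟩) ⟨?_, ?_⟩
  · rintro ⟨φ, σ⟩ ⟨ψ, τ⟩ h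
    have h' := congrArg Subtype.val h
    have h2 : ∀ v, φ.1 v = ψ.1 v := fun v =>
      congrFun (congrArg (fun y : H.Hom H => (y.1 : V → V)) (congrArg Prod.snd h')) v
    have h1 : ∀ v, φ.1 (σ.1.1 v) = ψ.1 (τ.1.1 v) := fun v =>
      congrFun (congrArg (fun y : G.toBipGraph.Hom H => (y.1 : G.Vertex → V))
        (congrArg Prod.fst h')) v
    refine Prod.ext (Subtype.ext (RelIso.ext h2)) (Subtype.ext (Hom.ext fun v => ?_))
    have := h1 v
    rw [← h2] at this
    exact φ.1.injective this
  · rintro ⟨⟨τ, y⟩, hl, hy⟩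
    obtain ⟨φ, hφ, hv⟩ := exists_automorphism hy
    have hinv : ∀ v, φ⁻¹ (φ v) = v := fun v => φ.symm_apply_apply v
    have hinv' : ∀ v, φ (φ⁻¹ v) = v := fun v => φ.apply_symm_apply v
    refine ⟨(⟨φ, hφ⟩, ⟨comp ⟨φ⁻¹, inv_mem hφ⟩ τ, fun q hq => ?_⟩), ?_⟩
    · refine (congrArg (fun w => φ⁻¹ w) (hl q hq)).trans ?_
      exact (congrArg (fun w => φ⁻¹ w) (hv q.2).symm).trans (hinv q.2)
    · refine Subtype.ext (Prod.ext (Hom.ext fun v => hinv' _) (Hom.ext fun v => hv v))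

open Classical in
/-- The pairs of distinct vertices of `H` on the same side. -/
noncomputable def BipGraph.sidePairs [Finite V] (H : BipGraph V) : Finset (V × V) :=
  let _ := Fintype.ofFinite V
  Finset.univ.filter fun s => s.1 ≠ s.2 ∧
    ((s.1 ∈ H.left ∧ s.2 ∈ H.left) ∨ (s.1 ∈ H.right ∧ s.2 ∈ H.right))

theorem BipGraph.mem_sidePairs [Finite V] {s : V × V} : s ∈ H.sidePairs ↔ s.1 ≠ s.2 ∧
    ((s.1 ∈ H.left ∧ s.2 ∈ H.left) ∨ (s.1 ∈ H.right ∧ s.2 ∈ H.right)) := by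
  simp [sidePairs]

/-- Vertices on different sides have images on different sides, so only pairs on the same side can
collide. -/
theorem BipGraph.injective_iff_sidePairs [Finite V] (y : H.Hom H) :
    Injective y.1 ↔ ∀ s ∈ H.sidePairs, y.1 s.1 ≠ y.1 s.2 := by
  constructor
  · exact fun h s hs hy => (mem_sidePairs.1 hs).1 (h hy)
  · intro h u v huv
    by_contra hne
    have hc := fun w => Set.eq_univ_iff_forall.1 H.cover w
    rcases hc u with hu | hu <;> rcases hc v with hv | hv
    · exact h (u, v) (mem_sidePairs.2 ⟨hne, .inl ⟨hu, hv⟩⟩) huv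
    · have h1 := y.2.1 u hu
      rw [huv] at h1
      exact not_mem_left_of_mem_right (y.2.2 v hv) h1
    · have h1 := y.2.1 v hv
      rw [← huv] at h1
      exact not_mem_left_of_mem_right (y.2.2 u hu) h1
    · exact h (u, v) (mem_sidePairs.2 ⟨hne, .inr ⟨hu, hv⟩⟩) huv

/-- Inclusion and exclusion: for a fixed pair `(σ, y)`, the indicator of injectivity is the product
of `1 - [y s.1 = y s.2]` over the side pairs `s`. Expanding it gives the signed sum over `S`, and
the two summations are then exchanged. -/
theorem sum_card_pairHom [Finite V] :
    ∑ S ∈ H.sidePairs.powerset, (-1 : ℤ) ^ S.card * Nat.card (PairHom G H l S) =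
      Nat.card H.autGroup * Nat.card (PinnedHom G H l) := by
  classical
  let _ := Fintype.ofFinite (G.toBipGraph.Hom H × H.Hom H)
  rw [← Nat.cast_mul, ← card_pairHom_injective]
  have key : ∀ P : G.toBipGraph.Hom H × H.Hom H → Prop,
      (Nat.card {x // (∀ q ∈ l, x.1.1 q.1 = x.2.1 q.2) ∧ P x} : ℤ) =
      ∑ x with ∀ q ∈ l, x.1.1 q.1 = x.2.1 q.2, if P x then 1 else 0 := by
    intro P
    rw [Nat.card_eq_fintype_card, Fintype.card_subtype, ← Finset.filter_filter,
      Finset.sum_boole]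
  have key' : ∀ S, (Nat.card (PairHom G H l S) : ℤ) =
      ∑ x : G.toBipGraph.Hom H × H.Hom H with ∀ q ∈ l, x.1.1 q.1 = x.2.1 q.2,
        ∏ s ∈ S, if x.2.1 s.1 = x.2.1 s.2 then 1 else 0 := by
    intro S
    refine (key fun x => ∀ s ∈ S, x.2.1 s.1 = x.2.1 s.2).trans (Finset.sum_congr rfl fun x _ => ?_)
    rw [Finset.prod_boole]
    congr
  rw [key fun x => Injective x.2.1]
  simp only [key', Finset.mul_sum]
  rw [Finset.sum_comm]
  refine Finset.sum_congr rfl fun x _ => ?_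
  have h := Finset.prod_add (fun s : V × V => -(if x.2.1 s.1 = x.2.1 s.2 then (1 : ℤ) else 0))
    (fun _ => 1) H.sidePairs
  simp only [Finset.prod_const_one, mul_one, Finset.prod_neg] at h
  rw [← h]
  have h2 : ∀ s : V × V, -(if x.2.1 s.1 = x.2.1 s.2 then (1 : ℤ) else 0) + 1 =
      if x.2.1 s.1 ≠ x.2.1 s.2 then 1 else 0 := by
    intro s
    by_cases hs : x.2.1 s.1 = x.2.1 s.2 <;> simp [hs]
  simp only [h2, Finset.prod_boole, injective_iff_sidePairs]

/-- The coefficients in the expression of the number of pinned homomorphisms. -/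
noncomputable def coefficient (H : BipGraph V) (p : ℕ) (S : Finset (V × V)) : ℕ :=
  ((-1 : ZMod p) ^ S.card * (Nat.card H.autGroup : ZMod p)⁻¹).val

/-- Divides `sum_card_pairHom` by `|Aut H|` in the field `ZMod p`. The coefficients are taken as
natural representatives because the machine only adds. -/
theorem sum_coefficient_mod [Finite V] {p : ℕ} (hp : p.Prime) (hH : H.PartitionwiseReduced p) :
    (∑ S ∈ H.sidePairs.powerset, Nat.card (PairHom G H l S) % p * coefficient H p S) % p =
      Nat.card (PinnedHom G H l) % p := by
  have := Fact.mk hp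
  have hne : (Nat.card H.autGroup : ZMod p) ≠ 0 := by
    rw [Ne, ZMod.natCast_eq_zero_iff]
    exact not_dvd_card_autGroup hp hH
  have h := congrArg (Int.cast : ℤ → ZMod p) (sum_card_pairHom (H := H) (G := G) (l := l))
  push_cast at h
  refine (ZMod.natCast_eq_natCast_iff' _ _ p).1 ?_
  push_cast
  simp only [coefficient, ZMod.natCast_val, ZMod.cast_id', id_eq, ZMod.natCast_mod]
  calc _ = (∑ S ∈ H.sidePairs.powerset, (-1 : ZMod p) ^ S.card * Nat.card (PairHom G H l S)) *
      (Nat.card H.autGroup : ZMod p)⁻¹ := by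
        rw [Finset.sum_mul]
        exact Finset.sum_congr rfl fun S _ => by ring
    _ = _ := by
        rw [h]
        field_simp

end counting

end

section

open Function BipGraph OracleProg

/-! ### The queries -/

/-- The input graph with a given list of edges. -/
def BipInput.ofList (a b : ℕ) (E : List (ℕ × ℕ)) (h : ∀ x ∈ E, x.1 < a ∧ x.2 < b) : BipInput where
  a := a
  b := b
  edges := E.pmap (fun x hx => (⟨x.1, hx.1⟩, ⟨x.2, hx.2⟩)) h

theorem BipInput.ofList_edges {a b : ℕ} {E : List (ℕ × ℕ)} (h : ∀ x ∈ E, x.1 < a ∧ x.2 < b) :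
    (ofList a b E h).edges.map (fun x => (x.1.1, x.2.1)) = E := by
  simp [ofList, List.map_pmap]

theorem BipInput.code_eq (G : BipInput) : G.code = natCode G.a ++ natCode G.b ++
    listCode edgeCode (G.edges.map fun x => (x.1.1, x.2.1)) := by
  rw [listCode_map]
  rfl

theorem mergePairs_lt {n : ℕ} {l : List ℕ} {q : List (ℕ × ℕ)} (hq : ∀ p ∈ q, p.1 < n ∧ p.2 < n)
    (hl : ∀ z ∈ l, z < n) : ∀ w ∈ (mergePairs n l q).2, w < (mergePairs n l q).1 := by
  obtain ⟨g, h1, h2, -⟩ := exists_quotientMap Unit n l q hq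
  rw [h1]
  simp only [List.mem_map, forall_exists_index, and_imp, forall_apply_eq_imp_iff₂]
  exact fun z hz => h2 z (hl z hz)

theorem solution_congr {W : Type*} (H : BipGraph W) {n n' : ℕ} {E E' q q' : List (ℕ × ℕ)}
    (h : ∀ x, x ∈ E ↔ x ∈ E') :
    Nat.card (Solution H n n' E q q') = Nat.card (Solution H n n' E' q q') :=
  Nat.card_congr (Equiv.subtypeEquivRight fun f => by simp only [h])

/-- Homomorphisms preserve sides, so a vertex cannot be mapped to a label on the other side. -/
theorem card_pinnedHom_eq_zero {V : Type*} {H : BipGraph V} {G : BipInput}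
    {l : List (G.Vertex × V)} (hl : ¬ G.GoodPins H l) : Nat.card (PinnedHom G H l) = 0 := by
  have : IsEmpty (PinnedHom G H l) := by
    refine ⟨fun σ => hl ⟨fun i v hv => ?_, fun j v hv => ?_⟩⟩
    · have := σ.1.2.1 (.inl i) ⟨i, rfl⟩
      rwa [σ.2 _ hv] at this
    · have := σ.1.2.2 (.inr j) ⟨j, rfl⟩
      rwa [σ.2 _ hv] at this
  exact Nat.card_of_isEmpty

section queries

variable {V : Type*} [Finite V] {m : ℕ} (e : V ≃ Fin m) {H : BipGraph V} {G : BipInput}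
  {l : List (G.Vertex × V)} {c : Finset (V × V) → ℕ} {S : Finset (V × V)}

theorem numPairs_lt {s : Set V} (hS : ∀ x ∈ S, x.1 ∈ s → x.2 ∈ s) :
    ∀ p ∈ numPairs s S, p.1 < Nat.card s ∧ p.2 < Nat.card s := by
  rintro ⟨i, j⟩ hp
  obtain ⟨x, hx, h1, rfl, rfl⟩ := mem_numPairs.1 hp
  exact ⟨num_lt h1, num_lt (hS x hx h1)⟩

theorem label_numTable_lt (s : Set V) (k x : ℕ) {n : ℕ} (hx : x < n) :
    (label (numTable e s) k).getD 0 < Nat.card s + n := by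
  have := label_numTable_le e s k
  omega

/-- Good pins are not required: the default label `0` is in range as well, because the pinned vertex
shows that this side of the union is nonempty. -/
theorem pairsL_lt (hS : H.SameSide S) :
    ∀ p ∈ (G.pinnedData e l).pairsL (targetData e H) (queryData H c S),
      p.1 < Nat.card H.left + G.a ∧ p.2 < Nat.card H.left + G.a := by
  intro p hp
  rcases List.mem_append.1 hp with hp | hp
  · simp only [pinPairs, BipInput.pinnedData, targetData, List.mem_reverse, List.mem_map,
      List.mem_filter] at hp
    obtain ⟨_, ⟨⟨⟨x | x, v⟩, hx, rfl⟩, hs⟩, rfl⟩ := hp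
    · exact ⟨label_numTable_lt e _ _ x.1 x.2, Nat.add_lt_add_left x.2 _⟩
    · simp at hs
  · have := numPairs_lt (fun x hx h => by
      rcases hS x hx with h' | h'
      · exact h'.2
      · exact absurd h (not_mem_left_of_mem_right h'.1)) p hp
    omega

theorem pairsR_lt (hS : H.SameSide S) :
    ∀ p ∈ (G.pinnedData e l).pairsR (targetData e H) (queryData H c S),
      p.1 < Nat.card H.right + G.b ∧ p.2 < Nat.card H.right + G.b := by
  intro p hp
  rcases List.mem_append.1 hp with hp | hp
  · simp only [pinPairs, BipInput.pinnedData, targetData, List.mem_reverse, List.mem_map,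
      List.mem_filter] at hp
    obtain ⟨_, ⟨⟨⟨x | x, v⟩, hx, rfl⟩, hs⟩, rfl⟩ := hp
    · simp at hs
    · exact ⟨label_numTable_lt e _ _ x.1 x.2, Nat.add_lt_add_left x.2 _⟩
  · have := numPairs_lt (fun x hx h => by
      rcases hS x hx with h' | h'
      · exact absurd h (not_mem_right_of_mem_left h'.1)
      · exact h'.2) p hp
    omega

theorem numEdges_lt : ∀ x ∈ numEdges H, x.1 < Nat.card H.left ∧ x.2 < Nat.card H.right := by
  rintro ⟨i, j⟩ hx
  obtain ⟨u, v, -, rfl, rfl⟩ := mem_numEdges.1 hx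
  exact ⟨num_lt u.2, num_lt v.2⟩

theorem endsL_lt :
    ∀ z ∈ (G.pinnedData e l).endsL (targetData e H), z < Nat.card H.left + G.a := by
  intro z hz
  rcases List.mem_append.1 hz with hz | hz
  · simp only [BipInput.pinnedData, targetData, List.mem_reverse, List.mem_map] at hz
    obtain ⟨_, ⟨x, -, rfl⟩, rfl⟩ := hz
    exact Nat.add_lt_add_left x.1.2 _
  · obtain ⟨x, hx, rfl⟩ := List.mem_map.1 hz
    exact Nat.lt_add_right _ (numEdges_lt x hx).1

theorem endsR_lt :
    ∀ z ∈ (G.pinnedData e l).endsR (targetData e H), z < Nat.card H.right + G.b := by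
  intro z hz
  rcases List.mem_append.1 hz with hz | hz
  · simp only [BipInput.pinnedData, targetData, List.mem_reverse, List.mem_map] at hz
    obtain ⟨_, ⟨x, -, rfl⟩, rfl⟩ := hz
    exact Nat.add_lt_add_left x.2.2 _
  · obtain ⟨x, hx, rfl⟩ := List.mem_map.1 hz
    exact Nat.lt_add_right _ (numEdges_lt x hx).2

/-- Whatever the pins are, the query is the code of some graph, so the oracle must answer with a
residue and the time bound holds. Only the meaning of the count depends on good pins. -/
theorem exists_queryGraph (l : List (G.Vertex × V)) (c : Finset (V × V) → ℕ)
    (hS : H.SameSide S) : ∃ Q : BipInput,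
    (G.pinnedData e l).query (targetData e H) (queryData H c S) = Q.code ∧
    (G.GoodPins H l → Q.toBipGraph.numHom H = Nat.card (PairHom G H l S)) := by
  have hL := pairsL_lt e (G := G) (l := l) (c := c) hS
  have hR := pairsR_lt e (G := G) (l := l) (c := c) hS
  have eL := endsL_lt e (H := H) (G := G) (l := l)
  have eR := endsR_lt e (H := H) (G := G) (l := l)
  have hE : ∀ x ∈ (((G.pinnedData e l).sideL (targetData e H) (queryData H c S)).2.zip
      ((G.pinnedData e l).sideR (targetData e H) (queryData H c S)).2).reverse,
      x.1 < ((G.pinnedData e l).sideL (targetData e H) (queryData H c S)).1 ∧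
      x.2 < ((G.pinnedData e l).sideR (targetData e H) (queryData H c S)).1 := by
    intro x hx
    have hx' := List.of_mem_zip (List.mem_reverse.1 hx)
    exact ⟨mergePairs_lt hL eL _ hx'.1, mergePairs_lt hR eR _ hx'.2⟩
  refine ⟨BipInput.ofList _ _ _ hE, ?_, fun hl => ?_⟩
  · rw [BipInput.code_eq, BipInput.ofList_edges]
    rfl
  · rw [BipInput.numHom_eq, BipInput.ofList_edges,
      ← card_solution_union e (c := c) hl hS, ← card_solution_mergePairs H hL hR eL eR]
    exact solution_congr H fun x => List.mem_reverse

theorem countP_badPin_eq_zero :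
    (G.pinnedData e l).pins.countP (badPin (targetData e H).tL (targetData e H).tR) = 0 ↔
      G.GoodPins H l := by
  classical
  simp only [List.countP_eq_zero, BipInput.pinnedData, targetData, List.mem_map, badPin,
    forall_exists_index, and_imp, forall_apply_eq_imp_iff₂]
  constructor
  · intro h
    refine ⟨fun i v hv => ?_, fun j v hv => ?_⟩
    · by_contra hn
      exact h (.inl i, v) hv (by simp [label_numTable, hn])
    · by_contra hn
      exact h (.inr j, v) hv (by simp [label_numTable, hn])
  · rintro ⟨h1, h2⟩ ⟨i | j, v⟩ hv
    · simp [label_numTable, h1 i v hv]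
    · simp [label_numTable, h2 j v hv]

end queries

/-! ### The reduction of pinned to plain counting -/

theorem card_pinnedHom_ofFn {V : Type*} {H : BipGraph V} {G : BipInput} {r : ℕ}
    (u : Fin r → G.Vertex) (w : Fin r → V) :
    Nat.card (PinnedHom G H (List.ofFn fun i => (u i, w i))) =
      G.toBipGraph.numPinnedHom u H w :=
  Nat.card_congr (Equiv.subtypeEquivRight fun σ => by simp)

section reduction

variable {V : Type*} [Finite V] {m : ℕ} (e : V ≃ Fin m) {H : BipGraph V} {p : ℕ}

/-- The list of the queries. -/
noncomputable def queryList (H : BipGraph V) (p : ℕ) : List QueryData :=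
  H.sidePairs.powerset.toList.map (queryData H (coefficient H p))

theorem sameSide_of_mem_powerset {S : Finset (V × V)} (hS : S ∈ H.sidePairs.powerset) :
    H.SameSide S := fun _ hs => (mem_sidePairs.1 (Finset.mem_powerset.1 hS hs)).2

theorem outputsWithin_pinned (hp : p.Prime) (hH : H.PartitionwiseReduced p)
    {O : List Bool → List Bool} (hO : FunProblem.Solves O (bipHomsTo H p)) {P : OracleProg}
    {G : BipInput} {l : List (G.Vertex × V)} {x y : List Bool} {K T : ℕ} (hx : x = G.code ++ y)
    (hP : ∀ s : Store, s 2 = y → RunsWithin O P s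
      (pinStore (targetData e H).a (targetData e H).b (targetData e H).tL (targetData e H).tR s []
        (G.pinnedData e l).pins) T)
    (hB : ∀ Q ∈ queryList H p, (G.pinnedData e l).Bounded (targetData e H) Q x K) (hpK : p ≤ K) :
    OutputsWithin O (countPinned P (targetData e H) p (queryList H p)) x
      (natCode (Nat.card (PinnedHom G H l) % p))
      ((queryList H p).length * (400 * (K + 1) ^ 3 + T) +
        2 * ((queryList H p).map fun Q => p * Q.c).sum + p + 10) := by
  classical
  have hex : ∀ S ∈ H.sidePairs.powerset, ∃ v,
      O ((G.pinnedData e l).query (targetData e H) (queryData H (coefficient H p) S)) =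
        natCode v ∧ v < p ∧ (G.GoodPins H l → v = Nat.card (PairHom G H l S) % p) := by
    intro S hS
    obtain ⟨Q, h1, h2⟩ := exists_queryGraph e l (coefficient H p) (sameSide_of_mem_powerset hS)
    exact ⟨Q.toBipGraph.numHom H % p, by rw [h1]; exact hO Q, Nat.mod_lt _ hp.pos,
      fun hl => by rw [h2 hl]⟩
  have hinj : ∀ {v w : ℕ}, natCode v = natCode w → v = w := fun {v w} h =>
    (natCode_append_inj (s := []) (t := []) (by rw [h])).1
  -- The program handles query data instead of sets `S`, so the answer is read off from the oracle
  -- as a function of `Q`. Injectivity of `natCode` makes it the expected residue.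
  let v : QueryData → ℕ := fun Q =>
    if h : ∃ v, O ((G.pinnedData e l).query (targetData e H) Q) = natCode v then h.choose else 0
  have hv : ∀ S ∈ H.sidePairs.powerset,
      O ((G.pinnedData e l).query (targetData e H) (queryData H (coefficient H p) S)) =
        natCode (v (queryData H (coefficient H p) S)) ∧
      v (queryData H (coefficient H p) S) < p ∧ (G.GoodPins H l →
        v (queryData H (coefficient H p) S) = Nat.card (PairHom G H l S) % p) := by
    intro S hS
    obtain ⟨w, h1, h2, h3⟩ := hex S hS
    have h : ∃ v, O ((G.pinnedData e l).query (targetData e H)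
      (queryData H (coefficient H p) S)) = natCode v := ⟨w, h1⟩
    have hvw : v (queryData H (coefficient H p) S) = w := by
      simp only [v, dif_pos h]
      exact hinj (h.choose_spec.symm.trans h1)
    rw [hvw]
    exact ⟨h1, h2, h3⟩
  have hmem : ∀ Q ∈ queryList H p,
      ∃ S ∈ H.sidePairs.powerset, queryData H (coefficient H p) S = Q := by
    intro Q hQ
    obtain ⟨S, hS, rfl⟩ := List.mem_map.1 hQ
    exact ⟨S, Finset.mem_toList.1 hS, rfl⟩
  have hne : queryList H p ≠ [] := by
    rw [queryList, Ne, List.map_eq_nil_iff, Finset.toList_eq_nil]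
    exact Finset.powerset_nonempty _ |>.ne_empty
  have hmain := outputsWithin_countPinned (v := v) hp.pos (x := x) (y := y)
    (hx.trans (by rw [BipInput.code_eq]; rfl)) hP hne hB
    (fun Q hQ => by obtain ⟨S, hS, rfl⟩ := hmem Q hQ; exact (hv S hS).1)
    (fun Q hQ => by obtain ⟨S, hS, rfl⟩ := hmem Q hQ; exact (hv S hS).2.1) hpK
  convert hmain using 2
  by_cases hl : G.GoodPins H l
  · rw [if_pos ((countP_badPin_eq_zero e).2 hl), ← sum_coefficient_mod hp hH, queryList,
      List.map_map, ← Finset.sum_map_toList]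
    congr 2
    refine List.map_congr_left fun S hS => ?_
    rw [comp_apply, (hv S (Finset.mem_toList.1 hS)).2.2 hl]
    rfl
  · rw [if_neg fun h => hl ((countP_badPin_eq_zero e).1 h), card_pinnedHom_eq_zero hl,
      Nat.zero_mod]

/-- A bound for all constants in the reduction. -/
noncomputable def constantBound (m : ℕ) (H : BipGraph V) (p : ℕ) : ℕ :=
  m + Nat.card H.left + Nat.card H.right + (numEdges H).length + p +
    ∑ S ∈ H.sidePairs.powerset, ((numPairs H.left S).length + (numPairs H.right S).length)

theorem length_le_length_listCode {α : Type*} (f : α → List Bool) (l : List α) :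
    l.length ≤ (listCode f l).length := by
  induction l with
  | nil => simp
  | cons x l ih =>
    simp only [listCode, List.length_cons, List.length_append]
    omega

/-- Numbers are coded in unary, so every number and every list length of the input is at most the
length of the input; everything else is constant. -/
theorem bounded_pinnedData (hp : p.Prime) {G : BipInput} {l : List (G.Vertex × V)}
    {x y : List Bool} (hx : x = G.code ++ y) (hl : l.length ≤ y.length) {Q : QueryData}
    (hQ : Q ∈ queryList H p) :
    (G.pinnedData e l).Bounded (targetData e H) Q x (x.length + constantBound m H p) := by
  have := Fact.mk hp
  obtain ⟨S, hS, rfl⟩ := List.mem_map.1 hQ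
  rw [Finset.mem_toList] at hS
  have hS' := sameSide_of_mem_powerset hS
  have hlen : G.a + G.b + G.edges.length + y.length ≤ x.length := by
    have := length_le_length_listCode (fun e : Fin G.a × Fin G.b => natCode e.1 ++ natCode e.2)
      G.edges
    simp only [hx, BipInput.code, List.length_append, length_natCode]
    omega
  have hsum := Finset.single_le_sum (f := fun S =>
    (numPairs H.left S).length + (numPairs H.right S).length) (fun _ _ => Nat.zero_le _) hS
  have hK : constantBound m H p = m + Nat.card H.left + Nat.card H.right + (numEdges H).length +
    p + ∑ S ∈ H.sidePairs.powerset,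
      ((numPairs H.left S).length + (numPairs H.right S).length) := rfl
  have hpin : ∀ (c : Bool) a t, (pinPairs c a t (G.pinnedData e l).pins).length ≤ l.length := by
    intro c a t
    rw [pinPairs, List.length_reverse, List.length_map]
    refine (List.length_filter_le _ _).trans ?_
    simp [BipInput.pinnedData]
  refine ⟨by omega, ?_, ?_, ?_, ?_, ?_, ?_, ?_, ?_, ?_, ?_⟩
  · simp only [targetData, BipInput.pinnedData]; omega
  · simp only [targetData, BipInput.pinnedData]; omega
  · simp only [targetData, BipInput.pinnedData, List.length_map]; omega
  · simp only [targetData, BipInput.pinnedData, List.mem_map, forall_exists_index, and_imp,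
      forall_apply_eq_imp_iff₂]
    intro a _
    have h1 := a.1.2
    have h2 := a.2.2
    omega
  · intro a ha
    have := numEdges_lt a ha
    omega
  · intro a ha
    have := pairsL_lt e hS' a ha
    omega
  · intro a ha
    have := pairsR_lt e hS' a ha
    omega
  · have := hpin false (targetData e H).a (targetData e H).tL
    simp only [PinnedData.pairsL, List.length_append, queryData]
    omega
  · have := hpin true (targetData e H).b (targetData e H).tR
    simp only [PinnedData.pairsR, List.length_append, queryData]
    omega
  -- The coefficients are representatives in the range from `0` to `p - 1`.
  · have h : (queryData H (coefficient H p) S).c < p := ZMod.val_lt _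
    omega

/-- A problem reduces to counting homomorphisms to `H` if a program can read its instances as graphs
with pinned vertices. -/
theorem turingReduces_bipHomsTo (hp : p.Prime) (hH : H.PartitionwiseReduced p) (A : FunProblem)
    (P : OracleProg)
    (h : ∀ x : A.Inst, ∃ (G : BipInput) (l : List (G.Vertex × V)) (y : List Bool),
      A.code x = G.code ++ y ∧ l.length ≤ y.length ∧
      A.answer x = natCode (Nat.card (PinnedHom G H l) % p) ∧
      ∀ O K, G.a ≤ K → G.b ≤ K → l.length ≤ K → constantBound m H p ≤ K → ∀ s : Store, s 2 = y →
        RunsWithin O P s (pinStore (targetData e H).a (targetData e H).b (targetData e H).tL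
          (targetData e H).tR s [] (G.pinnedData e l).pins) (K * (8 * K + 13) + 2)) :
    A.TuringReduces (bipHomsTo H p) := by
  open Polynomial in
  -- The polynomial form of `K`, the input length plus the constant bound.
  let N : Polynomial ℕ := X + C (constantBound m H p)
  refine ⟨countPinned P (targetData e H) p (queryList H p),
    Polynomial.C (queryList H p).length * (400 * (N + 1) ^ 3 + (N * (8 * N + 13) + 2)) +
      Polynomial.C (2 * ((queryList H p).map fun Q => p * Q.c).sum + p + 10), ?_⟩
  intro O hO x
  obtain ⟨G, l, y, hx, hl, ha, hP⟩ := h x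
  have hlen : G.a + G.b + y.length ≤ (A.code x).length := by
    simp only [hx, BipInput.code, List.length_append, length_natCode]
    omega
  have hpK : p ≤ (A.code x).length + constantBound m H p := by
    simp only [constantBound]
    omega
  rw [ha]
  have := outputsWithin_pinned e hp hH hO hx
    (hP O ((A.code x).length + constantBound m H p) (by omega) (by omega) (by omega) (by omega))
    (fun Q hQ => bounded_pinnedData e hp hx hl hQ) hpK
  convert this using 1
  simp only [N, Polynomial.eval_add, Polynomial.eval_mul, Polynomial.eval_C, Polynomial.eval_X,
    Polynomial.eval_pow, Polynomial.eval_one, Polynomial.eval_ofNat]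
  ring

theorem index_le {G : BipInput} {K : ℕ} (ha : G.a ≤ K) (hb : G.b ≤ K) (v : G.Vertex) :
    G.index v ≤ K := by
  rcases v with i | j
  · exact i.2.le.trans ha
  · exact j.2.le.trans hb

theorem BipInput.vertexCode_eq (G : BipInput) (v : G.Vertex) :
    G.vertexCode v = v.isRight :: natCode (G.index v) := by
  rcases v with i | j <;> rfl

theorem turingReduces_bipPartLabHomsTo (hp : p.Prime) (hH : H.PartitionwiseReduced p) :
    (bipPartLabHomsTo e H p).TuringReduces (bipHomsTo H p) := by
  refine turingReduces_bipHomsTo e hp hH _ (readPins (targetData e H).a (targetData e H).b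
    (targetData e H).tL (targetData e H).tR) fun x => ?_
  refine ⟨x.graph, List.ofFn fun i => (x.u i, x.w i), _, rfl, length_le_length_listCode _ _,
    ?_, fun O K ha hb hl hK s hs => ?_⟩
  · rw [card_pinnedHom_ofFn]
    rfl
  · have hK' := hK
    simp only [constantBound] at hK'
    refine (runsWithin_readPins (K := K) (l := (x.graph.pinnedData e _).pins) ?_ ?_ ?_ ?_).mono ?_
    · exact fun k => (label_numTable_le e _ k).trans (by omega)
    · exact fun k => (label_numTable_le e _ k).trans (by omega)
    · simp only [BipInput.pinnedData, List.mem_map, forall_exists_index, and_imp,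
        forall_apply_eq_imp_iff₂]
      intro q _
      have h1 := index_le ha hb q.1
      have h2 := (e q.2).2
      refine ⟨h1, by omega, ?_, ?_⟩
      · simp [targetData, numTable]
      · simp [targetData, numTable]
    · rw [hs, BipInput.pinnedData, listCode_map]
      congr 1
      funext q
      simp [pinCode, BipInput.vertexCode_eq]
    · simp only [BipInput.pinnedData, targetData, List.length_map]
      have := Nat.mul_le_mul hl (show 6 * K + Nat.card H.left + Nat.card H.right + 13 ≤
        8 * K + 13 by omega)
      omega

theorem turingReduces_bipPartLabHomsToFixed (hp : p.Prime) (hH : H.PartitionwiseReduced p) {m : ℕ}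
    (e : V ≃ Fin m) {r : ℕ} (w : Fin r → V) :
    (bipPartLabHomsToFixed H w p).TuringReduces (bipHomsTo H p) := by
  refine turingReduces_bipHomsTo e hp hH _ (readVertices (targetData e H).a (targetData e H).b
    (targetData e H).tL (targetData e H).tR (List.ofFn fun i => (e (w i)).1)) fun x => ?_
  refine ⟨x.graph, List.ofFn fun i => (x.u i, w i), _, rfl, ?_, ?_,
    fun O K ha hb hl hK s hs => ?_⟩
  · refine le_trans (by simp) (length_le_length_listCode _ _)
  · rw [card_pinnedHom_ofFn]
    rfl
  · have hK' := hK
    simp only [constantBound] at hK'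
    have hread := runsWithin_readVertices (O := O) (K := K) (a := (targetData e H).a)
      (b := (targetData e H).b) (tL := (targetData e H).tL) (tR := (targetData e H).tR)
      (l := List.ofFn fun i => ((((x.u i).isRight, x.graph.index (x.u i)), (e (w i)).1) :
        (Bool × ℕ) × ℕ))
      (fun k => (label_numTable_le e _ k).trans (by omega))
      (fun k => (label_numTable_le e _ k).trans (by omega))
      (by
        simp only [List.mem_ofFn, forall_exists_index, forall_apply_eq_imp_iff]
        exact fun i => index_le ha hb _)
      (s := s) (by
        rw [hs, List.map_ofFn]
        have : List.ofFn (Prod.fst ∘ fun i => ((((x.u i).isRight, x.graph.index (x.u i)),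
            (e (w i)).1) : (Bool × ℕ) × ℕ)) =
            (List.ofFn x.u).map fun v => (v.isRight, x.graph.index v) := by
          rw [List.map_ofFn]
          rfl
        rw [this, listCode_map]
        congr 1
        funext v
        exact BipInput.vertexCode_eq _ v)
    rw [List.map_ofFn, List.map_ofFn] at hread
    refine hread.of_eq ?_ ?_
    · simp only [BipInput.pinnedData, List.map_ofFn]
      rfl
    · simp only [List.length_ofFn, targetData] at hl ⊢
      have := Nat.mul_le_mul hl (show 6 * K + Nat.card H.left + Nat.card H.right + 13 ≤
        8 * K + 13 by omega)
      omega

end reduction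

end

section

open Function BipGraph OracleProg

variable {O : List Bool → List Bool}

/-! ### Adding isolated vertices -/

namespace OracleProg

/-- Puts a copy of the string of ones on stack `i` on stack `4`. -/
def copyOnes (i : ℕ) : OracleProg := .seq (moveBitsTwice i 5 4) (moveBits 5 i)

/-- Writes a list of new vertices to stack `4`; the numbers of old left and right vertices are on the
stacks `2` and `3`. -/
def writeVertices : List (Bool × ℕ × List Bool) → OracleProg
  | [] => .push 4 false
  | x :: l => .seq (writeVertices l) (.seq (write 4 x.2.2) (.seq (.push 4 false)
      (.seq (write 4 (ones x.2.1)) (.seq (copyOnes (if x.1 then 3 else 2))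
        (.seq (.push 4 x.1) (.push 4 true))))))

/-- Queries the oracle about the input graph with additional isolated vertices, which are listed. -/
def askExtended (a b : ℕ) (l : List (Bool × ℕ × List Bool)) : OracleProg :=
  .seq (.seq (moveOnes 0 2) (.seq (.pop 0) (.seq (moveOnes 0 3) (.pop 0))))
    (.seq (writeVertices l) (.seq (.seq (moveBits 0 5) (moveBits 5 4))
      (.seq (.seq (.push 4 false) (.seq (write 4 (ones b)) (moveOnes 3 4)))
        (.seq (.seq (.push 4 false) (.seq (write 4 (ones a)) (moveOnes 2 4))) (.query 4 1)))))

end OracleProg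

/-- The code of a new vertex. -/
def newVertexCode (a b : ℕ) (x : Bool × ℕ × List Bool) : List Bool :=
  x.1 :: (natCode ((if x.1 then b else a) + x.2.1) ++ x.2.2)

/-- Reading a stack destroys it, so the ones pass through stack `5` and return. Their order is
immaterial. -/
theorem runsWithin_copyOnes {a b : ℕ} {y : List Bool} {y0 : List Bool} (c : Bool) :
    RunsWithin O (copyOnes (if c then 3 else 2))
      (frame (base y0 [] (ones a) (ones b) y [] [] [] [] [] []) [] [] [] [] [] [] [])
      (frame (base y0 [] (ones a) (ones b) (ones (if c then b else a) ++ y) [] [] [] [] [] [])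
        [] [] [] [] [] [] []) (9 * (a + b) + 2) := by
  cases c with
  | false =>
    exact ((runsWithin_moveBitsTwice (l := ones a) (by norm_num) (by norm_num) (by norm_num)
      (by simp)).seq (runsWithin_moveBits (l := ones a) (by norm_num) (by simp))).of_eq (by simp)
      (by simp; omega)
  | true =>
    exact ((runsWithin_moveBitsTwice (l := ones b) (by norm_num) (by norm_num) (by norm_num)
      (by simp)).seq (runsWithin_moveBits (l := ones b) (by norm_num) (by simp))).of_eq (by simp)
      (by simp; omega)

theorem runsWithin_writeVertices {a b B : ℕ} {y0 : List Bool} {l : List (Bool × ℕ × List Bool)}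
    (hl : ∀ x ∈ l, x.2.1 ≤ B ∧ x.2.2.length ≤ B) :
    RunsWithin O (writeVertices l)
      (frame (base y0 [] (ones a) (ones b) [] [] [] [] [] [] []) [] [] [] [] [] [] [])
      (frame (base y0 [] (ones a) (ones b) (listCode (newVertexCode a b) l) [] [] [] [] [] [])
        [] [] [] [] [] [] []) (l.length * (2 * B + 9 * (a + b) + 10) + 1) := by
  induction l with
  | nil => exact (RunsWithin.push 4 false).of_eq (by simp [listCode]) (by simp)
  | cons x l ih =>
    have hx := hl x (by simp)
    refine ((ih fun y hy => hl y (by simp [hy])).seq ((runsWithin_write 4 x.2.2 _).seq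
      ((RunsWithin.push 4 false).seq ((runsWithin_write 4 (ones x.2.1) _).seq
        (((runsWithin_copyOnes (a := a) (b := b) (y0 := y0)
          (y := ones x.2.1 ++ false :: (x.2.2 ++ listCode (newVertexCode a b) l)) x.1).of_eq' ?_).seq
          ((RunsWithin.push 4 x.1).seq (RunsWithin.push 4 true))))))).of_eq ?_ ?_
    · simp
    · simp [listCode, newVertexCode, ones_append_natCode_append]
    · rw [List.length_cons, add_mul, List.length_replicate]
      omega

theorem length_listCode_newVertexCode_le {a b B : ℕ} {l : List (Bool × ℕ × List Bool)}
    (hl : ∀ x ∈ l, x.2.1 ≤ B ∧ x.2.2.length ≤ B) :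
    (listCode (newVertexCode a b) l).length ≤ l.length * (2 * B + (a + b) + 3) + 1 := by
  induction l with
  | nil => simp [listCode]
  | cons x l ih =>
    have hx := hl x (by simp)
    have := ih fun y hy => hl y (by simp [hy])
    have h : (if x.1 then b else a) ≤ a + b := by split_ifs <;> omega
    simp only [listCode, newVertexCode, List.length_cons, List.length_append, length_natCode,
      add_mul]
    omega

/-- The query is again written from its end: the pinned new vertices, the old edge code, the two
enlarged sizes. The answer of the oracle is already the output, so it goes straight to stack `1`. -/
theorem outputsWithin_askExtended {a b n n' B : ℕ} {y z : List Bool}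
    {l : List (Bool × ℕ × List Bool)} (hl : ∀ x ∈ l, x.2.1 ≤ B ∧ x.2.2.length ≤ B) (hn : n ≤ B)
    (hn' : n' ≤ B) (hz : z.length ≤ B)
    (hO : O (natCode (n + a) ++ natCode (n' + b) ++ y ++ listCode (newVertexCode a b) l) = z) :
    OutputsWithin O (askExtended n n' l) (natCode a ++ natCode b ++ y) z
      (l.length * (4 * B + 10 * (natCode a ++ natCode b ++ y).length + 13) +
        20 * (natCode a ++ natCode b ++ y).length + 10 * B + 20) := by
  generalize hx : natCode a ++ natCode b ++ y = x
  have hlen : a + b + 2 + y.length = x.length := by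
    simp only [← hx, List.length_append, length_natCode]
    omega
  have hx' : x = ones a ++ false :: (ones b ++ false :: y) := by
    simp [← hx, natCode_append]
  have s1 := (runsWithin_moveOnes (O := O) (i := 0) (j := 2) (n := a)
    (r := false :: (ones b ++ false :: y)) (by norm_num) rfl
    (s := frame (base x [] [] [] [] [] [] [] [] [] []) [] [] [] [] [] [] []) hx').seq
    ((RunsWithin.pop 0).seq ((runsWithin_moveOnes (O := O) (i := 0) (j := 3) (n := b)
      (r := false :: y) (by norm_num) rfl (by simp)).seq (RunsWithin.pop 0)))
  have s2 := runsWithin_writeVertices (O := O) (a := a) (b := b) (y0 := y) hl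
  have s3 := (runsWithin_moveBits (O := O) (i := 0) (j := 5) (l := y) (by norm_num)
    (s := frame (base y [] (ones a) (ones b) (listCode (newVertexCode a b) l) [] [] [] [] [] [])
        [] [] [] [] [] [] []) (by simp)).seq
    (runsWithin_moveBits (i := 5) (j := 4) (l := y.reverse) (by norm_num) (by simp))
  have s4 := (RunsWithin.push (O := O) 4 false (s := frame (base [] [] (ones a) (ones b)
    (y ++ listCode (newVertexCode a b) l) [] [] [] [] [] []) [] [] [] [] [] [] [])).seq
    ((runsWithin_write 4 (ones n') _).seq (runsWithin_moveOnes (i := 3) (j := 4) (n := b) (r := [])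
      (by norm_num) rfl (by simp)))
  have s5 := (RunsWithin.push (O := O) 4 false (s := frame (base [] [] (ones a) []
    (natCode (n' + b) ++ (y ++ listCode (newVertexCode a b) l)) [] [] [] [] [] [])
      [] [] [] [] [] [] [])).seq
    ((runsWithin_write 4 (ones n) _).seq (runsWithin_moveOnes (i := 2) (j := 4) (n := a) (r := [])
      (by norm_num) rfl (by simp)))
  have s6 := RunsWithin.query (O := O) 4 1 (s := frame (base [] [] [] []
    (natCode (n + a) ++ natCode (n' + b) ++ y ++ listCode (newVertexCode a b) l)
      [] [] [] [] [] []) [] [] [] [] [] [] [])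
  have hcomm : ∀ k k' r, ones k ++ (ones k' ++ false :: r) = natCode (k' + k) ++ r := fun k k' r =>
    (ones_append_natCode_append k k' r).trans (by rw [add_comm])
  have hall := s1.seq ((s2.of_eq' (by simp)).seq ((s3.of_eq' rfl).seq ((s4.of_eq' (by simp)).seq
    ((s5.of_eq' (by simp [hcomm])).seq (s6.of_eq' (by simp [hcomm]))))))
  obtain ⟨t, ht, hr⟩ := hall
  refine ⟨t, _, (initStore_eq x).symm ▸ hr, ht.trans ?_, ?_⟩
  · have h1 := length_listCode_newVertexCode_le (a := a) (b := b) hl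
    have e1 : frame (base [] [] [] []
      (natCode (n + a) ++ natCode (n' + b) ++ y ++ listCode (newVertexCode a b) l)
      [] [] [] [] [] []) [] [] [] [] [] [] [] 4 =
      natCode (n + a) ++ natCode (n' + b) ++ y ++ listCode (newVertexCode a b) l := rfl
    rw [e1, hO]
    simp only [List.length_append, length_natCode, List.length_replicate, List.length_reverse]
    have h2 : l.length * (2 * B + 9 * (a + b) + 10) + l.length * (2 * B + (a + b) + 3) =
      l.length * (4 * B + 10 * (a + b) + 13) := by ring
    have h3 : l.length * (4 * B + 10 * (a + b) + 13) ≤ l.length * (4 * B + 10 * x.length + 13) :=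
      Nat.mul_le_mul_left _ (by omega)
    omega
  · have e1 : frame (base [] [] [] []
      (natCode (n + a) ++ natCode (n' + b) ++ y ++ listCode (newVertexCode a b) l)
      [] [] [] [] [] []) [] [] [] [] [] [] [] 4 =
      natCode (n + a) ++ natCode (n' + b) ++ y ++ listCode (newVertexCode a b) l := rfl
    rw [e1, hO, update_self]

/-! ### The reduction of plain to pinned counting -/

/-- The input graph with isolated vertices added on both sides. -/
def BipInput.extend (G : BipInput) (n n' : ℕ) : BipInput where
  a := G.a + n
  b := G.b + n'
  edges := G.edges.map fun x => (Fin.castAdd n x.1, Fin.castAdd n' x.2)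

/-- New vertices are numbered after the old ones, so the edge part of the code is copied verbatim.
-/
theorem BipInput.extend_code (G : BipInput) (n n' : ℕ) : (G.extend n n').code =
    natCode (n + G.a) ++ natCode (n' + G.b) ++
      listCode (fun e : Fin G.a × Fin G.b => natCode e.1 ++ natCode e.2) G.edges := by
  rw [add_comm n, add_comm n']
  simp only [code, extend]
  rw [listCode_map]
  rfl

section extension

variable {V : Type*} {H : BipGraph V} {r : ℕ} (w : Fin r → V) (G : BipInput)

/-- The number of labels on one side. -/
noncomputable def numLabels (s : Set V) : ℕ := Nat.card (w ⁻¹' s)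

/-- The number of the new vertex for a label. -/
noncomputable def newIndex (s : Set V) (t : Fin r) (ht : w t ∈ s) : Fin (numLabels w s) :=
  Finite.equivFin (w ⁻¹' s) ⟨t, ht⟩

open Classical in
/-- The new vertex for a label. -/
noncomputable def newVertex (H : BipGraph V) (t : Fin r) :
    (G.extend (numLabels w H.left) (numLabels w H.right)).Vertex :=
  if h : w t ∈ H.left then .inl (Fin.natAdd G.a (newIndex w H.left t h))
  else .inr (Fin.natAdd G.b (newIndex w H.right t
    ((Set.eq_univ_iff_forall.1 H.cover (w t)).resolve_left h)))

theorem newVertex_left {t : Fin r} (h : w t ∈ H.left) :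
    newVertex w G H t = .inl (Fin.natAdd G.a (newIndex w H.left t h)) := dif_pos h

theorem newVertex_right {t : Fin r} (h : w t ∈ H.right) :
    newVertex w G H t = .inr (Fin.natAdd G.b (newIndex w H.right t h)) :=
  dif_neg (not_mem_left_of_mem_right h)

/-- Restriction to the old vertices is a bijection: the new vertices are isolated and hence impose
no condition, and their images are prescribed. Each position of `w` has its own new vertex, so
repeated labels cause no conflict. -/
theorem numPinnedHom_extend :
    (G.extend (numLabels w H.left) (numLabels w H.right)).toBipGraph.numPinnedHom
      (newVertex w G H) H w = G.toBipGraph.numHom H := by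
  have hadj : ∀ i j, (i, j) ∈ G.edges → (Fin.castAdd (numLabels w H.left) i,
      Fin.castAdd (numLabels w H.right) j) ∈
      (G.extend (numLabels w H.left) (numLabels w H.right)).edges := fun i j h =>
    List.mem_map.2 ⟨(i, j), h, rfl⟩
  -- Every new vertex is pinned, which makes the restriction injective.
  have surj : ∀ (s : Set V) (k : Fin (numLabels w s)), ∃ t, ∃ ht : w t ∈ s,
      newIndex w s t ht = k := by
    intro s k
    obtain ⟨⟨t, ht⟩, h⟩ := (Finite.equivFin (w ⁻¹' s)).surjective k
    exact ⟨t, ht, h⟩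
  refine Nat.card_eq_of_bijective (fun τ => G.homOfSides H
    (fun i => ⟨τ.1.1 (.inl (Fin.castAdd _ i)), τ.1.2.1 _ ⟨_, rfl⟩⟩)
    (fun j => ⟨τ.1.1 (.inr (Fin.castAdd _ j)), τ.1.2.2 _ ⟨_, rfl⟩⟩)
    (fun x hx => τ.1.1.map_rel (show BipInput.Adj _ (.inl _) (.inr _) from hadj _ _ hx))) ⟨?_, ?_⟩
  · intro τ τ' h
    have hv : ∀ v : G.Vertex, _ := fun v => congrFun
      (congrArg (fun σ : G.toBipGraph.Hom H => (σ.1 : G.Vertex → V)) h) v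
    refine Subtype.ext (Hom.ext ?_)
    rintro (i | j)
    · refine Fin.addCases (fun i => hv (.inl i)) (fun k => ?_) i
      obtain ⟨t, ht, rfl⟩ := surj H.left k
      have h1 := τ.2 t
      have h2 := τ'.2 t
      rw [newVertex_left w G ht] at h1 h2
      exact h1.trans h2.symm
    · refine Fin.addCases (fun j => hv (.inr j)) (fun k => ?_) j
      obtain ⟨t, ht, rfl⟩ := surj H.right k
      have h1 := τ.2 t
      have h2 := τ'.2 t
      rw [newVertex_right w G ht] at h1 h2
      exact h1.trans h2.symm
  · intro σ
    let f : Fin (G.a + numLabels w H.left) → H.left := Fin.append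
      (fun i => ⟨σ.1 (.inl i), σ.2.1 _ ⟨i, rfl⟩⟩)
      (fun k => ⟨w ((Finite.equivFin (w ⁻¹' H.left)).symm k).1,
        ((Finite.equivFin (w ⁻¹' H.left)).symm k).2⟩)
    let g : Fin (G.b + numLabels w H.right) → H.right := Fin.append
      (fun i => ⟨σ.1 (.inr i), σ.2.2 _ ⟨i, rfl⟩⟩)
      (fun k => ⟨w ((Finite.equivFin (w ⁻¹' H.right)).symm k).1,
        ((Finite.equivFin (w ⁻¹' H.right)).symm k).2⟩)
    have hf : ∀ i, f (Fin.castAdd _ i) = ⟨σ.1 (.inl i), σ.2.1 _ ⟨i, rfl⟩⟩ := fun i =>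
      Fin.append_left _ _ i
    have hg : ∀ i, g (Fin.castAdd _ i) = ⟨σ.1 (.inr i), σ.2.2 _ ⟨i, rfl⟩⟩ := fun i =>
      Fin.append_left _ _ i
    have hf' : ∀ t ht, f (Fin.natAdd _ (newIndex w H.left t ht)) = ⟨w t, ht⟩ := fun t ht =>
      (Fin.append_right _ _ _).trans (Subtype.ext (congrArg (fun x : w ⁻¹' H.left => w x.1)
        ((Finite.equivFin (w ⁻¹' H.left)).symm_apply_apply ⟨t, ht⟩)))
    have hg' : ∀ t ht, g (Fin.natAdd _ (newIndex w H.right t ht)) = ⟨w t, ht⟩ := fun t ht =>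
      (Fin.append_right _ _ _).trans (Subtype.ext (congrArg (fun x : w ⁻¹' H.right => w x.1)
        ((Finite.equivFin (w ⁻¹' H.right)).symm_apply_apply ⟨t, ht⟩)))
    have hfg : ∀ x ∈ (G.extend (numLabels w H.left) (numLabels w H.right)).edges,
        H.graph.Adj (f x.1) (g x.2) := by
      intro x hx
      obtain ⟨y, hy, rfl⟩ := List.mem_map.1 hx
      simp only [hf, hg]
      exact σ.1.map_rel (show G.Adj (.inl y.1) (.inr y.2) from hy)
    refine ⟨⟨BipInput.homOfSides _ H f g hfg, fun t => ?_⟩, Hom.ext ?_⟩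
    · rcases Set.eq_univ_iff_forall.1 H.cover (w t) with ht | ht
      · rw [newVertex_left w G ht]
        exact congrArg Subtype.val (hf' t ht)
      · rw [newVertex_right w G ht]
        exact congrArg Subtype.val (hg' t ht)
    · rintro (i | j)
      · exact congrArg Subtype.val (hf i)
      · exact congrArg Subtype.val (hg j)

open Classical in
/-- The data of the new vertex for a label, with an additional code word. -/
noncomputable def newVertexDatum (H : BipGraph V) (c : List Bool) (t : Fin r) :
    Bool × ℕ × List Bool :=
  if h : w t ∈ H.left then (false, (newIndex w H.left t h).1, c)
  else (true, (newIndex w H.right t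
    ((Set.eq_univ_iff_forall.1 H.cover (w t)).resolve_left h)).1, c)

theorem newVertexDatum_left {c : List Bool} {t : Fin r} (h : w t ∈ H.left) :
    newVertexDatum w H c t = (false, (newIndex w H.left t h).1, c) := dif_pos h

theorem newVertexDatum_right {c : List Bool} {t : Fin r} (h : w t ∈ H.right) :
    newVertexDatum w H c t = (true, (newIndex w H.right t h).1, c) :=
  dif_neg (not_mem_left_of_mem_right h)

/-- The data of the new vertices, with additional code words. -/
noncomputable def newVertexData (H : BipGraph V) (c : Fin r → List Bool) :
    List (Bool × ℕ × List Bool) :=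
  (List.ofFn id).map fun t => newVertexDatum w H (c t) t

theorem listCode_newVertexData (c : Fin r → List Bool) :
    listCode (newVertexCode G.a G.b) (newVertexData w H c) =
      listCode (fun t => (G.extend (numLabels w H.left) (numLabels w H.right)).vertexCode
        (newVertex w G H t) ++ c t) (List.ofFn id) := by
  rw [newVertexData, listCode_map]
  congr 1
  funext t
  rcases Set.eq_univ_iff_forall.1 H.cover (w t) with ht | ht
  · simp [newVertexCode, newVertex_left w G ht, newVertexDatum_left w ht, BipInput.vertexCode]
  · simp [newVertexCode, newVertex_right w G ht, newVertexDatum_right w ht, BipInput.vertexCode]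

/-- Counting homomorphisms to `H` reduces to a problem whose instances include the extended
graphs. -/
theorem bipHomsTo_turingReduces {p : ℕ} (hp : p.Prime) (A : FunProblem) (c : Fin r → List Bool)
    (h : ∀ G : BipInput, ∃ x : A.Inst, A.code x =
      (G.extend (numLabels w H.left) (numLabels w H.right)).code ++
        listCode (fun t => (G.extend (numLabels w H.left) (numLabels w H.right)).vertexCode
          (newVertex w G H t) ++ c t) (List.ofFn id) ∧
      A.answer x = natCode
        ((G.extend (numLabels w H.left) (numLabels w H.right)).toBipGraph.numPinnedHom
          (newVertex w G H) H w % p)) :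
    (bipHomsTo H p).TuringReduces A := by
  let B := numLabels w H.left + numLabels w H.right + p + ∑ t, (c t).length
  open Polynomial in
  refine ⟨askExtended (numLabels w H.left) (numLabels w H.right) (newVertexData w H c),
    C (newVertexData w H c).length * (4 * C B + 10 * X + 13) + 20 * X + 10 * C B + 20, ?_⟩
  intro O hO (G : BipInput)
  obtain ⟨x, hx, ha⟩ := h G
  have hOx := hO x
  rw [hx, ha, numPinnedHom_extend, BipInput.extend_code, ← listCode_newVertexData] at hOx
  have hlt := Nat.mod_lt (G.toBipGraph.numHom H) hp.pos
  have := outputsWithin_askExtended (B := B) ?_ ?_ ?_ ?_ hOx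
  · refine Eq.mp ?_ this
    simp only [Polynomial.eval_add, Polynomial.eval_mul, Polynomial.eval_C, Polynomial.eval_X,
      Polynomial.eval_ofNat]
    rfl
  · simp only [newVertexData, List.mem_map, List.mem_ofFn, forall_exists_index, and_imp,
      forall_apply_eq_imp_iff, id_eq]
    intro t
    have hc := Finset.single_le_sum (f := fun t => (c t).length) (fun _ _ => Nat.zero_le _)
      (Finset.mem_univ t)
    rcases Set.eq_univ_iff_forall.1 H.cover (w t) with ht | ht
    · have := (newIndex w H.left t ht).2
      rw [newVertexDatum_left w ht]
      exact ⟨by simp only; omega, by simp only; omega⟩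
    · have := (newIndex w H.right t ht).2
      rw [newVertexDatum_right w ht]
      exact ⟨by simp only; omega, by simp only; omega⟩
  · omega
  · omega
  · rw [length_natCode]
    omega

theorem bipHomsTo_turingReduces_fixed {p : ℕ} (hp : p.Prime) :
    (bipHomsTo H p).TuringReduces (bipPartLabHomsToFixed H w p) := by
  refine bipHomsTo_turingReduces w hp _ (fun _ => []) fun G =>
    ⟨⟨G.extend (numLabels w H.left) (numLabels w H.right), newVertex w G H⟩, ?_, rfl⟩
  simp only [List.append_nil]
  rw [← listCode_map, List.map_ofFn]
  rfl

/-- A single pin to an arbitrary vertex `v` is enough, since an instance needs a positive number of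
pins. -/
theorem bipHomsTo_turingReduces_of_nonempty {m : ℕ} (e : V ≃ Fin m) (v : V) {p : ℕ}
    (hp : p.Prime) : (bipHomsTo H p).TuringReduces (bipPartLabHomsTo e H p) := by
  refine bipHomsTo_turingReduces (fun _ : Fin 1 => v) hp _ (fun _ => natCode (e v)) fun G =>
    ⟨⟨G.extend _ _, 1, Nat.one_pos, newVertex (fun _ => v) G H, fun _ => v⟩, ?_, rfl⟩
  refine congrArg (BipInput.code _ ++ ·) (Eq.trans ?_ (listCode_map
    (fun y : (G.extend (numLabels (fun _ => v) H.left) (numLabels (fun _ => v) H.right)).Vertex × V =>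
      BipInput.vertexCode _ y.1 ++ natCode (e y.2))
    (fun t : Fin 1 => (newVertex (fun _ => v) G H t, v)) (List.ofFn id)))
  rw [List.map_ofFn]
  rfl

/-- No query is made: the count is `1` if `G` has no vertices and `0` otherwise. The first bit of
each of the two unary sizes decides this in constant time. -/
theorem bipHomsTo_turingReduces_of_isEmpty [IsEmpty V] {p : ℕ} (hp : p.Prime) (A : FunProblem) :
    (bipHomsTo H p).TuringReduces A := by
  refine ⟨.cond 0 topTrue (write 1 (natCode 0)) (.seq (.pop 0) (.cond 0 topTrue
    (write 1 (natCode 0)) (write 1 (natCode 1)))), Polynomial.C 10, fun O _ G => ?_⟩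
  have hzero : ∀ v : G.Vertex, (bipHomsTo H p).answer G = natCode 0 := by
    intro v
    have : IsEmpty (G.toBipGraph.Hom H) := ⟨fun σ => isEmptyElim (σ.1 v)⟩
    simp [bipHomsTo, numHom]
  have key : ∃ s', RunsWithin O (.cond 0 topTrue (write 1 (natCode 0)) (.seq (.pop 0)
      (.cond 0 topTrue (write 1 (natCode 0)) (write 1 (natCode 1)))))
      (initStore ((bipHomsTo H p).code G)) s' 10 ∧ s' 1 = (bipHomsTo H p).answer G := by
    obtain ⟨a, b, E⟩ := G
    have hw : ∀ n s, RunsWithin O (write 1 (natCode n)) s (update s 1 (natCode n ++ s 1))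
        (n + 2) := fun n s => (runsWithin_write 1 _ s).mono (by rw [length_natCode])
    have h0 : initStore ((bipHomsTo H p).code ⟨a, b, E⟩) 0 =
        natCode a ++ (natCode b ++ listCode
          (fun e : Fin a × Fin b => natCode e.1 ++ natCode e.2) E) := by
      simp [initStore, bipHomsTo, BipInput.code]
    have h1 : initStore ((bipHomsTo H p).code ⟨a, b, E⟩) 1 = [] := by
      simp [initStore]
    generalize initStore ((bipHomsTo H p).code ⟨a, b, E⟩) = s at *
    cases a with
    | succ a =>
      refine ⟨_, (RunsWithin.cond_true (by rw [h0, topTrue_natCode_append]; simp)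
        (hw 0 _)).mono (by omega), ?_⟩
      simp [h1, hzero (.inl 0)]
    | zero =>
      have ht : (s 0).tail = natCode b ++ listCode
          (fun e : Fin 0 × Fin b => natCode e.1 ++ natCode e.2) E := by
        rw [h0]; rfl
      cases b with
      | succ b =>
        refine ⟨_, (RunsWithin.cond_false (by rw [h0, topTrue_natCode_append]; simp)
          ((RunsWithin.pop 0).seq (RunsWithin.cond_true
            (by rw [update_self, ht, topTrue_natCode_append]; simp) (hw 0 _)))).mono
          (by omega), ?_⟩
        simp [h1, hzero (.inr 0)]
      | zero =>
        refine ⟨_, (RunsWithin.cond_false (by rw [h0, topTrue_natCode_append]; simp)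
          ((RunsWithin.pop 0).seq (RunsWithin.cond_false
            (by rw [update_self, ht, topTrue_natCode_append]; simp) (hw 1 _)))).mono
          (by omega), ?_⟩
        have hv : ∀ v : (⟨0, 0, E⟩ : BipInput).Vertex, False := by
          rintro (i | i) <;> exact i.elim0
        have hone : Nat.card ((⟨0, 0, E⟩ : BipInput).toBipGraph.Hom H) = 1 := by
          rw [Nat.card_eq_one_iff_unique]
          exact ⟨⟨fun σ τ => Hom.ext fun v => (hv v).elim⟩, ⟨BipInput.homOfSides _ H
            (fun i => i.elim0) (fun i => i.elim0) fun x => x.1.elim0⟩⟩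
        simp [h1, bipHomsTo, numHom, hone, Nat.mod_eq_of_lt hp.one_lt]
  obtain ⟨s', ⟨t, ht, hr⟩, hs'⟩ := key
  exact ⟨t, s', hr, by simpa using ht, hs'⟩

end extension

end

theorem mainTheorem7 {V : Type*} {m : ℕ} (e : V ≃ Fin m) (H : BipGraph V) (p : ℕ) (hp : p.Prime)
    (hH : H.PartitionwiseReduced p) :
    FunProblem.TuringEquivalent (bipPartLabHomsTo e H p) (bipHomsTo H p) ∧
      ∀ (r : ℕ) (w : Fin r → V), 0 < r →
        FunProblem.TuringEquivalent (bipPartLabHomsToFixed H w p) (bipHomsTo H p) := by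
  have : Finite V := Finite.of_equiv _ e.symm
  refine ⟨⟨turingReduces_bipPartLabHomsTo e hp hH, ?_⟩, fun r w _ =>
    ⟨turingReduces_bipPartLabHomsToFixed hp hH e w, bipHomsTo_turingReduces_fixed w hp⟩⟩
  -- If `H` has no vertices, no label exists and the labelled problem has no instances, so the
  -- oracle is of no help and plain counting is done directly.
  rcases isEmpty_or_nonempty V with hV | ⟨⟨v⟩⟩
  · exact bipHomsTo_turingReduces_of_isEmpty hp _
  · exact bipHomsTo_turingReduces_of_nonempty e v hp
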